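/- **Setting.** Let $N_t,N_x\ge 1$ and $N_\gamma\in\mathbb Z$. The square lattice on the twisted torus has nodes $(t,x)$, $0\le t<N_t$, $0\le x<N_x$, with the identifications $(t,N_x)\equiv(t,0)$ and $(N_t,x)\equiv(0,x+N_\gamma)$; a horizontal link goes from $(t,x)$ to $(t,x+1)$ and a vertical link from $(t,x)$ to $(t+1,x)$. For $\mathrm{SU}(2)$ holonomies $h^{(h)}_{t,x},h^{(v)}_{t,x}$ on these links and spins $T_{t,x},L_{t,x}\in\frac12\mathbb N$, let (with normalized Haar measures, $|{\uparrow}\rangle=(1,0)$, $|{+}\rangle=\frac1{\sqrt2}(1,1)$) $$\psi_{LS}(h)=\int\prod_{t,x}dg_{t,x}\prod_{t,x}\langle\uparrow|g_{t,x+1}^{-1}h^{(h)}_{t,x}g_{t,x}|\uparrow\rangle^{2T_{t,x}}\,\langle+|g_{t+1,x}^{-1}h^{(v)}_{t,x}g_{t,x}|+\rangle^{2L_{t,x}} .$$ The coherent spin network state with couplings $\lambda,\tau\in\mathbb C$ is $$\psi_{\lambda,\tau}(h)=\sum_{\{T,L\}}\ \prod_{t,x}\frac{\lambda^{2L_{t,x}}\tau^{2T_{t,x}}}{(2L_{t,x})!\,(2T_{t,x})!}(J_{t,x}+1)!\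 \ \psi_{LS}(h),\qquad J_{t,x}=T_{t,x}+L_{t,x}+T_{t,x-1}+L_{t-1,x},$$ for small couplings, and its analytic continuation in $(\lambda,\tau)$ otherwise. (Terms in which some $J_{t,x}$ is not an integer vanish.) For $H\in \mathrm{SU}(2)$ let $\psi_{\lambda,\tau}(H)$ be the state evaluated at $h^{(v)}_{N_t-1,x}=H$ for all $x$ and at the identity on all other links. The Ponzano–Regge partition function of the twisted solid torus is $Z=\int_{\mathrm{SU}(2)}dH\,\psi_{\lambda,\tau}(H)$. **Proposition.** Let $K=\gcd(N_\gamma,N_x)$, $N_x=Kn_x$ with $n_x>2$, and $\gamma=2\pi N_\gamma/N_x$. Let $\lambda,\tau\in\mathbb C\setminus\{0\}$ satisfy $\lambda^2+\tau^2=1$, and suppose that $\lambda\cos\theta\ne1$ for all real $\theta$ and $\tau\cos(2\pi k/N_x)\neq1$ for all integers $k\ge 0$ (for instance $0<\lambda,\tau<1$). Write $X_a$ for any complex number with $\cosh X_a=a$ and $\mathrm{Re}\,X_a\ge0$. Then for every $H\in\mathrm{SU}(2)$ the continuation $\psi_{\lambda,\tau}(H)$ exists and has exactly one value, it is integrable in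 $H$, and $$Z=\frac{2^{N_t(N_x-2)-K}\,n_x^K}{(\lambda\tau)^{N_tN_x}\,\sinh^{2N_t}\!\big(\tfrac12N_xX_{\tau^{-1}}\big)\,\sinh^K\!\big(N_tX_{\lambda^{-1}}\big)}\;L_{K-1}\!\big(\coth(n_xN_tX_{\lambda^{-1}})\big)\prod_{\substack{1\le k\le N_x-1\\ n_x\nmid k}}\frac1{2\big(\cosh(N_tX_{\lambda^{-1}})-\cos(\gamma k+iN_tX_{\lambda^{-1}})\big)}$$ $$\phantom{Z}=\frac{2^{N_t(N_x-2)-K}}{(\lambda\tau)^{N_tN_x}\,\sinh^{2N_t}\!\big(\tfrac12N_xX_{\tau^{-1}}\big)\,\sinh^K\!\big(n_xN_tX_{\lambda^{-1}}\big)}\;L_{K-1}\!\big(\coth(n_xN_tX_{\lambda^{-1}})\big),$$ where $L_n$ is the $n$-th Legendre polynomial. -/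

import Mathlib

namespace PonzanoRegge

open MeasureTheory
open scoped Topology Nat Matrix

/-! ## The group `SU(2)` and its normalized Haar measure -/

/-- The group `SU(2)`, with the topology induced from `2 × 2` complex matrices. -/
abbrev SU2 : Type := Matrix.specialUnitaryGroup (Fin 2) ℂ

instance SU2.instIsTopologicalGroup : IsTopologicalGroup SU2 where
  continuous_mul := Continuous.subtype_mk
    ((continuous_subtype_val.comp continuous_fst).mul
      (continuous_subtype_val.comp continuous_snd)) _
  continuous_inv := Continuous.subtype_mk continuous_subtype_val.star _

instance SU2.instCompactSpace : CompactSpace SU2 := by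
  refine isCompact_iff_compactSpace.mp ?_
  have hbox : IsCompact (Set.pi Set.univ fun _ : Fin 2 => Set.pi Set.univ fun _ : Fin 2 =>
      Metric.closedBall (0 : ℂ) 1) :=
    isCompact_univ_pi fun _ => isCompact_univ_pi fun _ => isCompact_closedBall _ _
  refine IsCompact.of_isClosed_subset hbox ?_ ?_
  · have h : ((Matrix.specialUnitaryGroup (Fin 2) ℂ : Submonoid (Matrix (Fin 2) (Fin 2) ℂ)) :
        Set (Matrix (Fin 2) (Fin 2) ℂ)) = {A | A * star A = 1} ∩ {A | A.det = 1} := by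
      ext A
      simp [Matrix.mem_specialUnitaryGroup_iff, Matrix.mem_unitaryGroup_iff]
    rw [h]
    exact (isClosed_eq (continuous_id.mul continuous_id.star) continuous_const).inter
      (isClosed_eq continuous_id.matrix_det continuous_const)
  · intro A hA i _ j _
    simpa using entry_norm_bound_of_unitary (Matrix.mem_specialUnitaryGroup_iff.mp hA).1 i j

noncomputable instance SU2.instMeasurableSpace : MeasurableSpace SU2 := borel SU2

instance SU2.instBorelSpace : BorelSpace SU2 := ⟨rfl⟩

/-- The Haar measure on `SU(2)` of total mass `1`. -/
noncomputable def haarSU2 : Measure SU2 := Measure.haarMeasure ⊤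

/-! ## The square lattice on the twisted torus -/

/-- The nodes `(t, x)`, with `t ∈ {0, …, Nt - 1}` the time slice and `x ∈ {0, …, Nx - 1}` the
position in space, as residues. -/
abbrev Node (Nt Nx : ℕ) : Type := ZMod Nt × ZMod Nx

/-- The target `(t, x + 1)` of the horizontal link that leaves the node `(t, x)`. -/
def right {Nt Nx : ℕ} : Node Nt Nx ≃ Node Nt Nx where
  toFun p := (p.1, p.2 + 1)
  invFun p := (p.1, p.2 - 1)
  left_inv p := by simp
  right_inv p := by simp

/-- The target `(t + 1, x)` of the vertical link that leaves the node `(t, x)`, where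
`(Nt, x) ≡ (0, x + Nγ)`: the last slice is glued back to the first one with a shift by `Nγ`. -/
def up {Nt Nx : ℕ} (Nγ : ℤ) : Node Nt Nx ≃ Node Nt Nx where
  toFun p := (p.1 + 1, if p.1 + 1 = 0 then p.2 + (Nγ : ZMod Nx) else p.2)
  invFun p := (p.1 - 1, if p.1 = 0 then p.2 - (Nγ : ZMod Nx) else p.2)
  left_inv p := by
    refine Prod.ext (by simp) ?_
    by_cases h : p.1 + 1 = 0 <;> simp [h]
  right_inv p := by
    refine Prod.ext (by simp) ?_
    by_cases h : p.1 = 0 <;> simp [h]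

/-! ## Coherent spin networks -/

/-- The spinor `|↑⟩`. -/
def ketUp : Fin 2 → ℂ := ![1, 0]

/-- The spinor `|+⟩ = (|↑⟩ + |↓⟩) / √2`. -/
noncomputable def ketPlus : Fin 2 → ℂ := ![1 / (Real.sqrt 2 : ℂ), 1 / (Real.sqrt 2 : ℂ)]

/-- The diagonal matrix element `⟨ξ| g |ξ⟩`. -/
noncomputable def braket (ξ : Fin 2 → ℂ) (g : SU2) : ℂ :=
  star ξ ⬝ᵥ ((g : Matrix (Fin 2) (Fin 2) ℂ) *ᵥ ξ)

/-- The spin network wave-function with rectangular coherent intertwiners (group averaging at every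
node), as a function of the holonomies `hH p` and `hV p` along the horizontal and the vertical link
that leave the node `p`. The spins of these links are `a p / 2` and `b p / 2`, so that the
exponents are `a p` and `b p`. -/
noncomputable def spinNetwork {Nt Nx : ℕ} [NeZero Nt] [NeZero Nx] (Nγ : ℤ)
    (hH hV : Node Nt Nx → SU2) (a b : Node Nt Nx → ℕ) : ℂ :=
  ∫ g : Node Nt Nx → SU2,
    ∏ p, braket ketUp ((g (right p))⁻¹ * hH p * g p) ^ a p *
      braket ketPlus ((g (up Nγ p))⁻¹ * hV p * g p) ^ b p
    ∂(Measure.pi fun _ => haarSU2)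

/-- Twice the sum `J` of the spins of the four links around the node `p`. -/
def twiceNodeSpin {Nt Nx : ℕ} (Nγ : ℤ) (a b : Node Nt Nx → ℕ) (p : Node Nt Nx) : ℕ :=
  a p + b p + a (right.symm p) + b ((up Nγ).symm p)

/-- The term of the coherent spin superposition for the spins `c.1 / 2` (horizontal links, coupling
`tau`) and `c.2 / 2` (vertical links, coupling `lam`). The factor at a node is `(J + 1)!`; when `J`
is a half-integer at some node, no intertwiner exists there and `spinNetwork` vanishes, so that the
rounding in that case does not matter. -/
noncomputable def coherentTerm {Nt Nx : ℕ} [NeZero Nt] [NeZero Nx] (Nγ : ℤ)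
    (hH hV : Node Nt Nx → SU2) (lam tau : ℂ)
    (c : (Node Nt Nx → ℕ) × (Node Nt Nx → ℕ)) : ℂ :=
  (∏ p, lam ^ c.2 p * tau ^ c.1 p / (((c.2 p)! : ℂ) * ((c.1 p)! : ℂ)) *
      ((twiceNodeSpin Nγ c.1 c.2 p / 2 + 1)! : ℂ)) *
    spinNetwork Nγ hH hV c.1 c.2

/-- `v` is the value at the couplings `(lam, tau)` of an analytic continuation, to some connected
open set of `ℂ²` that contains the origin and `(lam, tau)`, of the coherent spin network series,
which converges for small couplings. -/
def IsBoundaryStateValue {Nt Nx : ℕ} [NeZero Nt] [NeZero Nx] (Nγ : ℤ)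
    (hH hV : Node Nt Nx → SU2) (lam tau v : ℂ) : Prop :=
  ∃ (U : Set (ℂ × ℂ)) (F : ℂ × ℂ → ℂ),
    IsOpen U ∧ IsPreconnected U ∧ (0 : ℂ × ℂ) ∈ U ∧ (lam, tau) ∈ U ∧
    AnalyticOnNhd ℂ F U ∧
    (∀ᶠ q in 𝓝 (0 : ℂ × ℂ), HasSum (coherentTerm Nγ hH hV q.1 q.2) (F q)) ∧
    F (lam, tau) = v

/-- The coherent spin network wave-function with homogeneous couplings: the spin series, continued
analytically in the couplings outside its domain of convergence. -/
noncomputable def boundaryState {Nt Nx : ℕ} [NeZero Nt] [NeZero Nx] (Nγ : ℤ)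
    (hH hV : Node Nt Nx → SU2) (lam tau : ℂ) : ℂ :=
  Classical.epsilon (IsBoundaryStateValue Nγ hH hV lam tau)

/-! ## The Ponzano-Regge partition function of the twisted solid torus -/

/-- The trivial holonomy along the horizontal links. -/
def horizontalHolonomy {Nt Nx : ℕ} : Node Nt Nx → SU2 := fun _ => 1

/-- The holonomy `H` along the vertical links that leave the last time slice `t = Nt - 1`, and the
trivial one along all other vertical links. -/
def verticalHolonomy {Nt Nx : ℕ} (H : SU2) : Node Nt Nx → SU2 :=
  fun p => if p.1 + 1 = 0 then H else 1

/-- The Ponzano-Regge partition function of the twisted solid torus: the boundary state integrated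
over the holonomy `H` around the non-contractible cycle. -/
noncomputable def partitionFunction (Nt Nx : ℕ) [NeZero Nt] [NeZero Nx] (Nγ : ℤ)
    (lam tau : ℂ) : ℂ :=
  ∫ H : SU2, boundaryState (Nt := Nt) (Nx := Nx) Nγ
    horizontalHolonomy (verticalHolonomy H) lam tau ∂haarSU2

/-! ## Special functions -/

/-- `X` is an inverse hyperbolic cosine of `a` with non-negative real part. -/
def IsArcosh (X a : ℂ) : Prop := Complex.cosh X = a ∧ 0 ≤ X.re

/-- The `n`-th Legendre polynomial, by Rodrigues' formula. -/
noncomputable def legendre (n : ℕ) : Polynomial ℂ :=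
  Polynomial.C (1 / (2 ^ n * (n ! : ℂ))) *
    Polynomial.derivative^[n] ((Polynomial.X ^ 2 - 1) ^ n)

end PonzanoRegge

/-!
Each factor `(J + 1)!` of the coherent superposition is the radial part of a Gaussian integral over
a spinor in `ℂ²`, of which Haar integration over `SU(2)` is the angular part. So every term of the
spin series is a Gaussian integral of a monomial in link forms (`coherentTerm_eq_integral`), and for
small couplings the series sums up to the Gaussian integral of an exponential. In suitable complex
coordinates, and for a diagonal holonomy `diag(μ, μ⁻¹)`, to which the general one reduces by
conjugation, the exponent is a sesquilinear form with matrix `M`, linear in the couplings; the sum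
is `1 / det (1 - M)` (`hasSum_coherentTerm_diagonal`). Since the determinant is a polynomial in the
couplings, this is also the only possible value of the continuation wherever the determinant does
not vanish, and the continuation reaches all these points (`isBoundaryStateValue_iff`).

On the critical locus `λ² + τ² = 1` the determinant splits into those of `1 - τ (R + R⁻¹) / 2` and
`1 - λ (V + V⁻¹) / 2`, where `R` and `V` are the shifts along the two directions of the twisted
torus (`det_one_sub_couplingMatrix`). All cycles of `right` have length `Nx` and all cycles of `up` have
length `Nt nx`, which gives both determinants in closed form. The boundary state becomes
`C / (cosh (nx Nt X) - T (tr H / 2)) ^ K`, where `T` is the Chebyshev polynomial of degree `nx`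
(`isBoundaryStateValue_critical_iff`).

The class angle `θ` of a Haar distributed rotation has the density `(1 - cos 2θ) / 2π`. For `nx > 2`
its nonconstant part is orthogonal to all functions of `nx θ` of period `2π`, so that `T (tr H / 2)` is distributed like the cosine of a uniform
angle (`integral_comp_chebyshev_halfTrace`). What remains is Laplace's integral for the Legendre
polynomials (`integral_laplace`). The second form of the result follows, and the first one is
equivalent to it by a product formula for the Fourier modes that are not multiples of `nx`
(`prod_modes`).
-/

namespace PonzanoRegge

open MeasureTheory
open scoped Topology Nat Matrix

/-! ### Determinants of weighted permutation matrices -/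

section LinkMatrix

variable {α : Type*} [DecidableEq α]

/-- The matrix of the operator that moves the basis vector at `p` to the one at `σ p`, with the
weight `c p`. -/
def linkMatrix (σ : Equiv.Perm α) (c : α → ℂ) : Matrix α α ℂ :=
  Matrix.of fun q p => if q = σ p then c p else 0

lemma linkMatrix_one : linkMatrix (1 : Equiv.Perm α) (fun _ => 1) = 1 := by
  ext q p
  simp [linkMatrix, Matrix.one_apply]
  rfl

lemma linkMatrix_conjTranspose (σ : Equiv.Perm α) (c : α → ℂ) :
    (linkMatrix σ c)ᴴ = linkMatrix σ.symm (fun p => star (c (σ.symm p))) := by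
  ext q p
  by_cases h : p = σ q
  · subst h; simp [linkMatrix]
  · have h' : q ≠ σ.symm p := fun e => h (by simp [e])
    simp [linkMatrix, h, h']

variable [Fintype α]

lemma linkMatrix_mul (σ τ : Equiv.Perm α) (c d : α → ℂ) :
    linkMatrix σ c * linkMatrix τ d = linkMatrix (τ.trans σ) (fun p => c (τ p) * d p) := by
  ext q p
  simp [linkMatrix, Matrix.mul_apply]
  rfl

lemma linkMatrix_mul_conjTranspose (σ : Equiv.Perm α) (c : α → ℂ) (hc : ∀ p, c p * star (c p) = 1) :
    linkMatrix σ c * (linkMatrix σ c)ᴴ = 1 := by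
  rw [linkMatrix_conjTranspose, linkMatrix_mul, ← linkMatrix_one]
  congr 1
  · ext p; simp
  · ext p; exact hc _

lemma linkMatrix_pow (σ : Equiv.Perm α) (n : ℕ) :
    linkMatrix σ (fun _ => 1) ^ n = linkMatrix (σ ^ n) (fun _ => 1) := by
  induction n with
  | zero => simp [linkMatrix_one]
  | succ n ih =>
    rw [pow_succ, ih, linkMatrix_mul]
    simp [pow_succ, Equiv.Perm.mul_def]

/-- Conjugation by the diagonal matrix of `f` multiplies the weight of the step `p ↦ σ p` by
`f (σ p) / f p`, and leaves the characteristic polynomial unchanged. -/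
lemma det_sub_linkMatrix_gauge (σ : Equiv.Perm α) (c d f : α → ℂ) (hf : ∀ p, f p ≠ 0)
    (h : ∀ p, f (σ p) * c p = d p * f p) (z : ℂ) :
    (z • (1 : Matrix α α ℂ) - linkMatrix σ d).det =
      (z • (1 : Matrix α α ℂ) - linkMatrix σ c).det := by
  have h1 : Matrix.diagonal f * Matrix.diagonal (fun p => (f p)⁻¹) = 1 := by
    rw [Matrix.diagonal_mul_diagonal]
    simp [hf]
  have h2 : z • (1 : Matrix α α ℂ) - linkMatrix σ d =
      Matrix.diagonal f * (z • (1 : Matrix α α ℂ) - linkMatrix σ c) *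
        Matrix.diagonal (fun p => (f p)⁻¹) := by
    rw [mul_sub, sub_mul, Matrix.mul_smul, mul_one, Matrix.smul_mul, h1]
    congr 1
    ext q p
    rw [Matrix.mul_diagonal, Matrix.diagonal_mul]
    by_cases hq : q = σ p
    · subst hq
      simp only [linkMatrix, Matrix.of_apply, if_true]
      rw [h, mul_inv_cancel_right₀ (hf p)]
    · simp [linkMatrix, hq]
  have h3 := congrArg Matrix.det h1
  rw [Matrix.det_mul, Matrix.det_one] at h3
  rw [h2, Matrix.det_mul, Matrix.det_mul, mul_right_comm, h3, one_mul]

lemma monic_eq_of_pow_eq {p q : Polynomial ℂ} (hp : p.Monic) (hq : q.Monic) {L : ℕ} (hL : L ≠ 0)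
    (h : p ^ L = q ^ L) : p = q := by
  apply Polynomial.eq_of_monic_of_associated hp hq
  apply associated_of_dvd_dvd
  · exact (IsIntegrallyClosed.pow_dvd_pow_iff hL).1 h.dvd
  · exact (IsIntegrallyClosed.pow_dvd_pow_iff hL).1 h.symm.dvd

/-- If the permutation `σ` has order dividing `L` and, for every `L`-th root of unity `ζ`, there is
an eigenfunction of `σ` without zeros for the eigenvalue `ζ`, then all cycles of `σ` have length
`L`. On the level of determinants: the characteristic polynomial is invariant under rotations by
`L`-th roots of unity, so its `L`-th power is the determinant of `zᴸ - σᴸ`. -/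
lemma det_sub_linkMatrix_one (σ : Equiv.Perm α) {L K : ℕ} (hL : L ≠ 0) (hσ : σ ^ L = 1)
    (hcard : Fintype.card α = L * K)
    (hf : ∀ ζ : ℂ, ζ ^ L = 1 → ∃ f : α → ℂ, (∀ p, f p ≠ 0) ∧ ∀ p, f (σ p) = ζ * f p) (z : ℂ) :
    (z • (1 : Matrix α α ℂ) - linkMatrix σ (fun _ => 1)).det = (z ^ L - 1) ^ K := by
  set P := linkMatrix σ (fun _ => 1) with hP
  have hPL : P ^ L = 1 := by
    rw [hP, linkMatrix_pow, hσ, linkMatrix_one]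
  have hrot : ∀ ζ : ℂ, ζ ^ L = 1 → ∀ w : ℂ,
      (w • (1 : Matrix α α ℂ) - ζ • P).det = (w • (1 : Matrix α α ℂ) - P).det := by
    intro ζ hζ w
    obtain ⟨f, hf0, hfζ⟩ := hf ζ hζ
    have : ζ • P = linkMatrix σ (fun _ => ζ) := by
      ext q p; simp [hP, linkMatrix]
    rw [this]
    exact det_sub_linkMatrix_gauge σ (fun _ => 1) (fun _ => ζ) f hf0 (fun p => by simp [hfζ]) w
  have hζ := Complex.isPrimitiveRoot_exp L hL
  have hpow : ∀ w : ℂ, ((w • (1 : Matrix α α ℂ) - P).det) ^ L = ((w ^ L - 1) ^ K) ^ L := by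
    intro w
    let D : Polynomial ℂ →* ℂ :=
      (Matrix.detMonoidHom (n := α) (R := ℂ)).comp
        ((Polynomial.aeval P : Polynomial ℂ →ₐ[ℂ] Matrix α α ℂ) : Polynomial ℂ →* Matrix α α ℂ)
    have hD : ∀ p, D p = (Polynomial.aeval P p).det := fun p => rfl
    have hfac : Polynomial.C w ^ L - Polynomial.X ^ L =
        ∏ ζ ∈ Polynomial.nthRootsFinset L (1 : ℂ),
          (Polynomial.C w - Polynomial.C ζ * Polynomial.X) := by
      have := (hζ.map_of_injective (Polynomial.C_injective (R := ℂ))).pow_sub_pow_eq_prod_sub_mul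
        (Polynomial.C w) Polynomial.X (Nat.pos_of_ne_zero hL)
      rw [this]
      symm
      apply Finset.prod_bij (fun ζ _ => Polynomial.C ζ)
      · intro ζ h
        rw [Polynomial.mem_nthRootsFinset (Nat.pos_of_ne_zero hL)] at h ⊢
        rw [← Polynomial.C_pow, h, Polynomial.C_1]
      · intro a _ b _ h; exact Polynomial.C_injective h
      · intro b hb
        have hb' := hb
        rw [Polynomial.mem_nthRootsFinset (Nat.pos_of_ne_zero hL)] at hb
        have hu : IsUnit b := IsUnit.of_pow_eq_one hb hL
        obtain ⟨r, hr, rfl⟩ := Polynomial.isUnit_iff.1 hu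
        refine ⟨r, ?_, rfl⟩
        rw [Polynomial.mem_nthRootsFinset (Nat.pos_of_ne_zero hL)]
        apply Polynomial.C_injective
        rw [Polynomial.C_pow, hb, Polynomial.C_1]
      · intro a _; rfl
    have h1 := congrArg D hfac
    rw [map_prod] at h1
    have h2 : ∀ ζ ∈ Polynomial.nthRootsFinset L (1 : ℂ),
        D (Polynomial.C w - Polynomial.C ζ * Polynomial.X) =
          (w • (1 : Matrix α α ℂ) - P).det := by
      intro ζ h
      rw [Polynomial.mem_nthRootsFinset (Nat.pos_of_ne_zero hL)] at h
      rw [hD, ← hrot ζ h w]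
      simp [Algebra.algebraMap_eq_smul_one]
    rw [Finset.prod_congr rfl h2, Finset.prod_const, hζ.card_nthRootsFinset] at h1
    rw [← h1, hD]
    have : (Polynomial.aeval P) (Polynomial.C w ^ L - Polynomial.X ^ L) =
        (w ^ L - 1) • (1 : Matrix α α ℂ) := by
      simp [hPL, Algebra.algebraMap_eq_smul_one, sub_smul, smul_pow]
    rw [this, Matrix.det_smul, Matrix.det_one, mul_one, hcard, mul_comm L K, pow_mul]
  have hchar : P.charpoly = (Polynomial.X ^ L - 1) ^ K := by
    apply monic_eq_of_pow_eq (Matrix.charpoly_monic P)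
      ((Polynomial.monic_X_pow_sub_C (1 : ℂ) hL).pow K) hL
    apply Polynomial.funext
    intro w
    rw [Polynomial.eval_pow, Matrix.eval_charpoly]
    have := hpow w
    simpa [Matrix.scalar_apply, ← Matrix.smul_one_eq_diagonal] using this
  have := congrArg (Polynomial.eval z) hchar
  rw [Matrix.eval_charpoly] at this
  simpa [Matrix.scalar_apply, ← Matrix.smul_one_eq_diagonal] using this

/-- The determinant of `1 - lam (V + V⁻¹) / 2` in terms of `cosh X = 1 / lam`: the operator factors
as `-(lam / 2) V⁻¹ (V - e^X) (V - e^(-X))`. -/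
lemma det_one_sub_half_add_inv (V V' : Matrix α α ℂ) (hV : V * V' = 1) {L K : ℕ} {w lam X : ℂ}
    (hL : L ≠ 0) (hw : w ≠ 0) (hlam : lam ≠ 0)
    (hX : Complex.cosh X = lam⁻¹)
    (hdet : ∀ z : ℂ, (z • (1 : Matrix α α ℂ) - V).det = (z ^ L - w) ^ K) :
    ((1 : Matrix α α ℂ) - (lam / 2) • (V + V')).det =
      (lam / 2) ^ Fintype.card α * (2 * Complex.cosh (L * X) - w - w⁻¹) ^ K := by
  set e := Complex.exp X with he
  have he0 : e ≠ 0 := Complex.exp_ne_zero X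
  have hen : Complex.exp (-X) = e⁻¹ := Complex.exp_neg X
  have hsum : e + e⁻¹ = 2 * lam⁻¹ := by
    rw [← hX, Complex.cosh, hen]; ring
  have hprod : V * ((1 : Matrix α α ℂ) - (lam / 2) • (V + V')) =
      (-(lam / 2)) • ((e • (1 : Matrix α α ℂ) - V) * (e⁻¹ • (1 : Matrix α α ℂ) - V)) := by
    have h1 : (lam / 2) * (e + e⁻¹) = 1 := by rw [hsum]; field_simp
    have h2 : (e • (1 : Matrix α α ℂ) - V) * (e⁻¹ • (1 : Matrix α α ℂ) - V) =
        1 - (e + e⁻¹) • V + V * V := by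
      simp only [sub_mul, mul_sub, Matrix.smul_mul, Matrix.mul_smul, one_mul, mul_one, smul_smul,
        inv_mul_cancel₀ he0, one_smul, add_smul]
      abel
    rw [h2, mul_sub, mul_one, Matrix.mul_smul, mul_add, hV, smul_add, smul_add, smul_sub, smul_smul]
    rw [neg_mul, h1]
    simp only [neg_smul, one_smul]
    abel
  have hdV : V.det = (-1) ^ Fintype.card α * (-w) ^ K := by
    have := hdet 0
    rw [zero_smul, zero_sub, Matrix.det_neg, zero_pow hL, zero_sub] at this
    rw [← this, ← mul_assoc, ← pow_add, Even.neg_one_pow ⟨_, rfl⟩, one_mul]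
  have h3 := congrArg Matrix.det hprod
  rw [Matrix.det_mul, Matrix.det_smul, Matrix.det_mul, hdet, hdet, hdV] at h3
  have hcosh : (-w) * (2 * Complex.cosh (L * X) - w - w⁻¹) = (e ^ L - w) * (e⁻¹ ^ L - w) := by
    have h4 : 2 * Complex.cosh (L * X) = e ^ L + e⁻¹ ^ L := by
      rw [Complex.cosh, Complex.exp_nat_mul, ← mul_neg, Complex.exp_nat_mul, hen]; ring
    have h5 : e ^ L * e⁻¹ ^ L = 1 := by rw [← mul_pow, mul_inv_cancel₀ he0, one_pow]
    rw [h4]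
    have h6 : w * w⁻¹ = 1 := mul_inv_cancel₀ hw
    linear_combination h6 - h5
  have hne : (-1 : ℂ) ^ Fintype.card α * (-w) ^ K ≠ 0 :=
    mul_ne_zero (pow_ne_zero _ (by norm_num)) (pow_ne_zero _ (neg_ne_zero.2 hw))
  apply mul_left_cancel₀ hne
  rw [h3, ← mul_pow, ← hcosh, mul_pow, neg_pow (lam / 2)]
  ring

end LinkMatrix

/-- The determinant of a `2 × 2` block matrix whose lower blocks commute. -/
lemma det_fromBlocks_of_commute {α : Type*} [Fintype α] [DecidableEq α]
    (A B C D : Matrix α α ℂ) (h : C * D = D * C) :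
    (Matrix.fromBlocks A B C D).det = (A * D - B * C).det := by
  let c : ℂ →+* Polynomial ℂ := Polynomial.C
  let ev : Polynomial ℂ →+* ℂ := Polynomial.evalRingHom 0
  -- `D` is perturbed to `D + X`, whose determinant is a nonzero polynomial.
  let D' : Matrix α α (Polynomial ℂ) := D.map c + (Polynomial.X : Polynomial ℂ) • 1
  have hD' : D'.det ≠ 0 := by
    have : D' = (-D).charmatrix := by
      simp only [D', Matrix.charmatrix, c]
      ext i j : 2
      simp [Matrix.scalar_apply, ← Matrix.smul_one_eq_diagonal, add_comm]
    rw [this]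
    exact (Matrix.charpoly_monic (-D)).ne_zero
  have hCD : C.map c * D' = D' * C.map c := by
    simp only [D', mul_add, add_mul, ← Matrix.map_mul, h, Matrix.mul_smul, Matrix.smul_mul,
      mul_one, one_mul]
  have hmul : Matrix.fromBlocks (A.map c) (B.map c) (C.map c) D' *
      Matrix.fromBlocks D' 0 (-C.map c) 1 =
      Matrix.fromBlocks (A.map c * D' - B.map c * C.map c) (B.map c) 0 D' := by
    rw [Matrix.fromBlocks_multiply]
    congr 1
    · simp [sub_eq_add_neg]
    · simp
    · simp [hCD]
    · simp
  have hdet := congrArg Matrix.det hmul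
  rw [Matrix.det_mul, Matrix.det_fromBlocks_zero₁₂, Matrix.det_fromBlocks_zero₂₁, Matrix.det_one,
    mul_one] at hdet
  have hpoly := mul_right_cancel₀ hD' hdet
  have hev := congrArg ev hpoly
  rw [RingHom.map_det, RingHom.map_det] at hev
  have hmc : ∀ M : Matrix α α ℂ, (M.map c).map ev = M := by
    intro M; ext i j; simp [c, ev]
  have hmD : D'.map ev = D := by
    ext i j; simp [D', c, ev]
  simp only [RingHom.mapMatrix_apply, Matrix.fromBlocks_map, hmc, hmD] at hev
  rw [hev]
  congr 1
  rw [Matrix.map_sub _ (by simp), Matrix.map_mul, Matrix.map_mul, hmc, hmc, hmc, hmD]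

/-! ### The link matrices of the twisted torus -/

section Lattice

variable {Nt Nx : ℕ}

lemma right_pow_apply (n : ℕ) (p : Node Nt Nx) :
    (right ^ n : Equiv.Perm (Node Nt Nx)) p = (p.1, p.2 + n) := by
  induction n with
  | zero => simp
  | succ n ih =>
    rw [pow_succ', Equiv.Perm.mul_apply, ih]
    simp [right, add_assoc]

variable [NeZero Nt]

lemma zmod_val_add_one {n : ℕ} [NeZero n] {a : ZMod n} (h : a + 1 ≠ 0) :
    (a + 1).val = a.val + 1 := by
  have h1 : a.val + 1 ≠ n := by
    intro e
    apply h
    rw [← ZMod.natCast_zmod_val a, ← Nat.cast_one, ← Nat.cast_add, e, ZMod.natCast_self]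
  have h2 := ZMod.val_lt a
  have h3 : (a + 1) = ((a.val + 1 : ℕ) : ZMod n) := by
    rw [Nat.cast_add, ZMod.natCast_zmod_val, Nat.cast_one]
  rw [h3, ZMod.val_natCast, Nat.mod_eq_of_lt (by omega)]

lemma zmod_val_of_add_one_eq_zero {n : ℕ} [NeZero n] {a : ZMod n} (h : a + 1 = 0) :
    a.val + 1 = n := by
  have h2 := ZMod.val_lt a
  have h3 : ((a.val + 1 : ℕ) : ZMod n) = 0 := by
    rw [Nat.cast_add, ZMod.natCast_zmod_val, Nat.cast_one, h]
  have := Nat.le_of_dvd (by omega) ((ZMod.natCast_eq_zero_iff _ _).1 h3)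
  omega

lemma up_pow_apply_of_lt (Nγ : ℤ) (j : ℕ) (p : Node Nt Nx) (h : p.1.val + j < Nt) :
    (up Nγ ^ j : Equiv.Perm (Node Nt Nx)) p = (p.1 + j, p.2) := by
  induction j with
  | zero => simp
  | succ j ih =>
    rw [pow_succ', Equiv.Perm.mul_apply, ih (by omega)]
    have h1 : p.1 + (j : ZMod Nt) + 1 ≠ 0 := by
      have e : p.1 + (j : ZMod Nt) + 1 = ((p.1.val + (j + 1) : ℕ) : ZMod Nt) := by
        push_cast [ZMod.natCast_zmod_val]; ring
      rw [e, Ne, ZMod.natCast_eq_zero_iff]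
      intro hd
      have := Nat.le_of_dvd (by omega) hd
      omega
    simp [up, h1, ← add_assoc]

/-- Going once around the torus in the time direction shifts the position by the twist. -/
lemma up_pow_apply (Nγ : ℤ) (p : Node Nt Nx) :
    (up Nγ ^ Nt : Equiv.Perm (Node Nt Nx)) p = (p.1, p.2 + (Nγ : ZMod Nx)) := by
  have hlt := ZMod.val_lt p.1
  have e : Nt = p.1.val + (1 + (Nt - 1 - p.1.val)) := by omega
  have h0 : p.1 + ((Nt - 1 - p.1.val : ℕ) : ZMod Nt) + 1 = 0 := by
    have : p.1 + ((Nt - 1 - p.1.val : ℕ) : ZMod Nt) + 1 =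
        ((p.1.val + (1 + (Nt - 1 - p.1.val)) : ℕ) : ZMod Nt) := by
      push_cast [ZMod.natCast_zmod_val]; ring
    rw [this, ← e, ZMod.natCast_self]
  have h : (up Nγ ^ (p.1.val + (1 + (Nt - 1 - p.1.val))) : Equiv.Perm (Node Nt Nx)) p =
      (p.1, p.2 + (Nγ : ZMod Nx)) := by
    rw [pow_add, pow_add, Equiv.Perm.mul_apply, Equiv.Perm.mul_apply,
      up_pow_apply_of_lt Nγ (Nt - 1 - p.1.val) p (by omega), pow_one]
    have h1 : up Nγ (p.1 + ((Nt - 1 - p.1.val : ℕ) : ZMod Nt), p.2) =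
        ((0 : ZMod Nt), p.2 + (Nγ : ZMod Nx)) := by
      simp [up, h0]
    rw [h1, up_pow_apply_of_lt _ _ _ (by simpa using hlt)]
    simp
  rwa [← e] at h

variable {K nx : ℕ} {Nγ : ℤ}

lemma up_pow_eq_one (hK : K = Int.gcd Nγ (Nx : ℤ)) (hNx : Nx = K * nx) :
    (up Nγ ^ (Nt * nx) : Equiv.Perm (Node Nt Nx)) = 1 := by
  have h : ∀ (n : ℕ) (p : Node Nt Nx), ((up Nγ ^ Nt : Equiv.Perm (Node Nt Nx)) ^ n) p =
      (p.1, p.2 + n * (Nγ : ZMod Nx)) := by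
    intro n p
    induction n with
    | zero => simp
    | succ n ih =>
      rw [pow_succ', Equiv.Perm.mul_apply, ih, up_pow_apply]
      push_cast; ring_nf
  ext p : 1
  rw [pow_mul, h]
  have : (nx : ZMod Nx) * (Nγ : ZMod Nx) = ((nx * Nγ : ℤ) : ZMod Nx) := by push_cast; ring
  rw [this, (ZMod.intCast_zmod_eq_zero_iff_dvd _ _).2]
  · simp
  · obtain ⟨m, hm⟩ : (K : ℤ) ∣ Nγ := by rw [hK]; exact Int.gcd_dvd_left _ _
    refine ⟨m, ?_⟩
    rw [hm]
    conv_rhs => rw [hNx]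
    push_cast; ring

variable [NeZero Nx]

lemma card_node : Fintype.card (Node Nt Nx) = Nt * Nx := by
  simp [ZMod.card]

/-- The eigenfunctions of the shift in space are the characters of the spatial circle. -/
lemma det_sub_linkMatrix_right (z : ℂ) :
    (z • (1 : Matrix (Node Nt Nx) (Node Nt Nx) ℂ) - linkMatrix right (fun _ => 1)).det =
      (z ^ Nx - 1) ^ Nt := by
  refine det_sub_linkMatrix_one right (NeZero.ne Nx) ?_ ?_ ?_ z
  · ext p : 1
    rw [right_pow_apply]; simp
  · rw [card_node, mul_comm]
  · intro ζ hζ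
    refine ⟨fun p => AddChar.zmodChar Nx hζ p.2, fun p => ?_, fun p => ?_⟩
    · exact ((AddChar.zmodChar Nx hζ).val_isUnit _).ne_zero
    · simp only [right, Equiv.coe_fn_mk, AddChar.map_add_eq_mul]
      have := AddChar.zmodChar_apply' hζ 1
      rw [Nat.cast_one, pow_one] at this
      rw [this, mul_comm]

/-- An `nx`-th root of unity is the value at the twist `Nγ` of a character of the spatial circle. -/
lemma exists_addChar_twist (hK : K = Int.gcd Nγ (Nx : ℤ)) (hNx : Nx = K * nx) {ξ : ℂ}
    (hξ : ξ ^ nx = 1) : ∃ χ : AddChar (ZMod Nx) ℂ, χ (Nγ : ZMod Nx) = ξ := by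
  have hNx0 := NeZero.ne Nx
  have hK0 : K ≠ 0 := by rintro rfl; simp at hNx; omega
  have hnx0 : nx ≠ 0 := by rintro rfl; simp at hNx; omega
  have hξ0 : ξ ≠ 0 := by rintro rfl; simp [hnx0] at hξ
  obtain ⟨θ, hθ⟩ := IsAlgClosed.exists_pow_nat_eq ξ (Nat.pos_of_ne_zero hK0)
  have hθ0 : θ ≠ 0 := by rintro rfl; rw [zero_pow hK0] at hθ; exact hξ0 hθ.symm
  have hθx : θ ^ Nx = 1 := by rw [hNx, pow_mul, hθ, hξ]
  set u := Int.gcdA Nγ (Nx : ℤ)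
  set v := Int.gcdB Nγ (Nx : ℤ)
  have hbez : (K : ℤ) = Nγ * u + Nx * v := by rw [hK]; exact Int.gcd_eq_gcd_ab _ _
  have hη : (θ ^ u) ^ Nx = 1 := by
    rw [← zpow_natCast, ← zpow_mul, mul_comm, zpow_mul, zpow_natCast, hθx, one_zpow]
  refine ⟨AddChar.zmodChar Nx hη, ?_⟩
  have h1 : AddChar.zmodChar Nx hη (1 : ZMod Nx) = θ ^ u := by
    have := AddChar.zmodChar_apply' hη 1
    rwa [Nat.cast_one, pow_one] at this
  have h2 : (Nγ : ZMod Nx) = Nγ • (1 : ZMod Nx) := by simp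
  rw [h2, AddChar.map_zsmul_eq_zpow, h1, ← zpow_mul, ← hθ, ← zpow_natCast θ K, hbez,
    zpow_add₀ hθ0, zpow_mul θ (Nx : ℤ), zpow_natCast, hθx, one_zpow, mul_one, mul_comm]

/-- The function `(t, x) ↦ ζ ^ t * χ x` is an eigenfunction of the shift in time when the character
`χ` takes the value `ζ ^ Nt` at the twist. -/
lemma det_sub_linkMatrix_up (hK : K = Int.gcd Nγ (Nx : ℤ)) (hNx : Nx = K * nx) (z : ℂ) :
    (z • (1 : Matrix (Node Nt Nx) (Node Nt Nx) ℂ) - linkMatrix (up Nγ) (fun _ => 1)).det =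
      (z ^ (Nt * nx) - 1) ^ K := by
  have hNx0 := NeZero.ne Nx
  have hnx0 : nx ≠ 0 := by rintro rfl; simp at hNx; omega
  have hL : Nt * nx ≠ 0 := mul_ne_zero (NeZero.ne Nt) hnx0
  refine det_sub_linkMatrix_one (up Nγ) hL (up_pow_eq_one hK hNx) ?_ ?_ z
  · rw [card_node, hNx]; ring
  · intro ζ hζ
    have hζ0 : ζ ≠ 0 := by rintro rfl; simp [hL] at hζ
    obtain ⟨χ, hχ⟩ := exists_addChar_twist hK hNx (ξ := ζ ^ Nt) (by rw [← pow_mul, hζ])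
    refine ⟨fun p => ζ ^ p.1.val * χ p.2, fun p => ?_, fun p => ?_⟩
    · exact mul_ne_zero (pow_ne_zero _ hζ0) (χ.val_isUnit _).ne_zero
    · by_cases h : p.1 + 1 = 0
      · simp only [up, Equiv.coe_fn_mk, h, if_true, AddChar.map_add_eq_mul, hχ, ZMod.val_zero]
        have hpow : ζ ^ Nt = ζ ^ (p.1.val + 1) := by rw [zmod_val_of_add_one_eq_zero h]
        rw [hpow]
        ring
      · simp only [up, Equiv.coe_fn_mk, h, if_false]
        rw [zmod_val_add_one h]
        ring

/-- The holonomy `mu` on the last slice is spread evenly over the slices by a gauge transformation,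
as `κ` with `κ ^ Nt = mu` on each of them. -/
lemma det_sub_linkMatrix_up_holonomy (hK : K = Int.gcd Nγ (Nx : ℤ)) (hNx : Nx = K * nx) {mu : ℂ}
    (hmu : mu ≠ 0) (z : ℂ) :
    (z • (1 : Matrix (Node Nt Nx) (Node Nt Nx) ℂ) -
      linkMatrix (up Nγ) (fun p => if p.1 + 1 = 0 then mu else 1)).det =
      (z ^ (Nt * nx) - mu ^ nx) ^ K := by
  obtain ⟨κ, hκ⟩ := IsAlgClosed.exists_pow_nat_eq mu (Nat.pos_of_ne_zero (NeZero.ne Nt))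
  have hκ0 : κ ≠ 0 := by rintro rfl; rw [zero_pow (NeZero.ne Nt)] at hκ; exact hmu hκ.symm
  rw [← det_sub_linkMatrix_gauge (up Nγ) (fun p => if p.1 + 1 = 0 then mu else 1) (fun _ => κ)
    (fun p => κ ^ p.1.val) (fun p => pow_ne_zero _ hκ0)]
  · have h1 : z • (1 : Matrix (Node Nt Nx) (Node Nt Nx) ℂ) - linkMatrix (up Nγ) (fun _ => κ) =
        κ • ((z / κ) • 1 - linkMatrix (up Nγ) (fun _ => 1)) := by
      rw [smul_sub, smul_smul, mul_div_cancel₀ _ hκ0]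
      congr 1
      ext q p; simp [linkMatrix]
    have hc : Nt * Nx = (Nt * nx) * K := by rw [hNx]; ring
    rw [h1, Matrix.det_smul, det_sub_linkMatrix_up hK hNx, card_node, hc, pow_mul, ← mul_pow,
      ← hκ, ← pow_mul, div_pow, mul_sub, mul_div_cancel₀ _ (pow_ne_zero _ hκ0), mul_one]
  · intro p
    by_cases h : p.1 + 1 = 0
    · simp only [up, Equiv.coe_fn_mk, h, if_true, ZMod.val_zero]
      rw [← hκ, ← pow_succ', zmod_val_of_add_one_eq_zero h]; simp
    · simp only [up, Equiv.coe_fn_mk, h, if_false]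
      rw [zmod_val_add_one h]
      ring

end Lattice

/-! ### The Fourier modes of the twist -/

lemma two_mul_cosh_sub_cos (θ Y : ℂ) :
    2 * (Complex.cosh Y - Complex.cos (θ + Complex.I * Y)) =
      (1 - Complex.exp (θ * Complex.I)) * Complex.exp (-Y) *
        (1 - (Complex.exp (θ * Complex.I))⁻¹ * Complex.exp (2 * Y)) := by
  have h1 : Complex.cos (θ + Complex.I * Y) =
      (Complex.exp (θ * Complex.I) * Complex.exp (-Y) +
        (Complex.exp (θ * Complex.I))⁻¹ * Complex.exp Y) / 2 := by
    rw [Complex.cos, ← Complex.exp_neg, ← Complex.exp_add, ← Complex.exp_add]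
    have e1 : (θ + Complex.I * Y) * Complex.I = θ * Complex.I + -Y := by
      linear_combination Y * Complex.I_mul_I
    have e2 : -(θ + Complex.I * Y) * Complex.I = -(θ * Complex.I) + Y := by
      linear_combination -Y * Complex.I_mul_I
    rw [e1, e2]
  have h2 : Complex.exp (2 * Y) = Complex.exp Y * Complex.exp Y := by
    rw [← Complex.exp_add]; ring_nf
  have h3 : Complex.exp (-Y) * Complex.exp Y = 1 := by rw [← Complex.exp_add]; simp
  have h4 : Complex.exp (θ * Complex.I) * (Complex.exp (θ * Complex.I))⁻¹ = 1 :=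
    mul_inv_cancel₀ (Complex.exp_ne_zero _)
  rw [h1, Complex.cosh, h2]
  linear_combination ((Complex.exp (θ * Complex.I))⁻¹ * Complex.exp Y - Complex.exp Y) * h3 -
    Complex.exp (-Y) * Complex.exp Y * Complex.exp Y * h4

lemma prod_range_one_sub_mul_inv {μ : ℂ} {n : ℕ} (hn : n ≠ 0) (hμ : IsPrimitiveRoot μ n) (s : ℂ) :
    ∏ k ∈ Finset.range n, (1 - (μ ^ k)⁻¹ * s) = 1 - s ^ n := by
  have := congrArg (Polynomial.eval (1 : ℂ))
    (X_pow_sub_C_eq_prod hμ.inv (Nat.pos_of_ne_zero hn) (rfl : s ^ n = s ^ n))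
  rw [Polynomial.eval_prod] at this
  simpa using this.symm

/-- The product over the nontrivial `n`-th roots of unity `ζ = exp (iθ)` of
`2 (cosh Y - cos (θ + iY)) = (1 - ζ) e⁻ʸ (1 - ζ⁻¹ e²ʸ)`. -/
lemma prod_nontrivial_roots {μ : ℂ} {n : ℕ} (hn : n ≠ 0) (hμ : IsPrimitiveRoot μ n) {Y : ℂ}
    (hY : Complex.sinh Y ≠ 0) :
    ∏ k ∈ Finset.range n, (if n ∣ k then 1 else
      (1 - μ ^ k) * Complex.exp (-Y) * (1 - (μ ^ k)⁻¹ * Complex.exp (2 * Y))) =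
      n * Complex.sinh (n * Y) / Complex.sinh Y := by
  obtain ⟨N, rfl⟩ := Nat.exists_eq_succ_of_ne_zero hn
  have h1 := prod_range_one_sub_mul_inv hn hμ (Complex.exp (2 * Y))
  have h2 := hμ.prod_one_sub_pow_eq_order
  rw [Finset.prod_range_succ'] at h1 ⊢
  have h3 : ∏ k ∈ Finset.range N, (if (N + 1) ∣ (k + 1) then (1 : ℂ) else
      (1 - μ ^ (k + 1)) * Complex.exp (-Y) * (1 - (μ ^ (k + 1))⁻¹ * Complex.exp (2 * Y))) =
      ∏ k ∈ Finset.range N,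
        ((1 - μ ^ (k + 1)) * Complex.exp (-Y) * (1 - (μ ^ (k + 1))⁻¹ * Complex.exp (2 * Y))) := by
    refine Finset.prod_congr rfl fun k hk => if_neg fun hd => ?_
    have := Nat.le_of_dvd (by omega) hd
    have := Finset.mem_range.1 hk
    omega
  rw [Nat.succ_eq_add_one] at *
  rw [h3, Finset.prod_mul_distrib, Finset.prod_mul_distrib, h2, Finset.prod_const,
    Finset.card_range, eq_div_iff hY]
  simp only [pow_zero, inv_one, one_mul] at h1
  have h4 : Complex.exp (2 * Y) = Complex.exp Y * Complex.exp Y := by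
    rw [← Complex.exp_add]; ring_nf
  have h5 : Complex.exp (-Y) * Complex.exp Y = 1 := by rw [← Complex.exp_add]; simp
  have h6 : Complex.sinh Y = -(1 - Complex.exp (2 * Y)) * Complex.exp (-Y) / 2 := by
    rw [Complex.sinh, h4]; linear_combination -(Complex.exp Y / 2) * h5
  have h7 : Complex.sinh (((N + 1 : ℕ) : ℂ) * Y) =
      -(1 - Complex.exp (2 * Y) ^ (N + 1)) * Complex.exp (-Y) ^ (N + 1) / 2 := by
    have h8 : Complex.exp (-Y) ^ (N + 1) * Complex.exp Y ^ (N + 1) = 1 := by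
      rw [← mul_pow, h5, one_pow]
    rw [Complex.sinh, Complex.exp_nat_mul, ← mul_neg, Complex.exp_nat_mul, h4, mul_pow]
    linear_combination -(Complex.exp Y ^ (N + 1) / 2) * h8
  rw [h6, h7, ← h1]
  simp only [dvd_zero, if_true, mul_one]
  push_cast
  ring

lemma prod_range_mul_dvd {n : ℕ} (f : ℕ → ℂ) (hf : ∀ k, f (k + n) = f k) (K : ℕ) :
    ∏ k ∈ Finset.range (K * n), f k = (∏ k ∈ Finset.range n, f k) ^ K := by
  have hf' : ∀ m k, f (m * n + k) = f k := by
    intro m k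
    induction m with
    | zero => simp
    | succ m ih => rw [← ih, ← hf (m * n + k)]; congr 1; ring
  induction K with
  | zero => simp
  | succ K ih =>
    rw [Nat.succ_mul, Finset.prod_range_add, ih, pow_succ]
    simp only [hf']

/-- The modes `k` that are not multiples of `nx` run `K` times through the nontrivial `nx`-th roots
of unity. -/
lemma prod_modes (Nx K nx : ℕ) (Nγ : ℤ) (hK : K = Int.gcd Nγ (Nx : ℤ)) (hNx : Nx = K * nx)
    (hNx0 : Nx ≠ 0) {Y : ℂ} (hY : Complex.sinh Y ≠ 0) :
    ∏ k ∈ (Finset.Icc 1 (Nx - 1)).filter (fun k => ¬ nx ∣ k),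
        2 * (Complex.cosh Y - Complex.cos (2 * (Real.pi : ℂ) * (Nγ : ℂ) / (Nx : ℂ) * (k : ℂ) +
            Complex.I * Y)) =
      (nx * Complex.sinh (nx * Y) / Complex.sinh Y) ^ K := by
  have hK0 : K ≠ 0 := by rintro rfl; simp at hNx; omega
  have hnx0 : nx ≠ 0 := by rintro rfl; simp at hNx; omega
  obtain ⟨m, hm⟩ : (K : ℤ) ∣ Nγ := by rw [hK]; exact Int.gcd_dvd_left _ _
  have hcop : m.gcd (nx : ℤ) = 1 := by
    have h := hK
    rw [hm, hNx, Nat.cast_mul, Int.gcd_mul_left, Int.natAbs_natCast] at h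
    exact Nat.eq_of_mul_eq_mul_left (Nat.pos_of_ne_zero hK0) (by rw [mul_one]; exact h.symm)
  set μ : ℂ := Complex.exp (2 * Real.pi * Complex.I / nx) ^ m with hμdef
  have hμ : IsPrimitiveRoot μ nx := (Complex.isPrimitiveRoot_exp nx hnx0).zpow_of_gcd_eq_one m hcop
  have hexp : ∀ k : ℕ, Complex.exp (2 * (Real.pi : ℂ) * (Nγ : ℂ) / (Nx : ℂ) * (k : ℂ) *
      Complex.I) = μ ^ k := by
    intro k
    rw [hμdef, ← Complex.exp_int_mul, ← Complex.exp_nat_mul, hm, hNx]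
    congr 1
    have h1 : (K : ℂ) ≠ 0 := by exact_mod_cast hK0
    have h2 : (nx : ℂ) ≠ 0 := by exact_mod_cast hnx0
    push_cast
    field_simp
  have hrange : (Finset.Icc 1 (Nx - 1)).filter (fun k => ¬ nx ∣ k) =
      (Finset.range (K * nx)).filter (fun k => ¬ nx ∣ k) := by
    ext k
    simp only [Finset.mem_filter, Finset.mem_Icc, Finset.mem_range, ← hNx]
    constructor
    · rintro ⟨h1, h2⟩; exact ⟨by omega, h2⟩
    · rintro ⟨h1, h2⟩
      have : k ≠ 0 := by rintro rfl; simp at h2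
      exact ⟨by omega, h2⟩
  rw [hrange, Finset.prod_filter, ← prod_nontrivial_roots hnx0 hμ hY]
  have : ∀ k : ℕ, (if ¬ nx ∣ k then 2 * (Complex.cosh Y -
      Complex.cos (2 * (Real.pi : ℂ) * (Nγ : ℂ) / (Nx : ℂ) * (k : ℂ) + Complex.I * Y)) else 1) =
      (if nx ∣ k then 1 else
        (1 - μ ^ k) * Complex.exp (-Y) * (1 - (μ ^ k)⁻¹ * Complex.exp (2 * Y))) := by
    intro k
    rw [two_mul_cosh_sub_cos, hexp]
    by_cases h : nx ∣ k
    · rw [if_pos h, if_neg (not_not.2 h)]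
    · rw [if_neg h, if_pos h]
  simp only [this]
  rw [prod_range_mul_dvd]
  intro k
  simp only [Nat.dvd_add_self_right, pow_add, hμ.pow_eq_one, mul_one]

/-! ### Legendre polynomials and Laplace's integral -/

/-- The expansion of the Legendre polynomials in powers of `(x - 1) / 2`. -/
lemma legendre_eval (n : ℕ) (x : ℂ) :
    (legendre n).eval x =
      ∑ k ∈ Finset.range (n + 1),
        (n.choose k : ℂ) * ((n + k).choose k : ℂ) * ((x - 1) / 2) ^ k := by
  have hcomp : ∀ (m : ℕ) (p : Polynomial ℂ), Polynomial.derivative^[m] (p.comp (Polynomial.X - 1)) =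
      (Polynomial.derivative^[m] p).comp (Polynomial.X - 1) := by
    intro m
    induction m with
    | zero => simp
    | succ m ih =>
      intro p
      rw [Function.iterate_succ_apply, Function.iterate_succ_apply, ← ih]
      congr 1
      simp [Polynomial.derivative_comp]
  have hQ : ((Polynomial.X : Polynomial ℂ) ^ 2 - 1) ^ n =
      (∑ k ∈ Finset.range (n + 1), Polynomial.C ((2 : ℂ) ^ (n - k) * (n.choose k : ℂ)) *
        Polynomial.X ^ (n + k)).comp (Polynomial.X - 1) := by
    have h : (∑ k ∈ Finset.range (n + 1), Polynomial.C ((2 : ℂ) ^ (n - k) * (n.choose k : ℂ)) *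
        Polynomial.X ^ (n + k)) = (Polynomial.X : Polynomial ℂ) ^ n * (Polynomial.X + 2) ^ n := by
      rw [add_pow, Finset.mul_sum]
      refine Finset.sum_congr rfl fun k _ => ?_
      simp only [Polynomial.C_mul, Polynomial.C_pow, map_natCast, pow_add]
      have : (Polynomial.C (2 : ℂ)) = 2 := rfl
      rw [this]; ring
    rw [h]
    simp only [Polynomial.mul_comp, Polynomial.pow_comp, Polynomial.add_comp, Polynomial.X_comp]
    rw [← mul_pow]
    congr 1
    have : (2 : Polynomial ℂ).comp (Polynomial.X - 1) = 2 := by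
      exact Polynomial.C_comp (a := (2 : ℂ))
    rw [this]; ring
  rw [legendre, hQ, hcomp, Polynomial.eval_mul, Polynomial.eval_C, Polynomial.eval_comp,
    Polynomial.iterate_derivative_sum, Polynomial.eval_finsetSum, Finset.mul_sum]
  refine Finset.sum_congr rfl fun k hk => ?_
  have hk' : k ≤ n := Nat.lt_succ_iff.1 (Finset.mem_range.1 hk)
  rw [Polynomial.iterate_derivative_C_mul, Polynomial.iterate_derivative_X_pow_eq_natCast_mul,
    Nat.descFactorial_eq_factorial_mul_choose, Nat.add_sub_cancel_left,
    Nat.choose_symm_add]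
  simp only [Polynomial.eval_mul, Polynomial.eval_C, Polynomial.eval_pow, Polynomial.eval_X,
    Polynomial.eval_natCast, Polynomial.eval_sub, Polynomial.eval_one]
  have h2 : (2 : ℂ) ^ n = 2 ^ (n - k) * 2 ^ k := by rw [← pow_add]; congr 1; omega
  have h3 : (n ! : ℂ) ≠ 0 := by exact_mod_cast Nat.factorial_ne_zero n
  rw [h2, div_pow]
  push_cast
  field_simp

/-- One factor is expanded by the Vandermonde identity, as the sum over `k` of
`m.choose k * n.choose k`; the trinomial revision absorbs `m.choose k` into the other factor. -/
lemma choose_sq_eq_sum (m n : ℕ) : ((m + n).choose n) ^ 2 =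
    ∑ k ∈ Finset.range (n + 1), n.choose k * (n + k).choose k * (m + n).choose (n + k) := by
  have hv : (m + n).choose n = ∑ k ∈ Finset.range (n + 1), m.choose k * n.choose k := by
    rw [Nat.add_choose_eq, Finset.Nat.sum_antidiagonal_eq_sum_range_succ_mk]
    refine Finset.sum_congr rfl fun k hk => ?_
    rw [Nat.choose_symm (Nat.lt_succ_iff.1 (Finset.mem_range.1 hk))]
  rw [sq]
  conv_lhs => arg 2; rw [hv]
  rw [Finset.mul_sum]
  refine Finset.sum_congr rfl fun k _ => ?_
  have := Nat.choose_mul (n := m + n) (k := n + k) (s := n) (Nat.le_add_right n k)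
  rw [Nat.add_sub_cancel, Nat.add_sub_cancel_left, Nat.choose_symm_add] at this
  rw [mul_assoc, mul_comm ((n + k).choose k), this]
  ring

lemma hasSum_choose_sq {s : ℂ} (hs : ‖s‖ < 1) (n : ℕ) :
    HasSum (fun m : ℕ => ((m + n).choose n : ℂ) ^ 2 * s ^ m)
      (∑ k ∈ Finset.range (n + 1),
        (n.choose k : ℂ) * ((n + k).choose k : ℂ) * (s ^ k / (1 - s) ^ (n + k + 1))) := by
  have h1 : ∀ k, HasSum (fun m : ℕ => ((m + n).choose (n + k) : ℂ) * s ^ m)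
      (s ^ k / (1 - s) ^ (n + k + 1)) := by
    intro k
    rw [← hasSum_nat_add_iff' k]
    have h2 : ∑ i ∈ Finset.range k, ((i + n).choose (n + k) : ℂ) * s ^ i = 0 := by
      refine Finset.sum_eq_zero fun i hi => ?_
      rw [Nat.choose_eq_zero_of_lt (by have := Finset.mem_range.1 hi; omega)]
      simp
    rw [h2, sub_zero]
    have h3 := (hasSum_choose_mul_geometric_of_norm_lt_one (n + k) hs).mul_left (s ^ k)
    rw [mul_one_div] at h3
    rw [show (fun m : ℕ => ((m + k + n).choose (n + k) : ℂ) * s ^ (m + k)) =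
      fun m : ℕ => s ^ k * (((m + (n + k)).choose (n + k) : ℂ) * s ^ m) from funext fun m => ?_]
    · exact h3
    rw [show m + (n + k) = m + k + n by omega, pow_add]
    ring
  have h4 := hasSum_sum (s := Finset.range (n + 1)) fun k _ =>
    (h1 k).mul_left ((n.choose k : ℂ) * ((n + k).choose k : ℂ))
  refine h4.congr_fun fun m => ?_
  rw [← Nat.cast_pow, choose_sq_eq_sum]
  push_cast
  rw [Finset.sum_mul]
  refine Finset.sum_congr rfl fun k _ => ?_
  ring

/-- Laplace's integral for the Legendre polynomials. With `q = e⁻ᵃ`, the integrand is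
`(2q)ⁿ⁺¹ (1 - q e^{iθ})⁻ⁿ⁻¹ (1 - q e^{-iθ})⁻ⁿ⁻¹`, and only the diagonal terms of the product of the
two binomial series survive the integration. -/
lemma integral_laplace (n : ℕ) {a : ℂ} (ha : 0 < a.re) :
    (2 * Real.pi : ℂ)⁻¹ * ∫ θ in (0 : ℝ)..(2 * Real.pi),
      ((Complex.cosh a - Complex.cos θ) ^ (n + 1))⁻¹ =
      (legendre n).eval (Complex.cosh a / Complex.sinh a) / Complex.sinh a ^ (n + 1) := by
  set q := Complex.exp (-a) with hq
  have hq0 : q ≠ 0 := Complex.exp_ne_zero _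
  have hqn : ‖q‖ < 1 := by
    rw [hq, Complex.norm_exp]; simpa using ha
  have hEq : Complex.exp a = q⁻¹ := by rw [hq, Complex.exp_neg, inv_inv]
  let e : ℝ → ℂ := fun θ => Complex.exp (θ * Complex.I)
  have he0 : ∀ θ, e θ ≠ 0 := fun θ => Complex.exp_ne_zero _
  have hen : ∀ θ, ‖e θ‖ = 1 := fun θ => Complex.norm_exp_ofReal_mul_I θ
  have hfac : ∀ θ : ℝ, ((Complex.cosh a - Complex.cos θ) ^ (n + 1))⁻¹ =
      (2 * q) ^ (n + 1) * (1 / (1 - q * e θ) ^ (n + 1) * (1 / (1 - q * (e θ)⁻¹) ^ (n + 1))) := by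
    intro θ
    have h1 : Complex.cosh a - Complex.cos θ =
        (2 * q)⁻¹ * ((1 - q * e θ) * (1 - q * (e θ)⁻¹)) := by
      have h2 : Complex.cos θ = (e θ + (e θ)⁻¹) / 2 := by
        rw [Complex.cos, ← Complex.exp_neg]
        simp only [e, neg_mul]
      have h3 := he0 θ
      rw [h2, Complex.cosh, hEq, ← hq]
      field_simp
      ring
    rw [h1, mul_pow, mul_inv, inv_pow, inv_inv, mul_pow (1 - q * e θ), mul_inv, one_div, one_div]
  let c : ℕ → ℂ := fun m => ((m + n).choose n : ℂ)
  let F : ℕ × ℕ → ℝ → ℂ := fun x θ => (c x.1 * (q * e θ) ^ x.1) * (c x.2 * (q * (e θ)⁻¹) ^ x.2)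
  have hs1 : Summable fun m => ‖c m * q ^ m‖ :=
    (hasSum_choose_mul_geometric_of_norm_lt_one n hqn).summable.norm
  have hb : Summable fun x : ℕ × ℕ => ‖c x.1 * q ^ x.1‖ * ‖c x.2 * q ^ x.2‖ :=
    hs1.mul_of_nonneg hs1 (fun _ => norm_nonneg _) (fun _ => norm_nonneg _)
  have hFn : ∀ x θ, ‖F x θ‖ = ‖c x.1 * q ^ x.1‖ * ‖c x.2 * q ^ x.2‖ := by
    intro x θ
    simp [F, hen, mul_pow]
  have hcont : ∀ x, Continuous (F x) := by
    intro x
    have h1 : Continuous e := (Complex.continuous_ofReal.mul continuous_const).cexp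
    have h2 : Continuous fun θ => (e θ)⁻¹ := h1.inv₀ he0
    exact (((h1.const_mul q).pow x.1).const_mul (c x.1)).mul
      (((h2.const_mul q).pow x.2).const_mul (c x.2))
  have hsum : ∀ θ, HasSum (fun x => F x θ)
      (1 / (1 - q * e θ) ^ (n + 1) * (1 / (1 - q * (e θ)⁻¹) ^ (n + 1))) := by
    intro θ
    have h1 : ‖q * e θ‖ < 1 := by simpa [hen] using hqn
    have h2 : ‖q * (e θ)⁻¹‖ < 1 := by simpa [hen] using hqn
    have h3 : HasSum (fun m => c m * (q * e θ) ^ m) (1 / (1 - q * e θ) ^ (n + 1)) :=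
      hasSum_choose_mul_geometric_of_norm_lt_one n h1
    have h4 : HasSum (fun m => c m * (q * (e θ)⁻¹) ^ m) (1 / (1 - q * (e θ)⁻¹) ^ (n + 1)) :=
      hasSum_choose_mul_geometric_of_norm_lt_one n h2
    have h5 : Summable fun x => F x θ :=
      Summable.of_norm (hb.congr fun x => (hFn x θ).symm)
    have h6 := HasSum.mul (f := fun m => c m * (q * e θ) ^ m)
      (g := fun m => c m * (q * (e θ)⁻¹) ^ m) h3 h4 h5
    exact h6
  have hint := intervalIntegral.hasSum_integral_of_dominated_convergence
    (μ := volume) (a := 0) (b := 2 * Real.pi) (F := F)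
    (fun x _ => ‖c x.1 * q ^ x.1‖ * ‖c x.2 * q ^ x.2‖)
    (fun x => (hcont x).aestronglyMeasurable)
    (fun x => Filter.Eventually.of_forall fun θ _ => (hFn x θ).le)
    (Filter.Eventually.of_forall fun θ _ => hb)
    intervalIntegrable_const
    (Filter.Eventually.of_forall fun θ _ => hsum θ)
  -- Orthogonality of the exponentials leaves the diagonal terms.
  have hFint : ∀ x : ℕ × ℕ, ∫ θ in (0 : ℝ)..(2 * Real.pi), F x θ =
      if x.1 = x.2 then 2 * Real.pi * (c x.1 ^ 2 * (q ^ 2) ^ x.1) else 0 := by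
    intro x
    have h1 : ∀ θ, F x θ = c x.1 * c x.2 * q ^ (x.1 + x.2) *
        Complex.exp ((((x.1 : ℂ) - x.2) * Complex.I) * θ) := by
      intro θ
      have : Complex.exp ((((x.1 : ℂ) - x.2) * Complex.I) * θ) = e θ ^ x.1 * (e θ)⁻¹ ^ x.2 := by
        simp only [e]
        rw [← Complex.exp_neg, ← Complex.exp_nat_mul, ← Complex.exp_nat_mul, ← Complex.exp_add]
        congr 1; ring
      rw [this]
      simp only [F]
      ring
    simp only [h1]
    rw [intervalIntegral.integral_const_mul]
    split_ifs with h
    · rw [h]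
      simp
      ring
    · have h2 : ((x.1 : ℂ) - x.2) * Complex.I ≠ 0 := by
        refine mul_ne_zero (sub_ne_zero.2 ?_) Complex.I_ne_zero
        exact_mod_cast h
      have h3 : Complex.exp (((x.1 : ℂ) - x.2) * Complex.I * ((2 * Real.pi : ℝ) : ℂ)) = 1 := by
        rw [Complex.exp_eq_one_iff]
        refine ⟨(x.1 : ℤ) - x.2, ?_⟩
        push_cast; ring
      rw [integral_exp_mul_complex h2, h3]
      simp
  simp only [hFint] at hint
  have hdiag := (Function.Injective.hasSum_iff (g := fun m : ℕ => (m, m))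
    (fun a b h => (Prod.ext_iff.1 h).1) (by
      rintro ⟨x, y⟩ hxy
      refine if_neg fun h => hxy ⟨x, ?_⟩
      exact Prod.ext rfl h)).2 hint
  have hq2 : ‖q ^ 2‖ < 1 := by
    rw [norm_pow]; exact pow_lt_one₀ (norm_nonneg _) hqn two_ne_zero
  have hval := hdiag.unique (f := _) (by
    simpa [Function.comp_def] using (hasSum_choose_sq hq2 n).mul_left (2 * Real.pi : ℂ))
  have hpi : (2 * Real.pi : ℂ) ≠ 0 := by
    simp [Real.pi_ne_zero]
  simp only [hfac]
  rw [intervalIntegral.integral_const_mul, hval, legendre_eval, mul_left_comm,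
    inv_mul_cancel_left₀ hpi, Finset.mul_sum, Finset.sum_div]
  refine Finset.sum_congr rfl fun k _ => ?_
  have h1 : (1 : ℂ) - q ^ 2 ≠ 0 := by
    intro h
    rw [← sub_eq_zero.1 h] at hq2
    simp at hq2
  have hsinh : Complex.sinh a = (1 - q ^ 2) / (2 * q) := by
    rw [Complex.sinh, hEq, ← hq]; field_simp
  have hcosh : Complex.cosh a = (1 + q ^ 2) / (2 * q) := by
    rw [Complex.cosh, hEq, ← hq]; field_simp
  have hx : (Complex.cosh a / Complex.sinh a - 1) / 2 = q ^ 2 / (1 - q ^ 2) := by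
    rw [hsinh, hcosh]; field_simp; ring
  rw [hx, hsinh, div_pow, div_pow, show n + k + 1 = k + (n + 1) by ring, pow_add _ k (n + 1)]
  field_simp

/-! ### `SU(2)` and spinors -/

instance haarSU2.instIsHaarMeasure : haarSU2.IsHaarMeasure := by
  unfold haarSU2; infer_instance

instance haarSU2.instIsProbabilityMeasure : IsProbabilityMeasure haarSU2 := by
  refine ⟨?_⟩
  have := Measure.haarMeasure_self (K₀ := (⊤ : TopologicalSpace.PositiveCompacts SU2))
  simpa [haarSU2] using this

instance SU2.instSecondCountableTopology : SecondCountableTopology SU2 := by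
  have : SecondCountableTopology (Matrix (Fin 2) (Fin 2) ℂ) :=
    inferInstanceAs (SecondCountableTopology (Fin 2 → Fin 2 → ℂ))
  exact Topology.IsEmbedding.subtypeVal.secondCountableTopology

lemma SU2.neg_one_mem :
    (-1 : Matrix (Fin 2) (Fin 2) ℂ) ∈ Matrix.specialUnitaryGroup (Fin 2) ℂ := by
  rw [Matrix.mem_specialUnitaryGroup_iff, Matrix.mem_unitaryGroup_iff]
  simp [Matrix.det_neg]

lemma SU2.apply_one_one (g : SU2) : g.1 1 1 = star (g.1 0 0) ∧ g.1 0 1 = -star (g.1 1 0) := by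
  have h := Matrix.mem_specialUnitaryGroup_iff.1 g.2
  have hu : g.1 * star g.1 = 1 := Matrix.mem_unitaryGroup_iff.1 h.1
  have hadj : g.1.adjugate = star g.1 := by
    have h1 : g.1.adjugate * g.1 = 1 := by rw [Matrix.adjugate_mul, h.2, one_smul]
    calc g.1.adjugate = g.1.adjugate * (g.1 * star g.1) := by rw [hu, mul_one]
      _ = star g.1 := by rw [← mul_assoc, h1, one_mul]
  rw [Matrix.adjugate_fin_two, Matrix.star_eq_conjTranspose] at hadj
  have h00 := congrFun (congrFun hadj 0) 0
  have h01 := congrFun (congrFun hadj 0) 1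
  simp at h00 h01
  exact ⟨by simpa using h00, by simpa using (neg_eq_iff_eq_neg.1 h01)⟩

/-- The squared Euclidean norm of a spinor. -/
def spinorNormSq (z : Fin 2 → ℂ) : ℝ := Complex.normSq (z 0) + Complex.normSq (z 1)

/-- The quaternion with first column `z`, as a `2 × 2` complex matrix. -/
def spinorMatrix (z : Fin 2 → ℂ) : Matrix (Fin 2) (Fin 2) ℂ :=
  !![z 0, -star (z 1); z 1, star (z 0)]

lemma spinorNormSq_nonneg (z : Fin 2 → ℂ) : 0 ≤ spinorNormSq z :=
  add_nonneg (Complex.normSq_nonneg _) (Complex.normSq_nonneg _)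

lemma spinorNormSq_pos {z : Fin 2 → ℂ} (hz : z ≠ 0) : 0 < spinorNormSq z := by
  refine lt_of_le_of_ne (spinorNormSq_nonneg z) fun h => hz ?_
  have h0 := Complex.normSq_nonneg (z 0)
  have h1 := Complex.normSq_nonneg (z 1)
  unfold spinorNormSq at h
  ext i
  fin_cases i
  · exact Complex.normSq_eq_zero.1 (show Complex.normSq (z 0) = 0 by linarith)
  · exact Complex.normSq_eq_zero.1 (show Complex.normSq (z 1) = 0 by linarith)

lemma continuous_spinorNormSq : Continuous spinorNormSq := by
  unfold spinorNormSq
  exact (Complex.continuous_normSq.comp (continuous_apply 0)).add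
    (Complex.continuous_normSq.comp (continuous_apply 1))

lemma continuous_spinorMatrix : Continuous spinorMatrix := by
  refine continuous_matrix fun i j => ?_
  fin_cases i <;> fin_cases j <;> simp [spinorMatrix] <;> fun_prop

lemma spinorMatrix_det (z : Fin 2 → ℂ) : (spinorMatrix z).det = spinorNormSq z := by
  simp only [spinorMatrix, spinorNormSq, Matrix.det_fin_two_of]
  push_cast
  rw [Complex.normSq_eq_conj_mul_self, Complex.normSq_eq_conj_mul_self]
  simp only [Complex.star_def]
  ring

lemma spinorMatrix_mul_star (z : Fin 2 → ℂ) :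
    spinorMatrix z * star (spinorMatrix z) = (spinorNormSq z : ℂ) • 1 := by
  have h0 := Complex.normSq_eq_conj_mul_self (z := z 0)
  have h1 := Complex.normSq_eq_conj_mul_self (z := z 1)
  ext i j
  fin_cases i <;> fin_cases j <;>
    simp [spinorMatrix, spinorNormSq, Matrix.mul_apply, Fin.sum_univ_two, Matrix.star_apply, h0,
      h1] <;>
    ring

lemma spinorMatrix_mulVec (g : SU2) (z : Fin 2 → ℂ) :
    spinorMatrix (g.1 *ᵥ z) = g.1 * spinorMatrix z := by
  obtain ⟨h1, h2⟩ := SU2.apply_one_one g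
  ext i j
  fin_cases i <;> fin_cases j <;>
    simp [spinorMatrix, Matrix.mul_apply, Fin.sum_univ_two, Matrix.mulVec, dotProduct, h1, h2] <;>
    ring

lemma spinorNormSq_mulVec (g : SU2) (z : Fin 2 → ℂ) :
    spinorNormSq (g.1 *ᵥ z) = spinorNormSq z := by
  have h := congrArg Matrix.det (spinorMatrix_mulVec g z)
  rw [Matrix.det_mul, spinorMatrix_det, spinorMatrix_det,
    (Matrix.mem_specialUnitaryGroup_iff.1 g.2).2, one_mul] at h
  exact_mod_cast h

lemma inv_sqrt_smul_spinorMatrix_mem {z : Fin 2 → ℂ} (hz : z ≠ 0) :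
    ((Real.sqrt (spinorNormSq z) : ℂ)⁻¹ • spinorMatrix z) ∈
      Matrix.specialUnitaryGroup (Fin 2) ℂ := by
  have hpos := spinorNormSq_pos hz
  have hs : (Real.sqrt (spinorNormSq z) : ℂ) * (Real.sqrt (spinorNormSq z) : ℂ) =
      spinorNormSq z := by
    rw [← Complex.ofReal_mul, Real.mul_self_sqrt hpos.le]
  have hne : (spinorNormSq z : ℂ) ≠ 0 := by exact_mod_cast hpos.ne'
  have hs0 : (Real.sqrt (spinorNormSq z) : ℂ) ≠ 0 := by
    intro h; rw [h, mul_zero] at hs; exact hne hs.symm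
  rw [Matrix.mem_specialUnitaryGroup_iff, Matrix.mem_unitaryGroup_iff]
  constructor
  · rw [star_smul, Matrix.smul_mul, Matrix.mul_smul, spinorMatrix_mul_star, smul_smul, smul_smul]
    have : star ((Real.sqrt (spinorNormSq z) : ℂ)⁻¹) = (Real.sqrt (spinorNormSq z) : ℂ)⁻¹ := by
      simp
    rw [this, ← hs]
    field_simp
    rw [one_smul]
  · rw [Matrix.det_smul, spinorMatrix_det, Fintype.card_fin, ← hs]
    field_simp

/-- The rotation whose matrix has first column `z / |z|` (the unit for `z = 0`). -/
noncomputable def spinorToSU2 (z : Fin 2 → ℂ) : SU2 :=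
  open Classical in
  if hz : z = 0 then 1 else
    ⟨(Real.sqrt (spinorNormSq z) : ℂ)⁻¹ • spinorMatrix z, inv_sqrt_smul_spinorMatrix_mem hz⟩

lemma spinorToSU2_coe {z : Fin 2 → ℂ} (hz : z ≠ 0) :
    (spinorToSU2 z).1 = (Real.sqrt (spinorNormSq z) : ℂ)⁻¹ • spinorMatrix z := by
  rw [spinorToSU2, dif_neg hz]

lemma spinorMatrix_eq_smul (z : Fin 2 → ℂ) :
    spinorMatrix z = (Real.sqrt (spinorNormSq z) : ℂ) • (spinorToSU2 z).1 := by
  by_cases hz : z = 0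
  · subst hz
    ext i j
    fin_cases i <;> fin_cases j <;> simp [spinorMatrix, spinorNormSq]
  · have : (Real.sqrt (spinorNormSq z) : ℂ) ≠ 0 := by
      exact_mod_cast (Real.sqrt_pos.2 (spinorNormSq_pos hz)).ne'
    rw [spinorToSU2_coe hz, smul_smul, mul_inv_cancel₀ this, one_smul]

lemma spinorToSU2_mulVec (g : SU2) {z : Fin 2 → ℂ} (hz : z ≠ 0) :
    spinorToSU2 (g.1 *ᵥ z) = g * spinorToSU2 z := by
  have hgz : g.1 *ᵥ z ≠ 0 := by
    intro h
    have h1 := spinorNormSq_mulVec g z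
    rw [h] at h1
    have := spinorNormSq_pos hz
    simp [spinorNormSq] at h1 this
    linarith
  apply Subtype.ext
  rw [spinorToSU2_coe hgz, spinorNormSq_mulVec, spinorMatrix_mulVec]
  change _ = g.1 * (spinorToSU2 z).1
  rw [spinorToSU2_coe hz, Matrix.mul_smul]

lemma measurable_spinorToSU2 : Measurable spinorToSU2 := by
  refine measurable_of_continuousOn_compl_singleton (0 : Fin 2 → ℂ) ?_
  refine (Topology.IsInducing.subtypeVal.continuousOn_iff (f := spinorToSU2)).2 ?_
  have h : ContinuousOn (fun z : Fin 2 → ℂ =>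
      (Real.sqrt (spinorNormSq z) : ℂ)⁻¹ • spinorMatrix z) {0}ᶜ := by
    have h1 : ContinuousOn (fun z : Fin 2 → ℂ => (Real.sqrt (spinorNormSq z) : ℂ)) {0}ᶜ :=
      (Complex.continuous_ofReal.comp
        (Real.continuous_sqrt.comp continuous_spinorNormSq)).continuousOn
    refine (h1.inv₀ fun z hz => ?_).smul continuous_spinorMatrix.continuousOn
    exact_mod_cast (Real.sqrt_pos.2 (spinorNormSq_pos hz)).ne'
  exact h.congr fun z hz => spinorToSU2_coe hz

/-! ### Haar measure as the angular part of rotation invariant measures on spinors -/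

lemma volume_map_mulVec (g : SU2) :
    Measure.map (fun z : Fin 2 → ℂ => g.1 *ᵥ z) volume = volume := by
  let f : (Fin 2 → ℂ) →ₗ[ℂ] (Fin 2 → ℂ) := Matrix.toLin' g.1
  have hdet : LinearMap.det (f.restrictScalars ℝ) = 1 := by
    rw [LinearMap.det_restrictScalars, LinearMap.det_toLin',
      (Matrix.mem_specialUnitaryGroup_iff.1 g.2).2, map_one]
  have h := Measure.map_linearMap_addHaar_eq_smul_addHaar (volume : Measure (Fin 2 → ℂ))
    (f := f.restrictScalars ℝ) (by rw [hdet]; exact one_ne_zero)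
  rw [hdet] at h
  rw [inv_one, abs_one, ENNReal.ofReal_one, one_smul] at h
  exact h

/-- The angular part of a finite `SU(2)`-invariant measure on spinors is a multiple of the Haar
measure, by uniqueness of the latter. -/
lemma map_spinorToSU2_withDensity {ρ : (Fin 2 → ℂ) → ENNReal} (hρ : Measurable ρ)
    (hinv : ∀ (g : SU2) z, ρ (g.1 *ᵥ z) = ρ z) (hfin : ∫⁻ z, ρ z ≠ ⊤) :
    Measure.map spinorToSU2 (volume.withDensity ρ) = (∫⁻ z, ρ z) • haarSU2 := by
  set ν := Measure.map spinorToSU2 (volume.withDensity ρ) with hν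
  have huniv : ν Set.univ = ∫⁻ z, ρ z := by
    rw [hν, Measure.map_apply measurable_spinorToSU2 MeasurableSet.univ, Set.preimage_univ,
      withDensity_apply _ MeasurableSet.univ, Measure.restrict_univ]
  have hνfin : IsFiniteMeasure ν := ⟨by rw [huniv]; exact hfin.lt_top⟩
  have hmeas : ∀ g : SU2, Measurable (fun z : Fin 2 → ℂ => g.1 *ᵥ z) := fun g =>
    (continuous_const.matrix_mulVec continuous_id).measurable
  have hinvd : ∀ g : SU2, Measure.map (fun z : Fin 2 → ℂ => g.1 *ᵥ z) (volume.withDensity ρ) =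
      volume.withDensity ρ := by
    intro g
    ext s hs
    rw [Measure.map_apply (hmeas g) hs, withDensity_apply _ (hmeas g hs), withDensity_apply _ hs]
    conv_rhs => rw [← volume_map_mulVec g]
    rw [setLIntegral_map hs hρ (hmeas g)]
    simp only [hinv]
  have hleft : ν.IsMulLeftInvariant := by
    refine ⟨fun g => ?_⟩
    rw [hν, Measure.map_map (measurable_const_mul g) measurable_spinorToSU2]
    conv_rhs => rw [← hinvd g]
    rw [Measure.map_map measurable_spinorToSU2 (hmeas g)]
    refine Measure.map_congr ?_
    have h0 : ∀ᵐ z ∂(volume.withDensity ρ), z ≠ (0 : Fin 2 → ℂ) := by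
      refine (withDensity_absolutelyContinuous volume ρ).ae_le ?_
      exact Measure.ae_ne volume 0
    filter_upwards [h0] with z hz
    exact (spinorToSU2_mulVec g hz).symm
  have h := Measure.isMulInvariant_eq_smul_of_compactSpace ν haarSU2
  have h2 := congrArg (fun m : Measure SU2 => m Set.univ) h
  simp only [Measure.smul_apply, measure_univ, huniv] at h2
  rw [h, h2]
  simp

/-! ### The Gaussian measure on spinors -/

/-- The Gaussian probability measure `e^{-|z|²} d⁴z / π²` on spinors. -/
noncomputable def spinorGaussian : Measure (Fin 2 → ℂ) :=
  volume.withDensity fun z => ENNReal.ofReal (Real.exp (-spinorNormSq z) / Real.pi ^ 2)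

lemma integral_normSq_pow_mul_exp (k : ℕ) :
    ∫ z : ℂ, Complex.normSq z ^ k * Real.exp (-Complex.normSq z) = Real.pi * k ! := by
  have h := Complex.integral_rpow_mul_exp_neg_rpow (p := 2) (q := 2 * k) (by norm_num)
    (by have : (0 : ℝ) ≤ k := Nat.cast_nonneg k
        linarith)
  have h1 : (2 * (k : ℝ) + 2) / 2 = k + 1 := by ring
  rw [h1, Real.Gamma_nat_eq_factorial, mul_div_cancel_left₀ _ (two_ne_zero' ℝ)] at h
  rw [← h]
  refine integral_congr_ae (Filter.Eventually.of_forall fun z => ?_)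
  simp only
  rw [Complex.normSq_eq_norm_sq, ← pow_mul, ← Real.rpow_natCast, ← Real.rpow_natCast ‖z‖ 2]
  push_cast
  rfl

lemma integrable_normSq_pow_mul_exp (k : ℕ) :
    Integrable fun z : ℂ => Complex.normSq z ^ k * Real.exp (-Complex.normSq z) := by
  apply Integrable.of_integral_ne_zero
  rw [integral_normSq_pow_mul_exp]
  exact mul_ne_zero Real.pi_ne_zero (by exact_mod_cast Nat.factorial_ne_zero k)

lemma integral_spinor_prod (f g : ℂ → ℝ) :
    ∫ z : Fin 2 → ℂ, f (z 0) * g (z 1) = (∫ z, f z) * ∫ z, g z := by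
  have := integral_fintype_prod_volume_eq_prod (E := fun _ : Fin 2 => ℂ) (𝕜 := ℝ) ![f, g]
  simpa [Fin.prod_univ_two] using this

lemma integrable_spinor_prod {f g : ℂ → ℝ} (hf : Integrable f) (hg : Integrable g) :
    Integrable fun z : Fin 2 → ℂ => f (z 0) * g (z 1) := by
  have := Integrable.fintype_prod (ι := Fin 2) (f := ![f, g]) (μ := fun _ => volume)
    (by intro i; fin_cases i <;> assumption)
  simp only [Fin.prod_univ_two] at this
  exact this

lemma spinorNormSq_pow_mul_exp (J : ℕ) (z : Fin 2 → ℂ) :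
    spinorNormSq z ^ J * Real.exp (-spinorNormSq z) =
      ∑ k ∈ Finset.range (J + 1), (J.choose k : ℝ) *
        ((Complex.normSq (z 0) ^ k * Real.exp (-Complex.normSq (z 0))) *
          (Complex.normSq (z 1) ^ (J - k) * Real.exp (-Complex.normSq (z 1)))) := by
  rw [spinorNormSq, add_pow, neg_add, Real.exp_add, Finset.sum_mul]
  exact Finset.sum_congr rfl fun k _ => by ring

lemma integrable_spinorNormSq_pow_mul_exp (J : ℕ) :
    Integrable fun z : Fin 2 → ℂ => spinorNormSq z ^ J * Real.exp (-spinorNormSq z) := by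
  simp only [spinorNormSq_pow_mul_exp]
  exact integrable_finsetSum _ fun k _ => (integrable_spinor_prod
    (integrable_normSq_pow_mul_exp k) (integrable_normSq_pow_mul_exp (J - k))).const_mul _

lemma integral_spinorNormSq_pow_mul_exp (J : ℕ) :
    ∫ z : Fin 2 → ℂ, spinorNormSq z ^ J * Real.exp (-spinorNormSq z) =
      Real.pi ^ 2 * (J + 1)! := by
  simp only [spinorNormSq_pow_mul_exp]
  rw [integral_finsetSum _ fun k _ => (integrable_spinor_prod
    (integrable_normSq_pow_mul_exp k) (integrable_normSq_pow_mul_exp (J - k))).const_mul _]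
  have : ∀ k ∈ Finset.range (J + 1), ∫ z : Fin 2 → ℂ, (J.choose k : ℝ) *
        ((Complex.normSq (z 0) ^ k * Real.exp (-Complex.normSq (z 0))) *
          (Complex.normSq (z 1) ^ (J - k) * Real.exp (-Complex.normSq (z 1)))) =
        Real.pi ^ 2 * J ! := by
    intro k hk
    rw [integral_const_mul, integral_spinor_prod
      (fun w => Complex.normSq w ^ k * Real.exp (-Complex.normSq w))
      (fun w => Complex.normSq w ^ (J - k) * Real.exp (-Complex.normSq w)),
      integral_normSq_pow_mul_exp, integral_normSq_pow_mul_exp,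
      ← Nat.choose_mul_factorial_mul_factorial (Nat.lt_succ_iff.1 (Finset.mem_range.1 hk))]
    push_cast
    ring
  rw [Finset.sum_congr rfl this, Finset.sum_const, Finset.card_range, Nat.factorial_succ]
  push_cast
  simp
  ring

lemma measurable_gaussianDensity :
    Measurable fun z : Fin 2 → ℂ => Real.exp (-spinorNormSq z) / Real.pi ^ 2 :=
  ((Real.continuous_exp.comp continuous_spinorNormSq.neg).div_const _).measurable

lemma integral_spinorGaussian (f : (Fin 2 → ℂ) → ℝ) :
    ∫ z, f z ∂spinorGaussian =
      (Real.pi ^ 2)⁻¹ * ∫ z, f z * Real.exp (-spinorNormSq z) := by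
  rw [spinorGaussian, integral_withDensity_eq_integral_toReal_smul
    measurable_gaussianDensity.ennreal_ofReal (Filter.Eventually.of_forall fun _ =>
      ENNReal.ofReal_lt_top), ← integral_const_mul]
  refine integral_congr_ae (Filter.Eventually.of_forall fun z => ?_)
  simp only [smul_eq_mul]
  rw [ENNReal.toReal_ofReal (by positivity)]
  ring

lemma integrable_spinorGaussian {f : (Fin 2 → ℂ) → ℝ}
    (hf : Integrable fun z => f z * Real.exp (-spinorNormSq z)) :
    Integrable f spinorGaussian := by
  rw [spinorGaussian, integrable_withDensity_iff measurable_gaussianDensity.ennreal_ofReal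
    (Filter.Eventually.of_forall fun _ => ENNReal.ofReal_lt_top)]
  refine (hf.mul_const (Real.pi ^ 2)⁻¹).congr (Filter.Eventually.of_forall fun z => ?_)
  simp only
  rw [ENNReal.toReal_ofReal (by positivity)]
  ring

instance spinorGaussian.instIsProbabilityMeasure : IsProbabilityMeasure spinorGaussian := by
  refine ⟨?_⟩
  have h := integral_spinorNormSq_pow_mul_exp 0
  have hi := integrable_spinorNormSq_pow_mul_exp 0
  simp only [pow_zero, one_mul] at h hi
  rw [spinorGaussian, withDensity_apply _ MeasurableSet.univ, Measure.restrict_univ,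
    ← ofReal_integral_eq_lintegral_ofReal (hi.div_const _)
      (Filter.Eventually.of_forall fun z => by positivity), integral_div, h]
  simp [Real.pi_ne_zero]

/-- The moments of the Euclidean norm under the Gaussian measure on spinors. -/
noncomputable def spinorMoment (n : ℕ) : ℝ := ∫ z, Real.sqrt (spinorNormSq z) ^ n ∂spinorGaussian

lemma spinorMoment_two_mul (J : ℕ) : spinorMoment (2 * J) = (J + 1)! := by
  have : ∀ z, Real.sqrt (spinorNormSq z) ^ (2 * J) = spinorNormSq z ^ J := fun z => by
    rw [pow_mul, Real.sq_sqrt (spinorNormSq_nonneg z)]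
  simp only [spinorMoment, this]
  rw [integral_spinorGaussian, integral_spinorNormSq_pow_mul_exp,
    inv_mul_cancel_left₀ (by positivity)]

lemma continuous_sqrt_spinorNormSq : Continuous fun z => Real.sqrt (spinorNormSq z) :=
  Real.continuous_sqrt.comp continuous_spinorNormSq

lemma integrable_sqrt_pow_spinorGaussian (n : ℕ) :
    Integrable (fun z => Real.sqrt (spinorNormSq z) ^ n) spinorGaussian := by
  have h : Integrable (fun z => 1 + spinorNormSq z ^ n) spinorGaussian :=
    (integrable_const 1).add (integrable_spinorGaussian (integrable_spinorNormSq_pow_mul_exp n))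
  refine h.mono' (continuous_sqrt_spinorNormSq.pow n).aestronglyMeasurable
    (Filter.Eventually.of_forall fun z => ?_)
  have h0 := Real.sqrt_nonneg (spinorNormSq z)
  rw [Real.norm_of_nonneg (by positivity)]
  have h1 : spinorNormSq z ^ n = (Real.sqrt (spinorNormSq z) ^ n) ^ 2 := by
    rw [← pow_mul, mul_comm, pow_mul, Real.sq_sqrt (spinorNormSq_nonneg z)]
  rw [h1]
  nlinarith [sq_nonneg (Real.sqrt (spinorNormSq z) ^ n - 1), pow_nonneg h0 n]

lemma lintegral_sqrt_pow_spinorGaussian (n : ℕ) :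
    ∫⁻ z, ENNReal.ofReal (Real.sqrt (spinorNormSq z) ^ n) ∂spinorGaussian =
      ENNReal.ofReal (spinorMoment n) := by
  rw [spinorMoment, ofReal_integral_eq_lintegral_ofReal (integrable_sqrt_pow_spinorGaussian n)
    (Filter.Eventually.of_forall fun z => pow_nonneg (Real.sqrt_nonneg _) n)]

lemma map_spinorToSU2_moment (n : ℕ) :
    Measure.map spinorToSU2 (spinorGaussian.withDensity
      fun z => ENNReal.ofReal (Real.sqrt (spinorNormSq z) ^ n)) =
      ENNReal.ofReal (spinorMoment n) • haarSU2 := by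
  have hm1 := measurable_gaussianDensity.ennreal_ofReal
  have hm2 : Measurable fun z => ENNReal.ofReal (Real.sqrt (spinorNormSq z) ^ n) :=
    (continuous_sqrt_spinorNormSq.pow n).measurable.ennreal_ofReal
  have h1 : ∫⁻ z, ((fun z => ENNReal.ofReal (Real.exp (-spinorNormSq z) / Real.pi ^ 2)) *
      fun z => ENNReal.ofReal (Real.sqrt (spinorNormSq z) ^ n)) z =
      ENNReal.ofReal (spinorMoment n) := by
    rw [← lintegral_sqrt_pow_spinorGaussian, spinorGaussian,
      lintegral_withDensity_eq_lintegral_mul _ hm1 hm2]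
  rw [spinorGaussian, ← withDensity_mul _ hm1 hm2, map_spinorToSU2_withDensity (hm1.mul hm2), h1]
  · intro g z
    simp only [Pi.mul_apply, spinorNormSq_mulVec]
  · rw [h1]; exact ENNReal.ofReal_ne_top

/-! ### Haar averages at many nodes as Gaussian integrals -/

lemma pi_withDensity {ι X : Type*} [Fintype ι] [MeasurableSpace X] (μ : Measure X)
    [SigmaFinite μ] {d : ι → X → ℝ} (hd : ∀ i, Integrable (d i) μ)
    (hd0 : ∀ i x, 0 ≤ d i x) :
    Measure.pi (fun i => μ.withDensity fun x => ENNReal.ofReal (d i x)) =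
      (Measure.pi fun _ : ι => μ).withDensity fun x => ENNReal.ofReal (∏ i, d i (x i)) := by
  classical
  refine Measure.pi_eq fun s hs => ?_
  have hpi := MeasurableSet.univ_pi hs
  have hprod : Integrable (fun x : ι → X => ∏ i, d i (x i)) (Measure.pi fun _ : ι => μ) :=
    Integrable.fintype_prod hd
  have h1 : ∀ x : ι → X, (Set.univ.pi s).indicator (fun x => ∏ i, d i (x i)) x =
      ∏ i, (s i).indicator (d i) (x i) := by
    intro x
    by_cases hx : x ∈ Set.univ.pi s
    · rw [Set.indicator_of_mem hx]
      refine Finset.prod_congr rfl fun i _ => ?_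
      rw [Set.indicator_of_mem (hx i trivial)]
    · rw [Set.indicator_of_notMem hx]
      simp only [Set.mem_pi, Set.mem_univ, true_implies, not_forall] at hx
      obtain ⟨i, hi⟩ := hx
      exact (Finset.prod_eq_zero (Finset.mem_univ i) (Set.indicator_of_notMem hi _)).symm
  rw [withDensity_apply _ hpi, ← ofReal_integral_eq_lintegral_ofReal hprod.integrableOn
    (Filter.Eventually.of_forall fun x => Finset.prod_nonneg fun i _ => hd0 i _),
    ← integral_indicator hpi]
  simp only [h1]
  rw [integral_fintype_prod_eq_prod (𝕜 := ℝ) (fun i => (s i).indicator (d i)),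
    ENNReal.ofReal_prod_of_nonneg fun i _ =>
      integral_nonneg fun x => Set.indicator_nonneg (fun x _ => hd0 i x) x]
  refine Finset.prod_congr rfl fun i _ => ?_
  rw [withDensity_apply _ (hs i), ← ofReal_integral_eq_lintegral_ofReal (hd i).integrableOn
    (Filter.Eventually.of_forall fun x => hd0 i x), ← integral_indicator (hs i)]

/-- For an integrand that is homogeneous of degree `n p` in the spinor at `p`, the Gaussian integral
is the Haar average times the radial integrals. -/
lemma integral_spinorGaussian_pi {ι : Type*} [Fintype ι] (n : ι → ℕ) (F : (ι → SU2) → ℂ)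
    (hF : Measurable F) :
    ∫ z : ι → Fin 2 → ℂ, ((∏ p, (Real.sqrt (spinorNormSq (z p)) ^ n p : ℝ) : ℝ) : ℂ) *
        F (fun p => spinorToSU2 (z p)) ∂(Measure.pi fun _ => spinorGaussian) =
      ((∏ p, spinorMoment (n p) : ℝ) : ℂ) * ∫ g, F g ∂(Measure.pi fun _ => haarSU2) := by
  set d : ι → (Fin 2 → ℂ) → ENNReal := fun p z =>
    ENNReal.ofReal (Real.sqrt (spinorNormSq z) ^ n p) with hddef
  have hd : ∀ p, Measurable (d p) := fun p =>
    (continuous_sqrt_spinorNormSq.pow (n p)).measurable.ennreal_ofReal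
  have hfin : ∀ p, IsFiniteMeasure (spinorGaussian.withDensity (d p)) := fun p =>
    isFiniteMeasure_withDensity (by
      rw [lintegral_sqrt_pow_spinorGaussian]; exact ENNReal.ofReal_ne_top)
  have hmap : ∀ p, Measure.map spinorToSU2 (spinorGaussian.withDensity (d p)) =
      ENNReal.ofReal (spinorMoment (n p)) • haarSU2 := fun p => map_spinorToSU2_moment (n p)
  have hmom : ∀ k, 0 ≤ spinorMoment k := fun k =>
    integral_nonneg fun z => pow_nonneg (Real.sqrt_nonneg _) k
  have hsf : ∀ p, IsFiniteMeasure (ENNReal.ofReal (spinorMoment (n p)) • haarSU2) := fun p => by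
    rw [← hmap]; infer_instance
  have hpi : Measure.pi (fun p => ENNReal.ofReal (spinorMoment (n p)) • haarSU2) =
      (∏ p, ENNReal.ofReal (spinorMoment (n p))) • Measure.pi fun _ : ι => haarSU2 := by
    refine Measure.pi_eq fun s hs => ?_
    simp only [Measure.smul_apply, Measure.pi_pi, smul_eq_mul]
    rw [Finset.prod_mul_distrib]
  have hT : Measurable fun (z : ι → Fin 2 → ℂ) p => spinorToSU2 (z p) :=
    measurable_pi_lambda _ fun p => measurable_spinorToSU2.comp (measurable_pi_apply p)
  have hmap2 : Measure.map (fun (z : ι → Fin 2 → ℂ) p => spinorToSU2 (z p))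
      (Measure.pi fun p => spinorGaussian.withDensity (d p)) =
      (∏ p, ENNReal.ofReal (spinorMoment (n p))) • Measure.pi fun _ : ι => haarSU2 := by
    rw [Measure.pi_map_pi (f := fun _ => spinorToSU2)
      fun _ => measurable_spinorToSU2.aemeasurable, ← hpi]
    simp only [hmap]
  have h1 : ∫ g, F g ∂((∏ p, ENNReal.ofReal (spinorMoment (n p))) •
      Measure.pi fun _ : ι => haarSU2) =
      ∫ z : ι → Fin 2 → ℂ, F (fun p => spinorToSU2 (z p))
        ∂(Measure.pi fun p => spinorGaussian.withDensity (d p)) := by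
    rw [← hmap2, integral_map hT.aemeasurable hF.aestronglyMeasurable]
  have hr : ∀ p, Measurable fun z => Real.sqrt (spinorNormSq z) ^ n p := fun p =>
    (continuous_sqrt_spinorNormSq.pow (n p)).measurable
  have hdm : Measurable fun z : ι → Fin 2 → ℂ => ∏ p, Real.sqrt (spinorNormSq (z p)) ^ n p :=
    Finset.measurable_fun_prod _ fun p _ => (hr p).comp (measurable_pi_apply p)
  rw [integral_smul_measure, pi_withDensity spinorGaussian
    (fun p => integrable_sqrt_pow_spinorGaussian (n p))
    (fun p z => pow_nonneg (Real.sqrt_nonneg _) _),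
    integral_withDensity_eq_integral_toReal_smul hdm.ennreal_ofReal
    (Filter.Eventually.of_forall fun z => ENNReal.ofReal_lt_top)] at h1
  have h2 : (∏ p, ENNReal.ofReal (spinorMoment (n p))).toReal = ∏ p, spinorMoment (n p) := by
    rw [ENNReal.toReal_prod]
    exact Finset.prod_congr rfl fun p _ => ENNReal.toReal_ofReal (hmom _)
  have h3 : ∀ z : ι → Fin 2 → ℂ,
      (ENNReal.ofReal (∏ p, Real.sqrt (spinorNormSq (z p)) ^ n p)).toReal =
      ∏ p, Real.sqrt (spinorNormSq (z p)) ^ n p := fun z =>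
    ENNReal.toReal_ofReal (Finset.prod_nonneg fun p _ => pow_nonneg (Real.sqrt_nonneg _) _)
  rw [h2] at h1
  simp only [h3, Complex.real_smul] at h1
  exact h1.symm

/-! ### The distribution of the trace under Haar measure -/

lemma integral_spinorGaussian_radial (n : ℕ) {f : SU2 → ℝ} (hf : Measurable f) :
    ∫ z, Real.sqrt (spinorNormSq z) ^ n * f (spinorToSU2 z) ∂spinorGaussian =
      spinorMoment n * ∫ g, f g ∂haarSU2 := by
  have hd : Measurable fun z => ENNReal.ofReal (Real.sqrt (spinorNormSq z) ^ n) :=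
    (continuous_sqrt_spinorNormSq.pow n).measurable.ennreal_ofReal
  have h1 : ∫ g, f g ∂(ENNReal.ofReal (spinorMoment n) • haarSU2) =
      ∫ z, f (spinorToSU2 z) ∂(spinorGaussian.withDensity
        fun z => ENNReal.ofReal (Real.sqrt (spinorNormSq z) ^ n)) := by
    rw [← map_spinorToSU2_moment, integral_map measurable_spinorToSU2.aemeasurable
      hf.aestronglyMeasurable]
  rw [integral_smul_measure, integral_withDensity_eq_integral_toReal_smul hd
    (Filter.Eventually.of_forall fun z => ENNReal.ofReal_lt_top), ENNReal.toReal_ofReal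
    (show 0 ≤ spinorMoment n from
      integral_nonneg fun z => pow_nonneg (Real.sqrt_nonneg _) n)] at h1
  rw [← smul_eq_mul, h1]
  refine integral_congr_ae (Filter.Eventually.of_forall fun z => ?_)
  simp only [smul_eq_mul]
  rw [ENNReal.toReal_ofReal (pow_nonneg (Real.sqrt_nonneg _) n)]

/-- Half the trace of a rotation. -/
def halfTrace (g : SU2) : ℝ := (g.1 0 0).re

lemma continuous_halfTrace : Continuous halfTrace :=
  Complex.continuous_re.comp ((continuous_apply 0).comp
    ((continuous_apply 0).comp continuous_subtype_val))

/-- The real part of the first component of a spinor is its norm times half the trace of its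
rotation, so that the even moments of the latter are Gaussian moments divided by radial ones. -/
lemma integral_halfTrace_pow_even (i : ℕ) :
    ((i + 1)! : ℝ) * ∫ g, halfTrace g ^ (2 * i) ∂haarSU2 =
      Real.pi⁻¹ * ∫ w : ℂ, w.re ^ (2 * i) * Real.exp (-Complex.normSq w) := by
  have h := integral_spinorGaussian_radial (2 * i) (f := fun g => halfTrace g ^ (2 * i))
    (continuous_halfTrace.pow (2 * i)).measurable
  have h1 : ∀ z, Real.sqrt (spinorNormSq z) ^ (2 * i) * halfTrace (spinorToSU2 z) ^ (2 * i) =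
      (z 0).re ^ (2 * i) := by
    intro z
    have h2 := congrArg Complex.re (congrFun (congrFun (spinorMatrix_eq_smul z) 0) 0)
    simp [spinorMatrix] at h2
    rw [h2, mul_pow, halfTrace]
  rw [← spinorMoment_two_mul, ← h, integral_congr_ae (Filter.Eventually.of_forall h1),
    integral_spinorGaussian]
  have h3 : ∀ z : Fin 2 → ℂ, (z 0).re ^ (2 * i) * Real.exp (-spinorNormSq z) =
      ((z 0).re ^ (2 * i) * Real.exp (-Complex.normSq (z 0))) *
        (Complex.normSq (z 1) ^ 0 * Real.exp (-Complex.normSq (z 1))) := by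
    intro z
    rw [spinorNormSq, neg_add, Real.exp_add]; ring
  simp only [h3]
  rw [integral_spinor_prod (fun w => w.re ^ (2 * i) * Real.exp (-Complex.normSq w))
    (fun w => Complex.normSq w ^ 0 * Real.exp (-Complex.normSq w)), integral_normSq_pow_mul_exp]
  have := Real.pi_ne_zero
  field_simp
  simp

lemma integral_pow_mul_exp_neg_sq (j : ℕ) :
    ∫ x : ℝ, x ^ (j + 2) * Real.exp (-x ^ 2) =
      ((j : ℝ) + 1) / 2 * ∫ x : ℝ, x ^ j * Real.exp (-x ^ 2) := by
  have hint : ∀ k : ℕ, Integrable fun x : ℝ => x ^ k * Real.exp (-x ^ 2) := by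
    intro k
    have := integrable_rpow_mul_exp_neg_mul_sq (b := 1) one_pos (s := k)
      (by have : (0 : ℝ) ≤ k := Nat.cast_nonneg k
          linarith)
    simpa using this
  have hderiv : ∀ x : ℝ, HasDerivAt (fun x : ℝ => x ^ (j + 1) * Real.exp (-x ^ 2))
      (((j : ℝ) + 1) * (x ^ j * Real.exp (-x ^ 2)) - 2 * (x ^ (j + 2) * Real.exp (-x ^ 2))) x := by
    intro x
    have h1 := (hasDerivAt_pow (j + 1) x).mul ((hasDerivAt_pow 2 x).neg.exp)
    convert! h1 using 1
    push_cast
    simp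
    ring
  have h := integral_eq_zero_of_hasDerivAt_of_integrable hderiv
    (((hint j).const_mul _).sub ((hint (j + 2)).const_mul _)) (hint (j + 1))
  rw [integral_sub ((hint j).const_mul _) ((hint (j + 2)).const_mul _), integral_const_mul,
    integral_const_mul] at h
  linarith

lemma integral_re_pow_mul_exp (j : ℕ) :
    ∫ w : ℂ, w.re ^ j * Real.exp (-Complex.normSq w) =
      (∫ x : ℝ, x ^ j * Real.exp (-x ^ 2)) * ∫ y : ℝ, Real.exp (-y ^ 2) := by
  rw [← integral_prod_mul (fun x : ℝ => x ^ j * Real.exp (-x ^ 2)) fun y => Real.exp (-y ^ 2)]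
  have := Complex.volume_preserving_equiv_real_prod.integral_comp
    Complex.measurableEquivRealProd.measurableEmbedding
    (fun p : ℝ × ℝ => p.1 ^ j * Real.exp (-p.1 ^ 2) * Real.exp (-p.2 ^ 2))
  rw [Measure.volume_eq_prod] at this
  rw [← this]
  refine integral_congr_ae (Filter.Eventually.of_forall fun w => ?_)
  simp only [Complex.measurableEquivRealProd_apply]
  rw [mul_assoc, ← Real.exp_add, Complex.normSq_apply]
  ring_nf

lemma integral_halfTrace_pow_odd {m : ℕ} (hm : Odd m) : ∫ g, halfTrace g ^ m ∂haarSU2 = 0 := by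
  have h := integral_mul_left_eq_self (μ := haarSU2) (fun g => halfTrace g ^ m)
    (⟨-1, SU2.neg_one_mem⟩ : SU2)
  have h1 : ∀ g : SU2, halfTrace ((⟨-1, SU2.neg_one_mem⟩ : SU2) * g) ^ m = -(halfTrace g ^ m) := by
    intro g
    rw [← hm.neg_pow]
    congr 1
    change (((-1 : Matrix (Fin 2) (Fin 2) ℂ) * g.1) 0 0).re = _
    simp [halfTrace]
  simp only [h1] at h
  rw [integral_neg] at h
  linarith

/-- The moments of half the trace satisfy the recursion of the moments of the semicircle law. -/
lemma integral_halfTrace_pow_add_two (j : ℕ) :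
    ((j : ℝ) + 4) * ∫ g, halfTrace g ^ (j + 2) ∂haarSU2 =
      ((j : ℝ) + 1) * ∫ g, halfTrace g ^ j ∂haarSU2 := by
  rcases Nat.even_or_odd' j with ⟨i, rfl | rfl⟩
  · have h0 := integral_halfTrace_pow_even i
    have h1 := integral_halfTrace_pow_even (i + 1)
    rw [integral_re_pow_mul_exp] at h0 h1
    rw [Nat.mul_succ, integral_pow_mul_exp_neg_sq, Nat.factorial_succ (i + 1)] at h1
    have h2 : ((i + 1)! : ℝ) ≠ 0 := by exact_mod_cast Nat.factorial_ne_zero _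
    apply mul_left_cancel₀ h2
    push_cast at h0 h1 ⊢
    linear_combination 2 * h1 - (2 * (i : ℝ) + 1) * h0
  · rw [integral_halfTrace_pow_odd ⟨i, rfl⟩, integral_halfTrace_pow_odd ⟨i + 1, by ring⟩]
    simp

lemma integral_cos_pow_mul_sin_sq (j : ℕ) :
    ((j : ℝ) + 4) * ∫ θ in (0 : ℝ)..(2 * Real.pi), Real.cos θ ^ (j + 2) * Real.sin θ ^ 2 =
      ((j : ℝ) + 1) * ∫ θ in (0 : ℝ)..(2 * Real.pi), Real.cos θ ^ j * Real.sin θ ^ 2 := by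
  have hderiv : ∀ θ : ℝ, HasDerivAt (fun θ => Real.cos θ ^ (j + 1) * Real.sin θ ^ 3)
      (((j : ℝ) + 4) * (Real.cos θ ^ (j + 2) * Real.sin θ ^ 2) -
        ((j : ℝ) + 1) * (Real.cos θ ^ j * Real.sin θ ^ 2)) θ := by
    intro θ
    have h1 := ((Real.hasDerivAt_cos θ).pow (j + 1)).mul ((Real.hasDerivAt_sin θ).pow 3)
    convert! h1 using 1
    have h2 := Real.sin_sq_add_cos_sq θ
    push_cast
    simp
    linear_combination (((j : ℝ) + 1) * Real.cos θ ^ j * Real.sin θ ^ 2) * h2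
  have h := intervalIntegral.integral_eq_sub_of_hasDerivAt (a := 0) (b := 2 * Real.pi)
    (fun θ _ => hderiv θ) (Continuous.intervalIntegrable (by fun_prop) _ _)
  rw [intervalIntegral.integral_sub (Continuous.intervalIntegrable (by fun_prop) _ _)
    (Continuous.intervalIntegrable (by fun_prop) _ _), intervalIntegral.integral_const_mul,
    intervalIntegral.integral_const_mul] at h
  simp at h
  linarith

/-- The class angle of a Haar distributed rotation has the density `sin² θ / π` on a full period. -/
lemma integral_halfTrace_pow (j : ℕ) :
    ∫ g, halfTrace g ^ j ∂haarSU2 =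
      Real.pi⁻¹ * ∫ θ in (0 : ℝ)..(2 * Real.pi), Real.cos θ ^ j * Real.sin θ ^ 2 := by
  have h2 := Real.pi_ne_zero
  induction j using Nat.twoStepInduction with
  | zero => simp [integral_sin_sq, h2]
  | one =>
    have hderiv : ∀ θ : ℝ, HasDerivAt (fun θ => Real.sin θ ^ 3 / 3)
        (Real.cos θ ^ 1 * Real.sin θ ^ 2) θ := by
      intro θ
      convert! ((Real.hasDerivAt_sin θ).pow 3).div_const 3 using 1
      simp
      ring
    rw [integral_halfTrace_pow_odd odd_one, intervalIntegral.integral_eq_sub_of_hasDerivAt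
      (fun θ _ => hderiv θ) (Continuous.intervalIntegrable (by fun_prop) _ _)]
    simp
  | more j ih _ =>
    have h1 : ((j : ℝ) + 4) ≠ 0 := by positivity
    apply mul_left_cancel₀ h1
    rw [integral_halfTrace_pow_add_two, ih, mul_left_comm, ← integral_cos_pow_mul_sin_sq]
    ring

lemma abs_halfTrace_le (g : SU2) : |halfTrace g| ≤ 1 := by
  have h1 := entry_norm_bound_of_unitary (Matrix.mem_specialUnitaryGroup_iff.1 g.2).1 0 0
  exact (Complex.abs_re_le_norm _).trans h1

lemma integral_eval_halfTrace (P : Polynomial ℝ) :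
    ∫ g, P.eval (halfTrace g) ∂haarSU2 =
      Real.pi⁻¹ * ∫ θ in (0 : ℝ)..(2 * Real.pi), P.eval (Real.cos θ) * Real.sin θ ^ 2 := by
  have hint : ∀ p : Polynomial ℝ, Integrable (fun g => p.eval (halfTrace g)) haarSU2 := fun p =>
    (p.continuous.comp continuous_halfTrace).integrable_of_hasCompactSupport
      (HasCompactSupport.of_compactSpace _)
  have hint2 : ∀ p : Polynomial ℝ, IntervalIntegrable
      (fun θ => p.eval (Real.cos θ) * Real.sin θ ^ 2) volume 0 (2 * Real.pi) := fun p =>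
    Continuous.intervalIntegrable ((p.continuous.comp Real.continuous_cos).mul
      (Real.continuous_sin.pow 2)) _ _
  induction P using Polynomial.induction_on' with
  | add p q hp hq =>
    simp only [Polynomial.eval_add, add_mul]
    rw [integral_add (hint p) (hint q), intervalIntegral.integral_add (hint2 p) (hint2 q), hp, hq]
    ring
  | monomial j c =>
    simp only [Polynomial.eval_monomial, mul_assoc]
    rw [integral_const_mul, intervalIntegral.integral_const_mul, integral_halfTrace_pow]
    ring

lemma integral_cos_int_mul (k : ℤ) :
    ∫ θ in (0 : ℝ)..(2 * Real.pi), Real.cos (k * θ) = if k = 0 then 2 * Real.pi else 0 := by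
  split_ifs with h
  · simp [h]
  · have hk : (k : ℝ) ≠ 0 := by exact_mod_cast h
    have hderiv : ∀ θ : ℝ, HasDerivAt (fun θ => Real.sin (k * θ) / k) (Real.cos (k * θ)) θ := by
      intro θ
      have h1 := (((hasDerivAt_id θ).const_mul (k : ℝ)).sin).div_const (k : ℝ)
      convert! h1 using 1
      simp [hk]
    rw [intervalIntegral.integral_eq_sub_of_hasDerivAt (fun θ _ => hderiv θ)
      (Continuous.intervalIntegrable (by fun_prop) _ _)]
    have h2 : Real.sin (k * (2 * Real.pi)) = 0 := by
      have := Real.sin_int_mul_pi (k * 2)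
      push_cast at this
      rwa [mul_assoc] at this
    simp [h2]

/-- The angular density `1 - cos 2θ` of the Haar measure is not seen by functions of period
`2π / n`, for `n > 2`. -/
lemma integral_cos_pow_mul_one_sub_cos {n : ℕ} (hn : 2 < n) (m : ℕ) (j : ℤ) :
    ∫ θ in (0 : ℝ)..(2 * Real.pi),
        Real.cos (n * θ) ^ m * Real.cos (j * n * θ) * (1 - Real.cos (2 * θ)) =
      ∫ θ in (0 : ℝ)..(2 * Real.pi), Real.cos θ ^ m * Real.cos (j * θ) := by
  induction m generalizing j with
  | zero =>
    have h1 : ∀ θ : ℝ, Real.cos (n * θ) ^ 0 * Real.cos (j * n * θ) * (1 - Real.cos (2 * θ)) =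
        Real.cos ((j * n : ℤ) * θ) - (Real.cos ((j * n + 2 : ℤ) * θ) +
          Real.cos ((j * n - 2 : ℤ) * θ)) / 2 := by
      intro θ
      have e1 : ((j * n + 2 : ℤ) : ℝ) * θ = (j * n : ℤ) * θ + 2 * θ := by push_cast; ring
      have e2 : ((j * n - 2 : ℤ) : ℝ) * θ = (j * n : ℤ) * θ - 2 * θ := by push_cast; ring
      rw [e1, e2, Real.cos_add, Real.cos_sub]
      push_cast
      ring
    have hj1 : j * n + 2 ≠ 0 := by
      intro h
      have : (n : ℤ) ∣ 2 := ⟨-j, by linarith⟩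
      have := Int.le_of_dvd (by norm_num) this
      omega
    have hj2 : j * n - 2 ≠ 0 := by
      intro h
      have : (n : ℤ) ∣ 2 := ⟨j, by linarith⟩
      have := Int.le_of_dvd (by norm_num) this
      omega
    simp only [h1]
    rw [intervalIntegral.integral_sub (Continuous.intervalIntegrable (by fun_prop) _ _)
      (Continuous.intervalIntegrable (by fun_prop) _ _), intervalIntegral.integral_div,
      intervalIntegral.integral_add (Continuous.intervalIntegrable (by fun_prop) _ _)
      (Continuous.intervalIntegrable (by fun_prop) _ _), integral_cos_int_mul,
      integral_cos_int_mul, integral_cos_int_mul, if_neg hj1, if_neg hj2]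
    simp only [pow_zero, one_mul]
    rw [integral_cos_int_mul]
    have : n ≠ 0 := by omega
    simp [this]
  | succ m ih =>
    have h1 : ∀ θ : ℝ, Real.cos (n * θ) ^ (m + 1) * Real.cos (j * n * θ) *
        (1 - Real.cos (2 * θ)) =
        (Real.cos (n * θ) ^ m * Real.cos ((j + 1 : ℤ) * n * θ) * (1 - Real.cos (2 * θ)) +
          Real.cos (n * θ) ^ m * Real.cos ((j - 1 : ℤ) * n * θ) * (1 - Real.cos (2 * θ))) / 2 := by
      intro θ
      have e1 : ((j + 1 : ℤ) : ℝ) * n * θ = j * n * θ + n * θ := by push_cast; ring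
      have e2 : ((j - 1 : ℤ) : ℝ) * n * θ = j * n * θ - n * θ := by push_cast; ring
      rw [e1, e2, Real.cos_add, Real.cos_sub]
      ring
    have h2 : ∀ θ : ℝ, Real.cos θ ^ (m + 1) * Real.cos (j * θ) =
        (Real.cos θ ^ m * Real.cos ((j + 1 : ℤ) * θ) +
          Real.cos θ ^ m * Real.cos ((j - 1 : ℤ) * θ)) / 2 := by
      intro θ
      have e1 : ((j + 1 : ℤ) : ℝ) * θ = j * θ + θ := by push_cast; ring
      have e2 : ((j - 1 : ℤ) : ℝ) * θ = j * θ - θ := by push_cast; ring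
      rw [e1, e2, Real.cos_add, Real.cos_sub]
      ring
    simp only [h1, h2]
    rw [intervalIntegral.integral_div, intervalIntegral.integral_div,
      intervalIntegral.integral_add (Continuous.intervalIntegrable (by fun_prop) _ _)
      (Continuous.intervalIntegrable (by fun_prop) _ _),
      intervalIntegral.integral_add (Continuous.intervalIntegrable (by fun_prop) _ _)
      (Continuous.intervalIntegrable (by fun_prop) _ _), ih, ih]

lemma integral_eval_cos_mul_one_sub_cos {n : ℕ} (hn : 2 < n) (P : Polynomial ℝ) :
    ∫ θ in (0 : ℝ)..(2 * Real.pi), P.eval (Real.cos (n * θ)) * (1 - Real.cos (2 * θ)) =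
      ∫ θ in (0 : ℝ)..(2 * Real.pi), P.eval (Real.cos θ) := by
  have hc1 : ∀ p : Polynomial ℝ, IntervalIntegrable
      (fun θ => p.eval (Real.cos (n * θ)) * (1 - Real.cos (2 * θ))) volume 0 (2 * Real.pi) :=
    fun p => Continuous.intervalIntegrable
      ((p.continuous.comp (by fun_prop : Continuous fun θ : ℝ => Real.cos (n * θ))).mul
        (by fun_prop)) _ _
  have hc2 : ∀ p : Polynomial ℝ, IntervalIntegrable
      (fun θ => p.eval (Real.cos θ)) volume 0 (2 * Real.pi) := fun p =>
    Continuous.intervalIntegrable (p.continuous.comp Real.continuous_cos) _ _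
  induction P using Polynomial.induction_on' with
  | add p q hp hq =>
    simp only [Polynomial.eval_add, add_mul]
    rw [intervalIntegral.integral_add (hc1 p) (hc1 q),
      intervalIntegral.integral_add (hc2 p) (hc2 q), hp, hq]
  | monomial j c =>
    simp only [Polynomial.eval_monomial, mul_assoc]
    rw [intervalIntegral.integral_const_mul, intervalIntegral.integral_const_mul]
    have := integral_cos_pow_mul_one_sub_cos hn j 0
    simp only [Int.cast_zero, zero_mul, Real.cos_zero, mul_one] at this
    rw [this]

/-- For `n > 2`, the cosine `Tₙ (cos θ) = cos (n θ)` of `n` times the class angle of a Haar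
distributed rotation has the distribution of the cosine of a uniform angle. -/
lemma integral_eval_chebyshev_halfTrace {n : ℕ} (hn : 2 < n) (P : Polynomial ℝ) :
    ∫ g, P.eval ((Polynomial.Chebyshev.T ℝ n).eval (halfTrace g)) ∂haarSU2 =
      (2 * Real.pi)⁻¹ * ∫ θ in (0 : ℝ)..(2 * Real.pi), P.eval (Real.cos θ) := by
  have h := integral_eval_halfTrace (P.comp (Polynomial.Chebyshev.T ℝ n))
  simp only [Polynomial.eval_comp] at h
  have h2 : ∀ θ : ℝ, P.eval ((Polynomial.Chebyshev.T ℝ n).eval (Real.cos θ)) * Real.sin θ ^ 2 =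
      2⁻¹ * (P.eval (Real.cos (n * θ)) * (1 - Real.cos (2 * θ))) := by
    intro θ
    rw [Polynomial.Chebyshev.T_real_cos, Real.cos_two_mul, Real.sin_sq]
    push_cast
    ring
  simp only [h2] at h
  rw [h, intervalIntegral.integral_const_mul, integral_eval_cos_mul_one_sub_cos hn, mul_inv]
  ring

/-- Two random variables in `[-1, 1]` with the same moments have the same distribution, by the
Weierstrass approximation theorem. -/
lemma integral_comp_eq_of_moments {X Y : Type} [MeasurableSpace X] [MeasurableSpace Y]
    (μ : Measure X) (ν : Measure Y) [IsProbabilityMeasure μ] [IsProbabilityMeasure ν]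
    {u : X → ℝ} {v : Y → ℝ} (hu : Measurable u) (hv : Measurable v)
    (hu1 : ∀ x, u x ∈ Set.Icc (-1 : ℝ) 1) (hv1 : ∀ y, v y ∈ Set.Icc (-1 : ℝ) 1)
    (h : ∀ P : Polynomial ℝ, ∫ x, P.eval (u x) ∂μ = ∫ y, P.eval (v y) ∂ν)
    {f : ℝ → ℂ} (hf : ContinuousOn f (Set.Icc (-1) 1)) :
    ∫ x, f (u x) ∂μ = ∫ y, f (v y) ∂ν := by
  have hle : (-1 : ℝ) ≤ 1 := by norm_num
  -- Integrability of continuous functions of a bounded variable.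
  have hi : ∀ {Z : Type} [MeasurableSpace Z] (m : Measure Z) [IsProbabilityMeasure m]
      {χ : Z → ℝ}, Measurable χ → (∀ z, χ z ∈ Set.Icc (-1 : ℝ) 1) → ∀ k : ℝ → ℝ, Continuous k →
      Integrable (fun z => k (χ z)) m := by
    intro Z _ m _ χ hχ hχ1 k hk
    obtain ⟨C, hC⟩ := isCompact_Icc.exists_bound_of_continuousOn
      (hk.continuousOn (s := Set.Icc (-1) 1))
    exact Integrable.of_bound (hk.measurable.comp hχ).aestronglyMeasurable C
      (Filter.Eventually.of_forall fun z => hC _ (hχ1 z))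
  have hreal : ∀ k : ℝ → ℝ, Continuous k → ∫ x, k (u x) ∂μ = ∫ y, k (v y) ∂ν := by
    intro k hk
    refine eq_of_abs_sub_le_all fun ε hε => ?_
    obtain ⟨P, hP⟩ := exists_polynomial_near_of_continuousOn (-1) 1 k hk.continuousOn (ε / 2)
      (half_pos hε)
    have hclose : ∀ {Z : Type} [MeasurableSpace Z] (m : Measure Z) [IsProbabilityMeasure m]
        {χ : Z → ℝ}, Measurable χ → (∀ z, χ z ∈ Set.Icc (-1 : ℝ) 1) →
        |∫ z, P.eval (χ z) ∂m - ∫ z, k (χ z) ∂m| ≤ ε / 2 := by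
      intro Z _ m _ χ hχ hχ1
      rw [← integral_sub (hi m hχ hχ1 _ P.continuous) (hi m hχ hχ1 k hk)]
      have := norm_integral_le_of_norm_le_const (μ := m) (f := fun z => P.eval (χ z) - k (χ z))
        (Filter.Eventually.of_forall fun z => (hP _ (hχ1 z)).le)
      simpa using this
    have h1 := abs_le.1 (hclose μ hu hu1)
    have h2 := abs_le.1 (hclose ν hv hv1)
    rw [h P] at h1
    rw [abs_le]
    constructor <;> linarith
  set F : ℝ → ℂ := Set.IccExtend hle (Set.domRestrict (Set.Icc (-1) 1) f) with hF
  have hFc : Continuous F := hf.domRestrict.Icc_extend'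
  have hFf : ∀ x ∈ Set.Icc (-1 : ℝ) 1, F x = f x := fun x hx => by
    rw [hF, Set.IccExtend_of_mem hle _ hx]; rfl
  have hsplit : ∀ {Z : Type} [MeasurableSpace Z] (m : Measure Z) [IsProbabilityMeasure m]
      {χ : Z → ℝ}, Measurable χ → (∀ z, χ z ∈ Set.Icc (-1 : ℝ) 1) →
      ∫ z, f (χ z) ∂m = (∫ z, (F (χ z)).re ∂m : ℝ) + (∫ z, (F (χ z)).im ∂m : ℝ) * Complex.I := by
    intro Z _ m _ χ hχ hχ1
    have h1 := hi m hχ hχ1 _ (Complex.continuous_re.comp hFc)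
    have h2 := hi m hχ hχ1 _ (Complex.continuous_im.comp hFc)
    rw [← integral_complex_ofReal, ← integral_complex_ofReal, ← integral_mul_const,
      ← integral_add h1.ofReal (h2.ofReal.mul_const _)]
    refine integral_congr_ae (Filter.Eventually.of_forall fun z => ?_)
    simp only
    rw [← hFf _ (hχ1 z)]
    exact (Complex.re_add_im _).symm
  rw [hsplit μ hu hu1, hsplit ν hv hv1,
    hreal (fun x => (F x).re) (Complex.continuous_re.comp hFc),
    hreal (fun x => (F x).im) (Complex.continuous_im.comp hFc)]

lemma chebyshev_halfTrace_mem (n : ℕ) (g : SU2) :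
    (Polynomial.Chebyshev.T ℝ n).eval (halfTrace g) ∈ Set.Icc (-1 : ℝ) 1 := by
  have h := abs_le.1 (abs_halfTrace_le g)
  rw [← Real.cos_arccos h.1 h.2, Polynomial.Chebyshev.T_real_cos]
  exact Real.cos_mem_Icc _

/-- The class function `Tₙ (tr g / 2)`, for `n > 2`, is distributed like the cosine of a uniform
angle. -/
lemma integral_comp_chebyshev_halfTrace {n : ℕ} (hn : 2 < n) {f : ℝ → ℂ}
    (hf : ContinuousOn f (Set.Icc (-1) 1)) :
    ∫ g, f ((Polynomial.Chebyshev.T ℝ n).eval (halfTrace g)) ∂haarSU2 =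
      (2 * Real.pi : ℂ)⁻¹ * ∫ θ in (0 : ℝ)..(2 * Real.pi), f (Real.cos θ) := by
  have hpi : (0 : ℝ) < 2 * Real.pi := by positivity
  let ν : Measure ℝ := (ENNReal.ofReal (2 * Real.pi))⁻¹ • volume.restrict (Set.Ioc 0 (2 * Real.pi))
  have hν : IsProbabilityMeasure ν := by
    refine ⟨?_⟩
    simp only [ν, Measure.smul_apply, Measure.restrict_apply_univ, Real.volume_Ioc, sub_zero,
      smul_eq_mul]
    exact ENNReal.inv_mul_cancel (by simpa using hpi) ENNReal.ofReal_ne_top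
  have hνint : ∀ {E : Type} [NormedAddCommGroup E] [NormedSpace ℝ E] (k : ℝ → E),
      ∫ θ, k θ ∂ν = (2 * Real.pi)⁻¹ • ∫ θ in (0 : ℝ)..(2 * Real.pi), k θ := by
    intro E _ _ k
    rw [integral_smul_measure, intervalIntegral.integral_of_le hpi.le, ENNReal.toReal_inv,
      ENNReal.toReal_ofReal hpi.le]
  have h := integral_comp_eq_of_moments haarSU2 ν
    (u := fun g => (Polynomial.Chebyshev.T ℝ n).eval (halfTrace g)) (v := Real.cos)
    ((Polynomial.continuous _).comp continuous_halfTrace).measurable Real.measurable_cos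
    (chebyshev_halfTrace_mem n) Real.cos_mem_Icc
    (fun P => by rw [integral_eval_chebyshev_halfTrace hn, hνint, smul_eq_mul]) hf
  rw [h, hνint, Complex.real_smul]
  push_cast
  rfl

/-! ### Complex Gaussian integrals -/

lemma integrable_exp_neg_mul_normSq {c : ℝ} (hc : 0 < c) :
    Integrable fun w : ℂ => Real.exp (-(c * Complex.normSq w)) := by
  have h := Complex.integral_rpow_mul_exp_neg_mul_rpow (p := 2) (q := 0) (b := c) (by norm_num)
    (by norm_num) hc
  have h2 : ∀ w : ℂ, ‖w‖ ^ (0 : ℝ) * Real.exp (-c * ‖w‖ ^ (2 : ℝ)) =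
      Real.exp (-(c * Complex.normSq w)) := by
    intro w
    rw [Real.rpow_zero, one_mul, Complex.normSq_eq_norm_sq, ← Real.rpow_natCast]
    push_cast
    ring_nf
  simp only [h2] at h
  apply Integrable.of_integral_ne_zero
  rw [h]
  have h3 : (0 : ℝ) < Real.Gamma ((0 + 2) / 2) := Real.Gamma_pos_of_pos (by norm_num)
  have := Real.pi_pos
  have := Real.rpow_pos_of_pos hc (-(0 + 2) / 2)
  positivity

/-- The coefficients `b` of `star w` and `c` of `w` are independent, because the forms to which this
applies need not be Hermitian. -/
lemma integral_cexp_one_variable {a : ℂ} (ha : 0 < a.re) (b c d : ℂ) :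
    ∫ w : ℂ, Complex.exp (-(a * Complex.normSq w + star w * b + c * w + d)) =
      Real.pi / a * Complex.exp (b * c / a - d) := by
  have ha0 : a ≠ 0 := by rintro rfl; simp at ha
  have hpi : (Real.pi : ℂ) / a ≠ 0 := div_ne_zero (by exact_mod_cast Real.pi_ne_zero) ha0
  have hsplit : ∀ x y : ℝ, Complex.exp (-(a * Complex.normSq (⟨x, y⟩ : ℂ) +
      star (⟨x, y⟩ : ℂ) * b + c * (⟨x, y⟩ : ℂ) + d)) =
      Complex.exp ((-a) * x ^ 2 + (-(b + c)) * x + -d) *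
        Complex.exp ((-a) * y ^ 2 + (Complex.I * (b - c)) * y + 0) := by
    intro x y
    rw [← Complex.exp_add]
    congr 1
    have h1 : (⟨x, y⟩ : ℂ) = x + y * Complex.I := Complex.mk_eq_add_mul_I x y
    have h2 : star (⟨x, y⟩ : ℂ) = x - y * Complex.I := by
      rw [h1]; simp [sub_eq_add_neg]
    have h3 : ((Complex.normSq (⟨x, y⟩ : ℂ) : ℝ) : ℂ) = x ^ 2 + y ^ 2 := by
      simp [Complex.normSq_apply]; ring
    rw [h3, h2, h1]
    ring
  have h := Complex.volume_preserving_equiv_real_prod.symm.integral_comp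
    Complex.measurableEquivRealProd.symm.measurableEmbedding
    (fun w : ℂ => Complex.exp (-(a * Complex.normSq w + star w * b + c * w + d)))
  rw [← h]
  have h4 : ∀ p : ℝ × ℝ, Complex.measurableEquivRealProd.symm p = ⟨p.1, p.2⟩ := fun p => rfl
  simp only [h4, hsplit]
  rw [Measure.volume_eq_prod, integral_prod_mul
    (fun x : ℝ => Complex.exp ((-a) * x ^ 2 + (-(b + c)) * x + -d))
    (fun y : ℝ => Complex.exp ((-a) * y ^ 2 + (Complex.I * (b - c)) * y + 0)),
    integral_cexp_quadratic (by simpa using ha), integral_cexp_quadratic (by simpa using ha),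
    neg_neg, mul_mul_mul_comm, ← Complex.cpow_add _ _ hpi, ← Complex.exp_add]
  norm_num
  left
  congr 1
  have : Complex.I ^ 2 = -1 := Complex.I_sq
  field_simp
  linear_combination (b - c) ^ 2 * this

/-- The Gaussian integral of an accretive complex quadratic form, by integrating out one variable
after the other: each step replaces the matrix by a Schur complement. -/
lemma integral_cexp_sesquilinear_fin (n : ℕ) (A : Matrix (Fin n) (Fin n) ℂ) {ε : ℝ} (hε : 0 < ε)
    (hA : ∀ u : Fin n → ℂ, ε * ∑ i, Complex.normSq (u i) ≤ (star u ⬝ᵥ (A *ᵥ u)).re) :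
    A.det ≠ 0 ∧ ∫ u : Fin n → ℂ, Complex.exp (-(star u ⬝ᵥ (A *ᵥ u))) = Real.pi ^ n / A.det := by
  induction n with
  | zero => simp [measureReal_def, volume_pi]
  | succ n ih =>
    set a := A 0 0 with ha
    have hare : 0 < a.re := by
      have h := hA (Pi.single 0 1)
      have h1 : star (Pi.single 0 1 : Fin (n + 1) → ℂ) ⬝ᵥ (A *ᵥ Pi.single 0 1) = a := by
        rw [Matrix.mulVec_single_one]
        simp [dotProduct, Pi.single_apply, ha]
      rw [h1, Fin.sum_univ_succ] at h
      simp at h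
      linarith
    have ha0 : a ≠ 0 := by intro h; rw [h] at hare; simp at hare
    let S : Matrix (Fin n) (Fin n) ℂ := Matrix.of fun i j =>
      A i.succ j.succ - A i.succ 0 * A 0 j.succ / a
    let b : (Fin n → ℂ) → ℂ := fun v => ∑ j, A 0 j.succ * v j
    let c : (Fin n → ℂ) → ℂ := fun v => ∑ i, star (v i) * A i.succ 0
    let d : (Fin n → ℂ) → ℂ := fun v => ∑ i, ∑ j, star (v i) * (A i.succ j.succ * v j)
    have hform : ∀ (w : ℂ) (v : Fin n → ℂ), star (Fin.cons w v : Fin (n + 1) → ℂ) ⬝ᵥ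
        (A *ᵥ (Fin.cons w v : Fin (n + 1) → ℂ)) =
        a * Complex.normSq w + star w * b v + c v * w + d v := by
      intro w v
      simp only [dotProduct, Matrix.mulVec, Fin.sum_univ_succ, Pi.star_apply, Fin.cons_zero,
        Fin.cons_succ, Finset.mul_sum, b, c, d, mul_add, Finset.sum_add_distrib, Finset.sum_mul]
      rw [Complex.normSq_eq_conj_mul_self, ← ha, Complex.star_def]
      have h1 : ∑ i, star (v i) * (A i.succ 0 * w) = ∑ i, star (v i) * A i.succ 0 * w :=
        Finset.sum_congr rfl fun i _ => by ring
      rw [Complex.star_def] at h1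
      linear_combination h1
    have hS : ∀ v : Fin n → ℂ, star v ⬝ᵥ (S *ᵥ v) = d v - b v * c v / a := by
      intro v
      have h1 : b v * c v / a = ∑ i, ∑ j, star (v i) * ((A i.succ 0 * A 0 j.succ / a) * v j) := by
        simp only [b, c]
        rw [mul_comm, Finset.sum_mul_sum, Finset.sum_div]
        refine Finset.sum_congr rfl fun i _ => ?_
        rw [Finset.sum_div]
        exact Finset.sum_congr rfl fun j _ => by ring
      rw [h1]
      simp only [dotProduct, Matrix.mulVec, S, Matrix.of_apply, Pi.star_apply, d, Finset.mul_sum,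
        sub_mul, mul_sub, Finset.sum_sub_distrib]
    -- The Schur complement inherits the lower bound: it is the form at the critical value of `w`.
    have hSacc : ∀ v : Fin n → ℂ, ε * ∑ i, Complex.normSq (v i) ≤ (star v ⬝ᵥ (S *ᵥ v)).re := by
      intro v
      have h := hA (Fin.cons (-(b v / a)) v)
      rw [hform, Fin.sum_univ_succ] at h
      have h1 : a * Complex.normSq (-(b v / a)) + star (-(b v / a)) * b v + c v * -(b v / a) + d v =
          star v ⬝ᵥ (S *ᵥ v) := by
        rw [hS, Complex.normSq_eq_conj_mul_self, Complex.star_def]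
        field_simp
        ring
      rw [h1] at h
      simp only [Fin.cons_zero, Fin.cons_succ] at h
      have := mul_nonneg hε.le (Complex.normSq_nonneg (-(b v / a)))
      linarith [mul_add ε (Complex.normSq (-(b v / a))) (∑ i, Complex.normSq (v i))]
    obtain ⟨hS0, hSint⟩ := ih S hSacc
    -- Subtracting multiples of the first row clears the first column.
    have hdet : A.det = a * S.det := by
      let B : Matrix (Fin (n + 1)) (Fin (n + 1)) ℂ := Matrix.of fun i j =>
        if i = 0 then A 0 j else A i j - A i 0 / a * A 0 j
      have h1 : A.det = B.det := by
        refine Matrix.det_eq_of_forall_row_eq_smul_add_const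
          (fun i => if i = 0 then 0 else A i 0 / a) 0 (by simp) fun i j => ?_
        by_cases hi : i = 0
        · simp [B, hi]
        · simp [B, hi]
      have h2 : ∀ i : Fin n, B i.succ 0 = 0 := by
        intro i
        simp only [B, Matrix.of_apply, Fin.succ_ne_zero, if_false]
        rw [← ha, div_mul_cancel₀ _ ha0, sub_self]
      have h3 : B.submatrix (Fin.succAbove 0) Fin.succ = S := by
        ext i j
        simp [B, S]
        ring
      rw [h1, Matrix.det_succ_column_zero, Fin.sum_univ_succ]
      simp only [h2, h3]
      simp [B, ha]
    have hvol := (volume_preserving_piFinSuccAbove (fun _ : Fin (n + 1) => ℂ) 0).symm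
    have hcons : ∀ p : ℂ × (Fin n → ℂ),
        (MeasurableEquiv.piFinSuccAbove (fun _ : Fin (n + 1) => ℂ) 0).symm p =
          (Fin.cons p.1 p.2 : Fin (n + 1) → ℂ) := by
      intro p
      rw [MeasurableEquiv.piFinSuccAbove_symm_apply, Fin.insertNthEquiv_zero]
      rfl
    have hInt : Integrable fun u : Fin (n + 1) → ℂ => Complex.exp (-(star u ⬝ᵥ (A *ᵥ u))) := by
      have h1 : Integrable (fun u : Fin (n + 1) → ℂ =>
          ∏ i, Real.exp (-(ε * Complex.normSq (u i)))) volume :=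
        Integrable.fintype_prod fun _ => integrable_exp_neg_mul_normSq hε
      refine h1.mono' ?_ (Filter.Eventually.of_forall fun u => ?_)
      · refine Continuous.aestronglyMeasurable ?_
        refine Complex.continuous_exp.comp (Continuous.neg ?_)
        exact (continuous_star).dotProduct (continuous_const.matrix_mulVec continuous_id)
      · rw [Complex.norm_exp, ← Real.exp_sum, Real.exp_le_exp, Complex.neg_re,
          Finset.sum_neg_distrib, ← Finset.mul_sum]
        exact neg_le_neg (hA u)
    refine ⟨by rw [hdet]; exact mul_ne_zero ha0 hS0, ?_⟩
    rw [← hvol.integral_comp' (g := fun u : Fin (n + 1) → ℂ => Complex.exp (-(star u ⬝ᵥ (A *ᵥ u))))]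
    have hInt2 : Integrable (fun p : ℂ × (Fin n → ℂ) => Complex.exp (-(star
        ((MeasurableEquiv.piFinSuccAbove (fun _ : Fin (n + 1) => ℂ) 0).symm p) ⬝ᵥ
        (A *ᵥ ((MeasurableEquiv.piFinSuccAbove (fun _ : Fin (n + 1) => ℂ) 0).symm p)))))
        (volume.prod volume) :=
      (hvol.integrable_comp_emb (MeasurableEquiv.measurableEmbedding _)).2 hInt
    rw [Measure.volume_eq_prod, integral_prod_symm _ hInt2]
    simp only [hcons, hform]
    have hinner : ∀ v : Fin n → ℂ, ∫ w : ℂ, Complex.exp (-(a * Complex.normSq w + star w * b v +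
        c v * w + d v)) = Real.pi / a * Complex.exp (-(star v ⬝ᵥ (S *ᵥ v))) := by
      intro v
      rw [integral_cexp_one_variable hare, hS]
      congr 2
      ring
    simp only [hinner]
    rw [integral_const_mul, hSint, hdet, pow_succ']
    field_simp

lemma integral_cexp_sesquilinear {κ : Type*} [Fintype κ] [DecidableEq κ] (A : Matrix κ κ ℂ) {ε : ℝ}
    (hε : 0 < ε)
    (hA : ∀ u : κ → ℂ, ε * ∑ i, Complex.normSq (u i) ≤ (star u ⬝ᵥ (A *ᵥ u)).re) :
    A.det ≠ 0 ∧ ∫ u : κ → ℂ, Complex.exp (-(star u ⬝ᵥ (A *ᵥ u))) =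
      Real.pi ^ Fintype.card κ / A.det := by
  let e := Fintype.equivFin κ
  let B : Matrix (Fin (Fintype.card κ)) (Fin (Fintype.card κ)) ℂ := A.submatrix e.symm e.symm
  have hdet : B.det = A.det := Matrix.det_submatrix_equiv_self e.symm A
  have hform : ∀ u : κ → ℂ, star (u ∘ e.symm) ⬝ᵥ (B *ᵥ (u ∘ e.symm)) = star u ⬝ᵥ (A *ᵥ u) := by
    intro u
    simp only [dotProduct, Matrix.mulVec, B, Matrix.submatrix_apply, Pi.star_apply,
      Function.comp_apply]
    rw [← e.symm.sum_comp fun i => star (u i) * ∑ j, A i j * u j]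
    refine Finset.sum_congr rfl fun i _ => ?_
    rw [← e.symm.sum_comp fun j => A (e.symm i) j * u j]
  have hB : ∀ u : Fin (Fintype.card κ) → ℂ,
      ε * ∑ i, Complex.normSq (u i) ≤ (star u ⬝ᵥ (B *ᵥ u)).re := by
    intro u
    have h1 := hform (u ∘ e)
    have h2 : (u ∘ e) ∘ e.symm = u := by ext; simp
    rw [h2] at h1
    rw [h1, ← e.sum_comp fun i => Complex.normSq (u i)]
    exact hA (u ∘ e)
  have h := integral_cexp_sesquilinear_fin _ B hε hB
  rw [hdet] at h
  refine ⟨h.1, ?_⟩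
  rw [← h.2, ← (volume_measurePreserving_piCongrLeft (fun _ => ℂ) e).integral_comp'
    (g := fun u : Fin (Fintype.card κ) → ℂ => Complex.exp (-(star u ⬝ᵥ (B *ᵥ u))))]
  refine integral_congr_ae (Filter.Eventually.of_forall fun u => ?_)
  have h3 : (MeasurableEquiv.piCongrLeft (fun _ => ℂ) e) u = u ∘ e.symm := by
    ext i
    obtain ⟨j, rfl⟩ := e.surjective i
    rw [MeasurableEquiv.piCongrLeft_apply_apply]
    simp
  simp only [h3, hform]

/-! ### The Gaussian model of the boundary state -/

/-- Complex coordinates on the spinors at the nodes: the entries of the first row of the quaternion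
`spinorMatrix (z p)`. In them, the exponent of the generating function is sesquilinear. -/
def rowCoord {α : Type*} (z : α → Fin 2 → ℂ) : α ⊕ α → ℂ :=
  Sum.elim (fun p => z p 0) fun p => -star (z p 1)

lemma measurePreserving_neg_star : MeasurePreserving (fun w : ℂ => -star w) volume volume :=
  (Measure.measurePreserving_neg volume).comp Complex.conjLIE.measurePreserving

lemma measurePreserving_rowCoord {α : Type*} [Fintype α] :
    MeasurePreserving (rowCoord : (α → Fin 2 → ℂ) → α ⊕ α → ℂ) volume volume := by
  have hm : Measurable (rowCoord : (α → Fin 2 → ℂ) → α ⊕ α → ℂ) := by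
    refine Continuous.measurable (continuous_pi ?_)
    rintro (p | p) <;> simp only [rowCoord, Sum.elim_inl, Sum.elim_inr] <;> fun_prop
  refine ⟨hm, ?_⟩
  symm
  refine Measure.pi_eq fun s hs => ?_
  rw [Measure.map_apply hm (MeasurableSet.univ_pi hs)]
  have h1 : rowCoord ⁻¹' Set.univ.pi s = Set.univ.pi fun p : α => Set.univ.pi
      ![s (Sum.inl p), (fun w : ℂ => -star w) ⁻¹' s (Sum.inr p)] := by
    ext z
    simp [rowCoord, Set.mem_pi, Fin.forall_fin_two, Sum.forall, forall_and]
  rw [h1, volume_pi, Measure.pi_pi, Fintype.prod_sum_type, ← Finset.prod_mul_distrib]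
  refine Finset.prod_congr rfl fun p _ => ?_
  rw [volume_pi_pi, Fin.prod_univ_two]
  simp only [Matrix.cons_val_zero, Matrix.cons_val_one]
  rw [measurePreserving_neg_star.measure_preimage (hs _).nullMeasurableSet]

lemma sum_normSq_rowCoord {α : Type*} [Fintype α] (z : α → Fin 2 → ℂ) :
    ∑ i, Complex.normSq (rowCoord z i) = ∑ p, spinorNormSq (z p) := by
  rw [Fintype.sum_sum_type, ← Finset.sum_add_distrib]
  refine Finset.sum_congr rfl fun p _ => ?_
  simp [rowCoord, spinorNormSq]

lemma rowCoord_surjective {α : Type*} :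
    Function.Surjective (rowCoord : (α → Fin 2 → ℂ) → α ⊕ α → ℂ) := by
  intro u
  refine ⟨fun p => ![u (Sum.inl p), -star (u (Sum.inr p))], ?_⟩
  ext i
  rcases i with p | p <;> simp [rowCoord]

/-- The exponential of a sesquilinear form in the row coordinates has Gaussian average
`1 / det (1 - M)`. -/
lemma integral_cexp_rowCoord {α : Type*} [Fintype α] [DecidableEq α]
    (M : Matrix (α ⊕ α) (α ⊕ α) ℂ) {c : ℝ} (hc : c < 1)
    (hM : ∀ z : α → Fin 2 → ℂ, ‖star (rowCoord z) ⬝ᵥ (M *ᵥ rowCoord z)‖ ≤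
      c * ∑ p, spinorNormSq (z p)) :
    (1 - M).det ≠ 0 ∧ ∫ z : α → Fin 2 → ℂ, Complex.exp (star (rowCoord z) ⬝ᵥ (M *ᵥ rowCoord z))
      ∂(Measure.pi fun _ => spinorGaussian) = ((1 - M).det)⁻¹ := by
  have hnorm : ∀ u : α ⊕ α → ℂ, star u ⬝ᵥ u = ((∑ i, Complex.normSq (u i) : ℝ) : ℂ) := by
    intro u
    simp only [dotProduct, Pi.star_apply, Complex.star_def, ← Complex.normSq_eq_conj_mul_self]
    push_cast
    rfl
  have hform : ∀ u : α ⊕ α → ℂ, star u ⬝ᵥ ((1 - M) *ᵥ u) =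
      ((∑ i, Complex.normSq (u i) : ℝ) : ℂ) - star u ⬝ᵥ (M *ᵥ u) := by
    intro u
    rw [Matrix.sub_mulVec, Matrix.one_mulVec, dotProduct_sub, hnorm]
  obtain ⟨hdet, hint⟩ := integral_cexp_sesquilinear (1 - M) (ε := 1 - c) (by linarith) (by
    intro u
    obtain ⟨z, rfl⟩ := rowCoord_surjective u
    have h1 := (Complex.re_le_norm _).trans (hM z)
    rw [hform, sum_normSq_rowCoord, Complex.sub_re, Complex.ofReal_re]
    linarith)
  refine ⟨hdet, ?_⟩
  have hi := integrable_spinorNormSq_pow_mul_exp 0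
  simp only [pow_zero, one_mul] at hi
  have hdens : Measurable fun z : α → Fin 2 → ℂ =>
      ∏ p, Real.exp (-spinorNormSq (z p)) / Real.pi ^ 2 :=
    Finset.measurable_fun_prod _ fun p _ => measurable_gaussianDensity.comp (measurable_pi_apply p)
  have hpos : ∀ z : α → Fin 2 → ℂ, 0 ≤ ∏ p, Real.exp (-spinorNormSq (z p)) / Real.pi ^ 2 :=
    fun z => Finset.prod_nonneg fun p _ => by positivity
  simp only [spinorGaussian]
  rw [pi_withDensity volume (fun _ => hi.div_const _) (fun _ _ => by positivity),
    integral_withDensity_eq_integral_toReal_smul hdens.ennreal_ofReal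
      (Filter.Eventually.of_forall fun z => ENNReal.ofReal_lt_top)]
  have hint2 : ∫ z : α → Fin 2 → ℂ, Complex.exp (-(star (rowCoord z) ⬝ᵥ ((1 - M) *ᵥ rowCoord z))) =
      Real.pi ^ Fintype.card (α ⊕ α) / (1 - M).det := by
    have hmp := measurePreserving_rowCoord (α := α)
    rw [← hint, ← hmp.map_eq, integral_map hmp.measurable.aemeasurable]
    refine Continuous.aestronglyMeasurable ?_
    refine Complex.continuous_exp.comp (Continuous.neg ?_)
    exact (continuous_star).dotProduct (continuous_const.matrix_mulVec continuous_id)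
  have hpi : ((Real.pi : ℂ) ^ 2) ^ Fintype.card α ≠ 0 :=
    pow_ne_zero _ (pow_ne_zero _ (by exact_mod_cast Real.pi_ne_zero))
  have hcard : (Real.pi : ℂ) ^ Fintype.card (α ⊕ α) = ((Real.pi : ℂ) ^ 2) ^ Fintype.card α := by
    rw [Fintype.card_sum, ← pow_mul]; ring_nf
  rw [hcard] at hint2
  have h3 : ∀ z : α → Fin 2 → ℂ,
      (ENNReal.ofReal (∏ p, Real.exp (-spinorNormSq (z p)) / Real.pi ^ 2)).toReal •
        Complex.exp (star (rowCoord z) ⬝ᵥ (M *ᵥ rowCoord z)) =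
      (((Real.pi : ℂ) ^ 2) ^ Fintype.card α)⁻¹ *
        Complex.exp (-(star (rowCoord z) ⬝ᵥ ((1 - M) *ᵥ rowCoord z))) := by
    intro z
    rw [ENNReal.toReal_ofReal (hpos z), Complex.real_smul, Finset.prod_div_distrib,
      ← Real.exp_sum, Finset.prod_const, Finset.card_univ, hform, sum_normSq_rowCoord, neg_sub,
      Complex.exp_sub]
    rw [Finset.sum_neg_distrib, Real.exp_neg]
    push_cast
    field_simp
  rw [← volume_pi]
  simp only [h3]
  rw [integral_const_mul, hint2]
  field_simp

/-! ### The generating function of coherent spin networks -/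

/-- The assertion that the product over `ι` of absolutely convergent series is the sum over all
multi-indices of the products of their terms, and that this sum converges absolutely. -/
def HasSumPiProd (𝕜 : Type) [RCLike 𝕜] (ι : Type) [Fintype ι] : Prop :=
  ∀ (f : ι → ℕ → 𝕜) (s : ι → 𝕜),
    (∀ i, HasSum (f i) (s i)) → (∀ i, Summable fun k => ‖f i k‖) →
    HasSum (fun c : ι → ℕ => ∏ i, f i (c i)) (∏ i, s i) ∧
      Summable fun c : ι → ℕ => ‖∏ i, f i (c i)‖

lemma HasSumPiProd.of_equiv {𝕜 : Type} [RCLike 𝕜] (α β : Type) [Fintype β] (e : α ≃ β)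
    (ih : @HasSumPiProd 𝕜 _ α (Fintype.ofEquiv β e.symm)) : HasSumPiProd 𝕜 β := by
  intro f s hf hn
  let := Fintype.ofEquiv β e.symm
  obtain ⟨h1, h2⟩ := ih (fun i => f (e i)) (fun i => s (e i)) (fun i => hf _) (fun i => hn _)
  rw [e.prod_comp s] at h1
  let E : (β → ℕ) ≃ (α → ℕ) := Equiv.arrowCongr e.symm (Equiv.refl ℕ)
  have h3 : ∀ c : β → ℕ, ∏ i, f (e i) (E c i) = ∏ i, f i (c i) := by
    intro c
    rw [← e.prod_comp fun i => f i (c i)]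
    rfl
  refine ⟨?_, ?_⟩
  · have := E.hasSum_iff.2 h1
    simpa only [Function.comp_def, h3] using this
  · have := E.summable_iff.2 h2
    simpa only [Function.comp_def, h3] using this

lemma hasSumPiProd_pempty {𝕜 : Type} [RCLike 𝕜] : HasSumPiProd 𝕜 PEmpty := by
  intro f s hf hn
  simp only [Finset.univ_eq_empty, Finset.prod_empty]
  exact ⟨hasSum_unique _, (hasSum_unique _).summable⟩

lemma HasSumPiProd.option {𝕜 : Type} [RCLike 𝕜] (α : Type) [Fintype α]
    (ih : HasSumPiProd 𝕜 α) : HasSumPiProd 𝕜 (Option α) := by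
  intro f s hf hn
  obtain ⟨h1, h2⟩ := ih (fun i => f (some i)) (fun i => s (some i)) (fun i => hf _)
    (fun i => hn _)
  obtain ⟨E, hE1, hE2⟩ : ∃ E : (Option α → ℕ) ≃ ℕ × (α → ℕ), (∀ c, (E c).1 = c none) ∧
      ∀ c i, (E c).2 i = c (some i) :=
    ⟨Equiv.piOptionEquivProd, fun _ => rfl, fun _ _ => rfl⟩
  have h3 : ∀ c : Option α → ℕ, f none (E c).1 * ∏ i, f (some i) ((E c).2 i) =
      ∏ i, f i (c i) := by
    intro c
    rw [Fintype.prod_option, hE1]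
    simp only [hE2]
  have h4 : Summable fun x : ℕ × (α → ℕ) => ‖f none x.1 * ∏ i, f (some i) (x.2 i)‖ := by
    simp only [norm_mul]
    exact (hn none).mul_of_nonneg h2 (fun _ => norm_nonneg _) (fun _ => norm_nonneg _)
  have h5 : HasSum (fun x : ℕ × (α → ℕ) => f none x.1 * ∏ i, f (some i) (x.2 i))
      (s none * ∏ i, s (some i)) := by
    have h6 : Summable fun x : ℕ × (α → ℕ) => f none x.1 * ∏ i, f (some i) (x.2 i) :=
      Summable.of_norm h4
    exact HasSum.mul (f := f none) (g := fun c : α → ℕ => ∏ i, f (some i) (c i)) (hf none) h1 h6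
  rw [Fintype.prod_option]
  refine ⟨?_, ?_⟩
  · have := E.hasSum_iff.2 h5
    simpa only [Function.comp_def, h3] using this
  · have := E.summable_iff.2 h4
    simpa only [Function.comp_def, h3] using this

lemma hasSumPiProd {𝕜 : Type} [RCLike 𝕜] (ι : Type) [Fintype ι] : HasSumPiProd 𝕜 ι :=
  Fintype.induction_empty_option (P := fun ι _ => HasSumPiProd 𝕜 ι) 
    (fun α β _ e ih => ih.of_equiv α β e) hasSumPiProd_pempty (fun α _ ih => ih.option α) ι

lemma hasSum_mul_of_summable_norm {𝕜 : Type} [RCLike 𝕜] {ι κ : Type} {F : ι → 𝕜} {G : κ → 𝕜}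
    {S T : 𝕜} (h1 : HasSum F S) (h3 : HasSum G T) (h2 : Summable fun c => ‖F c‖)
    (h4 : Summable fun c => ‖G c‖) :
    HasSum (fun c : ι × κ => F c.1 * G c.2) (S * T) :=
  HasSum.mul h1 h3 (summable_mul_of_summable_norm h2 h4)

lemma hasSum_pair_prod {𝕜 ι : Type} [RCLike 𝕜] [Fintype ι] {f g : ι → ℕ → 𝕜} {s t : ι → 𝕜}
    (hf : ∀ i, HasSum (f i) (s i)) (hfn : ∀ i, Summable fun k => ‖f i k‖)
    (hg : ∀ i, HasSum (g i) (t i)) (hgn : ∀ i, Summable fun k => ‖g i k‖) :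
    HasSum (fun c : (ι → ℕ) × (ι → ℕ) => ∏ i, (f i (c.1 i) * g i (c.2 i)))
      (∏ i, (s i * t i)) := by
  obtain ⟨h1, h2⟩ := hasSumPiProd ι f s hf hfn
  obtain ⟨h3, h4⟩ := hasSumPiProd ι g t hg hgn
  have h5 : HasSum (fun c : (ι → ℕ) × (ι → ℕ) => (∏ i, f i (c.1 i)) * ∏ i, g i (c.2 i))
      ((∏ i, s i) * ∏ i, t i) :=
    hasSum_mul_of_summable_norm (F := fun c : ι → ℕ => ∏ i, f i (c i))
      (G := fun c : ι → ℕ => ∏ i, g i (c i)) h1 h3 h2 h4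
  simp only [Finset.prod_mul_distrib]
  exact h5

lemma hasSum_pow_div_factorial (x : ℂ) :
    HasSum (fun k : ℕ => x ^ k / (k ! : ℂ)) (Complex.exp x) := by
  rw [Complex.exp_eq_exp_ℂ]
  exact NormedSpace.expSeries_div_hasSum_exp x

lemma hasSum_real_pow_div_factorial (x : ℝ) :
    HasSum (fun k : ℕ => x ^ k / (k ! : ℝ)) (Real.exp x) := by
  rw [Real.exp_eq_exp_ℝ]
  exact NormedSpace.expSeries_div_hasSum_exp x

lemma hasSum_pair_exp {ι : Type} [Fintype ι] (x y : ι → ℂ) :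
    HasSum (fun c : (ι → ℕ) × (ι → ℕ) =>
      ∏ i, (y i ^ c.1 i / ((c.1 i)! : ℂ) * (x i ^ c.2 i / ((c.2 i)! : ℂ))))
      (Complex.exp (∑ i, (y i + x i))) := by
  simp only [Complex.exp_sum, Complex.exp_add]
  exact hasSum_pair_prod (f := fun i k => y i ^ k / (k ! : ℂ)) (g := fun i k => x i ^ k / (k ! : ℂ))
    (fun i => hasSum_pow_div_factorial (y i))
    (fun i => (hasSum_pow_div_factorial (y i)).summable.norm)
    (fun i => hasSum_pow_div_factorial (x i))
    (fun i => (hasSum_pow_div_factorial (x i)).summable.norm)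

lemma hasSum_pair_real_exp {ι : Type} [Fintype ι] (x y : ι → ℝ) :
    HasSum (fun c : (ι → ℕ) × (ι → ℕ) =>
      ∏ i, (y i ^ c.1 i / ((c.1 i)! : ℝ) * (x i ^ c.2 i / ((c.2 i)! : ℝ))))
      (Real.exp (∑ i, (y i + x i))) := by
  simp only [Real.exp_sum, Real.exp_add]
  exact hasSum_pair_prod (f := fun i k => y i ^ k / (k ! : ℝ)) (g := fun i k => x i ^ k / (k ! : ℝ))
    (fun i => hasSum_real_pow_div_factorial (y i))
    (fun i => (hasSum_real_pow_div_factorial (y i)).summable.norm)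
    (fun i => hasSum_real_pow_div_factorial (x i))
    (fun i => (hasSum_real_pow_div_factorial (x i)).summable.norm)

section Nodes

variable {Nt Nx : ℕ} [NeZero Nt] [NeZero Nx]

/-- A factor at each end of each link is, node by node, raised to twice the sum of the spins. -/
lemma prod_link_pow {R : Type*} [CommMonoid R] (Nγ : ℤ) (a b : Node Nt Nx → ℕ)
    (s : Node Nt Nx → R) :
    ∏ p, (s (right p) * s p) ^ a p * (s (up Nγ p) * s p) ^ b p =
      ∏ p, s p ^ twiceNodeSpin Nγ a b p := by
  have h1 : ∏ p, s (right p) ^ a p = ∏ p, s p ^ a (right.symm p) := by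
    rw [← right.prod_comp fun p => s p ^ a (right.symm p)]
    simp
  have h2 : ∏ p, s (up Nγ p) ^ b p = ∏ p, s p ^ b ((up Nγ).symm p) := by
    rw [← (up Nγ).prod_comp fun p => s p ^ b ((up Nγ).symm p)]
    simp
  simp only [twiceNodeSpin, mul_pow, pow_add, Finset.prod_mul_distrib, h1, h2]
  rw [mul_mul_mul_comm, mul_comm]
  rw [← mul_assoc]

lemma continuous_braket (ξ : Fin 2 → ℂ) : Continuous (braket ξ) :=
  continuous_const.dotProduct (continuous_subtype_val.matrix_mulVec continuous_const)

lemma continuous_spinNetwork_integrand (Nγ : ℤ) (hH hV : Node Nt Nx → SU2) (a b : Node Nt Nx → ℕ) :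
    Continuous fun g : Node Nt Nx → SU2 =>
      ∏ p, braket ketUp ((g (right p))⁻¹ * hH p * g p) ^ a p *
        braket ketPlus ((g (up Nγ p))⁻¹ * hV p * g p) ^ b p := by
  refine continuous_finsetProd _ fun p _ => ?_
  refine Continuous.mul (((continuous_braket _).comp ?_).pow _)
    (((continuous_braket _).comp ?_).pow _)
  · exact ((continuous_apply _).inv.mul continuous_const).mul (continuous_apply _)
  · exact ((continuous_apply _).inv.mul continuous_const).mul (continuous_apply _)

/-- A simultaneous conjugation of all holonomies is absorbed by a translation of the group variables
at the nodes. -/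
lemma spinNetwork_conj (Nγ : ℤ) (hH hV : Node Nt Nx → SU2) (a b : Node Nt Nx → ℕ) (v : SU2) :
    spinNetwork Nγ (fun p => v⁻¹ * hH p * v) (fun p => v⁻¹ * hV p * v) a b =
      spinNetwork Nγ hH hV a b := by
  have h := integral_mul_left_eq_self (μ := Measure.pi fun _ : Node Nt Nx => haarSU2)
    (fun g : Node Nt Nx → SU2 => ∏ p, braket ketUp ((g (right p))⁻¹ * hH p * g p) ^ a p *
        braket ketPlus ((g (up Nγ p))⁻¹ * hV p * g p) ^ b p) (fun _ => v)
  rw [spinNetwork, spinNetwork, ← h]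
  simp only [Pi.mul_apply, mul_inv_rev, mul_assoc]

/-- No intertwiner exists at a node where the spins sum to a half-integer: the translation of the
group variable at this node by the central element `-1` changes the sign of the integrand. -/
lemma spinNetwork_eq_zero_of_odd (Nγ : ℤ) (hH hV : Node Nt Nx → SU2) (a b : Node Nt Nx → ℕ)
    (p₀ : Node Nt Nx) (hodd : Odd (twiceNodeSpin Nγ a b p₀)) :
    spinNetwork Nγ hH hV a b = 0 := by
  classical
  let ε : Node Nt Nx → ℂ := fun p => if p = p₀ then -1 else 1
  let σ : Node Nt Nx → SU2 := fun p => if p = p₀ then ⟨-1, SU2.neg_one_mem⟩ else 1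
  have hσ : ∀ p, (σ p).1 = ε p • (1 : Matrix (Fin 2) (Fin 2) ℂ) := by
    intro p
    by_cases hp : p = p₀ <;> simp [σ, ε, hp]
  have hσi : ∀ p, (σ p)⁻¹ = σ p := by
    intro p
    rw [inv_eq_iff_mul_eq_one]
    by_cases hp : p = p₀
    · apply Subtype.ext
      simp [σ, hp]
    · simp [σ, hp]
  have hbr : ∀ ξ q p h (g : Node Nt Nx → SU2), braket ξ ((σ q * g q)⁻¹ * h * (σ p * g p)) =
      (ε q * ε p) * braket ξ ((g q)⁻¹ * h * g p) := by
    intro ξ q p h g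
    have : (((σ q * g q)⁻¹ * h * (σ p * g p) : SU2) : Matrix (Fin 2) (Fin 2) ℂ) =
        (ε q * ε p) • (((g q)⁻¹ * h * g p : SU2) : Matrix (Fin 2) (Fin 2) ℂ) := by
      rw [mul_inv_rev, hσi]
      change ((g q)⁻¹.1 * (σ q).1 * h.1) * ((σ p).1 * (g p).1) = _ • ((g q)⁻¹.1 * h.1 * (g p).1)
      rw [hσ, hσ]
      simp only [Matrix.mul_smul, Matrix.smul_mul, mul_one, one_mul, smul_smul, mul_assoc]
      rw [mul_comm (ε p)]
    rw [braket, braket, this, Matrix.smul_mulVec, dotProduct_smul, smul_eq_mul]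
  have h := integral_mul_left_eq_self (μ := Measure.pi fun _ : Node Nt Nx => haarSU2)
    (fun g : Node Nt Nx → SU2 => ∏ p, braket ketUp ((g (right p))⁻¹ * hH p * g p) ^ a p *
        braket ketPlus ((g (up Nγ p))⁻¹ * hV p * g p) ^ b p) σ
  have h2 : ∀ g : Node Nt Nx → SU2,
      ∏ p, braket ketUp (((σ * g) (right p))⁻¹ * hH p * (σ * g) p) ^ a p *
        braket ketPlus (((σ * g) (up Nγ p))⁻¹ * hV p * (σ * g) p) ^ b p =
      -(∏ p, braket ketUp ((g (right p))⁻¹ * hH p * g p) ^ a p *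
        braket ketPlus ((g (up Nγ p))⁻¹ * hV p * g p) ^ b p) := by
    intro g
    have h3 : ∏ p, ε p ^ twiceNodeSpin Nγ a b p = -1 := by
      rw [Finset.prod_eq_single p₀]
      · simp [ε, hodd.neg_one_pow]
      · intro p _ hp; simp [ε, hp]
      · simp
    simp only [Pi.mul_apply, hbr]
    rw [← neg_one_mul, ← h3, ← prod_link_pow, ← Finset.prod_mul_distrib]
    refine Finset.prod_congr rfl fun p _ => ?_
    rw [mul_pow (ε (right p) * ε p), mul_pow (ε (up Nγ p) * ε p)]
    ring
  simp only [h2] at h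
  rw [integral_neg] at h
  rw [spinNetwork]
  exact self_eq_neg.1 h.symm

/-- The matrix element `⟨ξ| g_q⁻¹ h g_p |ξ⟩` of a link, with the quaternions of two spinors in place
of the rotations `g_q` and `g_p`, and the adjoint in place of the inverse. -/
noncomputable def linkForm (ξ : Fin 2 → ℂ) (h : SU2) (z w : Fin 2 → ℂ) : ℂ :=
  star ξ ⬝ᵥ ((star (spinorMatrix z) * h.1 * spinorMatrix w) *ᵥ ξ)

lemma linkForm_eq (ξ : Fin 2 → ℂ) (h : SU2) (z w : Fin 2 → ℂ) :
    linkForm ξ h z w = ((Real.sqrt (spinorNormSq z) * Real.sqrt (spinorNormSq w) : ℝ) : ℂ) *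
      braket ξ ((spinorToSU2 z)⁻¹ * h * spinorToSU2 w) := by
  have : (((spinorToSU2 z)⁻¹ * h * spinorToSU2 w : SU2) : Matrix (Fin 2) (Fin 2) ℂ) =
      star (spinorToSU2 z).1 * h.1 * (spinorToSU2 w).1 := rfl
  rw [linkForm, braket, this, spinorMatrix_eq_smul z, spinorMatrix_eq_smul w, star_smul]
  simp only [Matrix.mul_smul, Matrix.smul_mul, Matrix.smul_mulVec, dotProduct_smul, smul_smul,
    smul_eq_mul]
  rw [Complex.star_def, Complex.conj_ofReal]
  push_cast
  ring

lemma norm_braket_ketUp_le (g : SU2) : ‖braket ketUp g‖ ≤ 2 := by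
  have h1 := entry_norm_bound_of_unitary (Matrix.mem_specialUnitaryGroup_iff.1 g.2).1 0 0
  have h2 : braket ketUp g = g.1 0 0 := by
    simp [braket, ketUp, dotProduct, Matrix.mulVec, Fin.sum_univ_two]
  rw [h2]
  linarith

lemma norm_braket_ketPlus_le (g : SU2) : ‖braket ketPlus g‖ ≤ 2 := by
  have hb := entry_norm_bound_of_unitary (Matrix.mem_specialUnitaryGroup_iff.1 g.2).1
  have hs : ((Real.sqrt 2 : ℝ) : ℂ) * ((Real.sqrt 2 : ℝ) : ℂ) = 2 := by
    rw [← Complex.ofReal_mul, Real.mul_self_sqrt (by norm_num)]; norm_num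
  have hs0 : ((Real.sqrt 2 : ℝ) : ℂ) ≠ 0 := by
    intro h; rw [h] at hs; simp at hs
  have h2 : braket ketPlus g = (g.1 0 0 + g.1 0 1 + (g.1 1 0 + g.1 1 1)) / 2 := by
    simp [braket, ketPlus, dotProduct, Matrix.mulVec, Fin.sum_univ_two]
    rw [← hs]
    field_simp
  rw [h2, norm_div]
  have h3 := norm_add_le (g.1 0 0 + g.1 0 1) (g.1 1 0 + g.1 1 1)
  have h4 := norm_add_le (g.1 0 0) (g.1 0 1)
  have h5 := norm_add_le (g.1 1 0) (g.1 1 1)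
  have := hb 0 0
  have := hb 0 1
  have := hb 1 0
  have := hb 1 1
  rw [Complex.norm_ofNat]
  linarith

/-- The constant is not optimal; any multiple of the right-hand side gives convergence for small
couplings. -/
lemma norm_linkForm_le {ξ : Fin 2 → ℂ} (hξ : ∀ g, ‖braket ξ g‖ ≤ 2) (h : SU2) (z w : Fin 2 → ℂ) :
    ‖linkForm ξ h z w‖ ≤ spinorNormSq z + spinorNormSq w := by
  have hz := Real.sq_sqrt (spinorNormSq_nonneg z)
  have hw := Real.sq_sqrt (spinorNormSq_nonneg w)
  have hz0 := Real.sqrt_nonneg (spinorNormSq z)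
  have hw0 := Real.sqrt_nonneg (spinorNormSq w)
  rw [linkForm_eq, norm_mul, Complex.norm_real, Real.norm_of_nonneg (mul_nonneg hz0 hw0)]
  have h1 := mul_le_mul_of_nonneg_left (hξ ((spinorToSU2 z)⁻¹ * h * spinorToSU2 w))
    (mul_nonneg hz0 hw0)
  nlinarith [sq_nonneg (Real.sqrt (spinorNormSq z) - Real.sqrt (spinorNormSq w))]

lemma continuous_linkForm {α : Type*} (ξ : Fin 2 → ℂ) (h : SU2) (q p : α) :
    Continuous fun z : α → Fin 2 → ℂ => linkForm ξ h (z q) (z p) := by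
  unfold linkForm
  exact continuous_const.dotProduct
    ((((continuous_spinorMatrix.comp (continuous_apply q)).star.mul continuous_const).mul
      (continuous_spinorMatrix.comp (continuous_apply p))).matrix_mulVec continuous_const)

/-- Each term of the coherent superposition is a Gaussian integral over spinors: the factor
`(J + 1)!` at a node is the radial part of the integral over the spinor at this node. -/
lemma coherentTerm_eq_integral (Nγ : ℤ) (hH hV : Node Nt Nx → SU2) (lam tau : ℂ)
    (c : (Node Nt Nx → ℕ) × (Node Nt Nx → ℕ)) :
    coherentTerm Nγ hH hV lam tau c = ∫ z : Node Nt Nx → Fin 2 → ℂ,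
      ∏ p, ((tau * linkForm ketUp (hH p) (z (right p)) (z p)) ^ c.1 p / ((c.1 p)! : ℂ) *
        ((lam * linkForm ketPlus (hV p) (z (up Nγ p)) (z p)) ^ c.2 p / ((c.2 p)! : ℂ)))
      ∂(Measure.pi fun _ => spinorGaussian) := by
  let F : (Node Nt Nx → SU2) → ℂ := fun g =>
    ∏ p, braket ketUp ((g (right p))⁻¹ * hH p * g p) ^ c.1 p *
      braket ketPlus ((g (up Nγ p))⁻¹ * hV p * g p) ^ c.2 p
  have hF : Measurable F := (continuous_spinNetwork_integrand Nγ hH hV c.1 c.2).measurable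
  have h1 := integral_spinorGaussian_pi (twiceNodeSpin Nγ c.1 c.2) F hF
  have h2 : (∏ p, ((twiceNodeSpin Nγ c.1 c.2 p / 2 + 1)! : ℂ)) * spinNetwork Nγ hH hV c.1 c.2 =
      ((∏ p, spinorMoment (twiceNodeSpin Nγ c.1 c.2 p) : ℝ) : ℂ) *
        spinNetwork Nγ hH hV c.1 c.2 := by
    by_cases hodd : ∃ p, Odd (twiceNodeSpin Nγ c.1 c.2 p)
    · obtain ⟨p, hp⟩ := hodd
      rw [spinNetwork_eq_zero_of_odd Nγ hH hV c.1 c.2 p hp]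
      simp
    · congr 1
      push_cast
      refine Finset.prod_congr rfl fun p _ => ?_
      obtain ⟨J, hJ⟩ := even_iff_exists_two_mul.1 (Nat.not_odd_iff_even.1 (not_exists.1 hodd p))
      rw [hJ, spinorMoment_two_mul, Nat.mul_div_cancel_left _ two_pos]
      push_cast
      rfl
  rw [coherentTerm, Finset.prod_mul_distrib, mul_assoc, h2]
  have h3 : spinNetwork Nγ hH hV c.1 c.2 = ∫ g, F g ∂(Measure.pi fun _ => haarSU2) := rfl
  rw [h3, ← h1, ← integral_const_mul]
  refine integral_congr_ae (Filter.Eventually.of_forall fun z => ?_)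
  simp only
  rw [← prod_link_pow Nγ c.1 c.2 fun p => Real.sqrt (spinorNormSq (z p))]
  push_cast
  rw [← Finset.prod_mul_distrib, ← Finset.prod_mul_distrib]
  refine Finset.prod_congr rfl fun p _ => ?_
  have halg : ∀ (s s' B B' f f' : ℂ) (m n : ℕ),
      lam ^ n * tau ^ m / (f' * f) * (s ^ m * s' ^ n * (B ^ m * B' ^ n)) =
        (tau * (s * B)) ^ m / f * ((lam * (s' * B')) ^ n / f') := by
    intro s s' B B' f f' m n
    simp only [mul_pow, div_eq_mul_inv, mul_inv]
    ring
  rw [linkForm_eq, linkForm_eq, ← halg]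
  push_cast
  rfl

end Nodes

/-! ### The coupling matrix -/

lemma star_dotProduct_linkMatrix_mulVec {α : Type*} [Fintype α] [DecidableEq α]
    (σ : Equiv.Perm α) (c x y : α → ℂ) :
    star x ⬝ᵥ (linkMatrix σ c *ᵥ y) = ∑ p, star (x (σ p)) * c p * y p := by
  simp only [dotProduct, Matrix.mulVec, linkMatrix, Matrix.of_apply, Finset.mul_sum, Pi.star_apply]
  rw [Finset.sum_comm]
  refine Finset.sum_congr rfl fun p _ => ?_
  simp [mul_assoc]

lemma star_dotProduct_linkMatrix_conjTranspose_mulVec {α : Type*} [Fintype α] [DecidableEq α]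
    (σ : Equiv.Perm α) (c x y : α → ℂ) :
    star x ⬝ᵥ ((linkMatrix σ c)ᴴ *ᵥ y) = ∑ p, star (x p) * star (c p) * y (σ p) := by
  rw [linkMatrix_conjTranspose, star_dotProduct_linkMatrix_mulVec,
    ← Equiv.sum_comp σ]
  simp

/-- The rotation `diag(μ, μ⁻¹)` for a phase `μ`, whose inverse is its conjugate. -/
def diagonalSU2 (mu : ℂ) (hmu : mu * star mu = 1) : SU2 :=
  ⟨!![mu, 0; 0, star mu], by
    rw [Matrix.mem_specialUnitaryGroup_iff, Matrix.mem_unitaryGroup_iff]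
    refine ⟨?_, by rw [Matrix.det_fin_two_of, hmu]; ring⟩
    have h2 : star mu * mu = 1 := by rw [mul_comm]; exact hmu
    ext i j
    fin_cases i <;> fin_cases j <;> simp [Matrix.mul_apply, Fin.sum_univ_two, Matrix.star_apply]
    · exact hmu
    · exact h2⟩

lemma linkForm_ketUp_one (z w : Fin 2 → ℂ) :
    linkForm ketUp 1 z w = star (z 0) * w 0 + star (-star (w 1)) * -star (z 1) := by
  simp [linkForm, ketUp, spinorMatrix, dotProduct, Matrix.mulVec, Fin.sum_univ_two,
    Matrix.mul_apply, Matrix.star_apply]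
  ring

lemma linkForm_ketPlus_diagonal {h : SU2} {c : ℂ} (hh : h.1 = !![c, 0; 0, star c])
    (z w : Fin 2 → ℂ) :
    linkForm ketPlus h z w = (1 / 2) *
      (star (z 0 + -star (z 1)) * c * (w 0 + -star (w 1)) +
        star (w 0 - -star (w 1)) * star c * (z 0 - -star (z 1))) := by
  have hs : ((Real.sqrt 2 : ℝ) : ℂ)⁻¹ * ((Real.sqrt 2 : ℝ) : ℂ)⁻¹ = 1 / 2 := by
    rw [← mul_inv, ← Complex.ofReal_mul, Real.mul_self_sqrt (by norm_num)]; norm_num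
  rw [linkForm, hh, ← hs]
  simp [ketPlus, spinorMatrix, dotProduct, Matrix.mulVec, Fin.sum_univ_two,
    Matrix.mul_apply, Matrix.star_apply]
  ring

section Nodes

variable {Nt Nx : ℕ} [NeZero Nt] [NeZero Nx]

/-- The shift along the horizontal links. -/
noncomputable def horizontalShift (Nt Nx : ℕ) [NeZero Nt] [NeZero Nx] :
    Matrix (Node Nt Nx) (Node Nt Nx) ℂ :=
  linkMatrix right fun _ => 1

/-- The shift along the vertical links, with a phase `mu` on the links that close the torus. -/
noncomputable def verticalShift (Nt Nx : ℕ) [NeZero Nt] [NeZero Nx] (Nγ : ℤ) (mu : ℂ) :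
    Matrix (Node Nt Nx) (Node Nt Nx) ℂ :=
  linkMatrix (up Nγ) fun p => if p.1 + 1 = 0 then mu else 1

/-- The sesquilinear form in the row coordinates that is the exponent of the generating function,
when the holonomy along the non-contractible cycle is `diag(mu, mu⁻¹)`. -/
noncomputable def couplingMatrix (Nt Nx : ℕ) [NeZero Nt] [NeZero Nx] (Nγ : ℤ) (mu lam tau : ℂ) :
    Matrix (Node Nt Nx ⊕ Node Nt Nx) (Node Nt Nx ⊕ Node Nt Nx) ℂ :=
  let R := horizontalShift Nt Nx
  let V := verticalShift Nt Nx Nγ mu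
  tau • Matrix.fromBlocks R 0 0 Rᴴ +
    (lam / 2) • Matrix.fromBlocks (V + Vᴴ) (V - Vᴴ) (V - Vᴴ) (V + Vᴴ)

lemma sum_linkForm_eq (Nγ : ℤ) {mu : ℂ} (hmu : mu * star mu = 1) (lam tau : ℂ)
    (z : Node Nt Nx → Fin 2 → ℂ) :
    ∑ p, (tau * linkForm ketUp (horizontalHolonomy p) (z (right p)) (z p) +
        lam * linkForm ketPlus (verticalHolonomy (diagonalSU2 mu hmu) p) (z (up Nγ p)) (z p)) =
      star (rowCoord z) ⬝ᵥ (couplingMatrix Nt Nx Nγ mu lam tau *ᵥ rowCoord z) := by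
  have hv : ∀ p : Node Nt Nx, (verticalHolonomy (diagonalSU2 mu hmu) p).1 =
      !![if p.1 + 1 = 0 then mu else 1, 0; 0, star (if p.1 + 1 = 0 then mu else 1)] := by
    intro p
    rw [verticalHolonomy]
    split_ifs
    · rfl
    · ext i j
      fin_cases i <;> fin_cases j <;> simp
  have hel : rowCoord z ∘ Sum.inl = fun p => z p 0 := rfl
  have her : rowCoord z ∘ Sum.inr = fun p => -star (z p 1) := rfl
  have hstar : ∀ x y : Node Nt Nx → ℂ, star (rowCoord z) ⬝ᵥ Sum.elim x y =
      star (fun p => z p 0) ⬝ᵥ x + star (fun p => -star (z p 1)) ⬝ᵥ y := by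
    intro x y
    simp only [dotProduct, Fintype.sum_sum_type, Pi.star_apply, rowCoord, Sum.elim_inl,
      Sum.elim_inr]
  simp only [couplingMatrix, Matrix.add_mulVec, Matrix.smul_mulVec, Matrix.fromBlocks_mulVec, hel,
    her, dotProduct_add, dotProduct_smul, hstar, Matrix.sub_mulVec, dotProduct_sub,
    horizontalShift, verticalShift, Matrix.zero_mulVec, add_zero, zero_add,
    star_dotProduct_linkMatrix_mulVec, star_dotProduct_linkMatrix_conjTranspose_mulVec,
    smul_eq_mul, ← Finset.sum_add_distrib, ← Finset.sum_sub_distrib, Finset.mul_sum]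
  refine Finset.sum_congr rfl fun p _ => ?_
  rw [horizontalHolonomy, linkForm_ketUp_one, linkForm_ketPlus_diagonal (hv p)]
  simp only [star_add, star_sub, star_neg, star_star, star_one]
  ring

lemma norm_sum_linkForm_le (Nγ : ℤ) (hH hV : Node Nt Nx → SU2) (lam tau : ℂ)
    (z : Node Nt Nx → Fin 2 → ℂ) :
    ∑ p, (‖tau * linkForm ketUp (hH p) (z (right p)) (z p)‖ +
        ‖lam * linkForm ketPlus (hV p) (z (up Nγ p)) (z p)‖) ≤
      2 * (‖lam‖ + ‖tau‖) * ∑ p, spinorNormSq (z p) := by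
  have h1 : ∀ p, ‖tau * linkForm ketUp (hH p) (z (right p)) (z p)‖ +
        ‖lam * linkForm ketPlus (hV p) (z (up Nγ p)) (z p)‖ ≤
      ‖tau‖ * (spinorNormSq (z (right p)) + spinorNormSq (z p)) +
        ‖lam‖ * (spinorNormSq (z (up Nγ p)) + spinorNormSq (z p)) := by
    intro p
    rw [norm_mul, norm_mul]
    gcongr
    · exact norm_linkForm_le norm_braket_ketUp_le _ _ _
    · exact norm_linkForm_le norm_braket_ketPlus_le _ _ _
  refine (Finset.sum_le_sum fun p _ => h1 p).trans (le_of_eq ?_)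
  rw [Finset.sum_add_distrib, ← Finset.mul_sum, ← Finset.mul_sum, Finset.sum_add_distrib,
    Finset.sum_add_distrib, Equiv.sum_comp right fun p => spinorNormSq (z p),
    Equiv.sum_comp (up Nγ) fun p => spinorNormSq (z p)]
  ring

/-- For small couplings the spin series is the power series expansion, under the Gaussian integral
over spinors, of the exponential of the coupling form. -/
lemma hasSum_coherentTerm_diagonal (Nγ : ℤ) {mu : ℂ} (hmu : mu * star mu = 1) {lam tau : ℂ}
    (hsmall : ‖lam‖ + ‖tau‖ < 1 / 2) :
    (1 - couplingMatrix Nt Nx Nγ mu lam tau).det ≠ 0 ∧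
    HasSum (coherentTerm (Nt := Nt) (Nx := Nx) Nγ horizontalHolonomy
      (verticalHolonomy (diagonalSU2 mu hmu)) lam tau)
      ((1 - couplingMatrix Nt Nx Nγ mu lam tau).det)⁻¹ := by
  set hH : Node Nt Nx → SU2 := horizontalHolonomy
  set hV : Node Nt Nx → SU2 := verticalHolonomy (diagonalSU2 mu hmu)
  let X : (Node Nt Nx → Fin 2 → ℂ) → Node Nt Nx → ℂ :=
    fun z p => lam * linkForm ketPlus (hV p) (z (up Nγ p)) (z p)
  let Y : (Node Nt Nx → Fin 2 → ℂ) → Node Nt Nx → ℂ :=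
    fun z p => tau * linkForm ketUp (hH p) (z (right p)) (z p)
  have hXc : ∀ p, Continuous fun z => X z p := fun p =>
    continuous_const.mul (continuous_linkForm _ _ _ _)
  have hYc : ∀ p, Continuous fun z => Y z p := fun p =>
    continuous_const.mul (continuous_linkForm _ _ _ _)
  set c := 2 * (‖lam‖ + ‖tau‖) with hc
  have hc1 : c < 1 := by linarith
  have hbound : ∀ z, ∑ p, (‖Y z p‖ + ‖X z p‖) ≤ c * ∑ p, spinorNormSq (z p) :=
    norm_sum_linkForm_le Nγ hH hV lam tau
  have hexp : ∀ z, ∑ p, (Y z p + X z p) =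
      star (rowCoord z) ⬝ᵥ (couplingMatrix Nt Nx Nγ mu lam tau *ᵥ rowCoord z) :=
    sum_linkForm_eq Nγ hmu lam tau
  obtain ⟨hdet, hint⟩ := integral_cexp_rowCoord (couplingMatrix Nt Nx Nγ mu lam tau) hc1 (by
    intro z
    rw [← hexp]
    refine (norm_sum_le _ _).trans (le_trans ?_ (hbound z))
    exact Finset.sum_le_sum fun p _ => norm_add_le _ _)
  refine ⟨hdet, ?_⟩
  have hterm : coherentTerm Nγ hH hV lam tau = fun d => ∫ z, ∏ p,
      (Y z p ^ d.1 p / ((d.1 p)! : ℂ) * (X z p ^ d.2 p / ((d.2 p)! : ℂ)))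
      ∂(Measure.pi fun _ => spinorGaussian) :=
    funext fun d => coherentTerm_eq_integral Nγ hH hV lam tau d
  rw [hterm, ← hint]
  refine hasSum_integral_of_dominated_convergence
    (fun d z => ∏ p, (‖Y z p‖ ^ d.1 p / ((d.1 p)! : ℝ) * (‖X z p‖ ^ d.2 p / ((d.2 p)! : ℝ))))
    ?_ ?_ ?_ ?_ ?_
  · intro d
    refine Continuous.aestronglyMeasurable (continuous_finsetProd _ fun p _ => ?_)
    exact (((hYc p).pow _).div_const _).mul (((hXc p).pow _).div_const _)
  · intro d
    refine Filter.Eventually.of_forall fun z => le_of_eq ?_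
    simp [norm_prod]
  · exact Filter.Eventually.of_forall fun z =>
      (hasSum_pair_real_exp (fun p => ‖X z p‖) (fun p => ‖Y z p‖)).summable
  · have h1 : ∀ z, ∑' d : (Node Nt Nx → ℕ) × (Node Nt Nx → ℕ),
        ∏ p, (‖Y z p‖ ^ d.1 p / ((d.1 p)! : ℝ) * (‖X z p‖ ^ d.2 p / ((d.2 p)! : ℝ))) =
        Real.exp (∑ p, (‖Y z p‖ + ‖X z p‖)) := fun z =>
      (hasSum_pair_real_exp (fun p => ‖X z p‖) (fun p => ‖Y z p‖)).tsum_eq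
    simp only [h1]
    have h2 : Integrable (fun z : Node Nt Nx → Fin 2 → ℂ => ∏ p, Real.exp (c * spinorNormSq (z p)))
        (Measure.pi fun _ => spinorGaussian) := by
      refine Integrable.fintype_prod (f := fun _ w => Real.exp (c * spinorNormSq w)) fun _ => ?_
      have h3 := integrable_exp_neg_mul_normSq (c := 1 - c) (by linarith)
      refine integrable_spinorGaussian ((integrable_spinor_prod h3 h3).congr ?_)
      refine Filter.Eventually.of_forall fun w => ?_
      simp only [spinorNormSq]
      rw [← Real.exp_add, ← Real.exp_add]
      congr 1
      ring
    refine h2.mono' ?_ (Filter.Eventually.of_forall fun z => ?_)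
    · refine Continuous.aestronglyMeasurable ?_
      exact Real.continuous_exp.comp
        (continuous_finsetSum _ fun p _ => (hYc p).norm.add (hXc p).norm)
    · rw [Real.norm_of_nonneg (Real.exp_pos _).le, ← Real.exp_sum, ← Finset.mul_sum]
      exact Real.exp_le_exp.2 (hbound z)
  · refine Filter.Eventually.of_forall fun z => ?_
    rw [← hexp]
    exact hasSum_pair_exp (X z) (Y z)

end Nodes

/-! ### Diagonalization of the holonomy -/

lemma spinorMatrix_smul (mu : ℂ) (z : Fin 2 → ℂ) :
    spinorMatrix (mu • z) = spinorMatrix z * !![mu, 0; 0, star mu] := by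
  ext i j
  fin_cases i <;> fin_cases j <;>
    simp [spinorMatrix, Matrix.mul_apply, Fin.sum_univ_two, mul_comm]

/-- A unit eigenvector of `H` is the first column of a rotation that diagonalizes `H`. -/
lemma exists_conj_eq_diagonalSU2 (H : SU2) : ∃ (v : SU2) (mu : ℂ) (hmu : mu * star mu = 1),
    v⁻¹ * H * v = diagonalSU2 mu hmu := by
  obtain ⟨mu, hev⟩ := Module.End.exists_eigenvalue (Matrix.toLin' H.1)
  obtain ⟨z, hz⟩ := hev.exists_hasEigenvector
  have hHz : H.1 *ᵥ z = mu • z := by simpa using hz.apply_eq_smul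
  have hz0 : z ≠ 0 := hz.2
  have hpos := spinorNormSq_pos hz0
  have hmu : mu * star mu = 1 := by
    have h1 := spinorNormSq_mulVec H z
    rw [hHz] at h1
    have h2 : spinorNormSq (mu • z) = Complex.normSq mu * spinorNormSq z := by
      simp [spinorNormSq, mul_add]
    rw [h2] at h1
    have h3 : Complex.normSq mu = 1 := by
      exact mul_right_cancel₀ hpos.ne' (by rw [h1, one_mul])
    rw [Complex.star_def, Complex.mul_conj, h3, Complex.ofReal_one]
  refine ⟨spinorToSU2 z, mu, hmu, ?_⟩
  rw [mul_assoc, inv_mul_eq_iff_eq_mul]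
  apply Subtype.ext
  change H.1 * (spinorToSU2 z).1 = (spinorToSU2 z).1 * !![mu, 0; 0, star mu]
  rw [spinorToSU2_coe hz0, Matrix.mul_smul, Matrix.smul_mul, ← spinorMatrix_mulVec, hHz,
    spinorMatrix_smul]

lemma trace_eq_two_mul_halfTrace (g : SU2) : g.1.trace = 2 * (halfTrace g : ℂ) := by
  rw [Matrix.trace_fin_two, (SU2.apply_one_one g).1, halfTrace, Complex.star_def, Complex.add_conj]
  push_cast
  rfl

lemma halfTrace_conj (v g : SU2) : halfTrace (v⁻¹ * g * v) = halfTrace g := by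
  have h : (v⁻¹ * g * v).1.trace = g.1.trace := by
    change ((v⁻¹).1 * g.1 * v.1).trace = _
    rw [Matrix.trace_mul_cycle]
    change ((v * v⁻¹).1 * g.1).trace = _
    rw [mul_inv_cancel]
    exact congrArg _ (one_mul _)
  rw [trace_eq_two_mul_halfTrace, trace_eq_two_mul_halfTrace] at h
  exact_mod_cast mul_left_cancel₀ two_ne_zero h

/-- In the phases of a rotation, Chebyshev polynomials of half its trace are averages of powers. -/
lemma pow_add_inv_pow_eq_chebyshev {mu : ℂ} (hmu : mu * star mu = 1) (n : ℕ) :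
    mu ^ n + (mu ^ n)⁻¹ =
      2 * (((Polynomial.Chebyshev.T ℝ n).eval (halfTrace (diagonalSU2 mu hmu)) : ℝ) : ℂ) := by
  have hnorm : ‖mu‖ = 1 := by
    have h : Complex.normSq mu = 1 := by
      rw [Complex.star_def, Complex.mul_conj] at hmu
      exact_mod_cast hmu
    rw [Complex.normSq_eq_norm_sq] at h
    nlinarith [norm_nonneg mu]
  obtain ⟨θ, rfl⟩ : ∃ θ : ℝ, Complex.exp (θ * Complex.I) = mu :=
    ⟨mu.arg, by
      have := Complex.norm_mul_exp_arg_mul_I mu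
      rwa [hnorm, Complex.ofReal_one, one_mul] at this⟩
  have h1 : halfTrace (diagonalSU2 _ hmu) = Real.cos θ := by
    change (Complex.exp (θ * Complex.I)).re = _
    exact Complex.exp_ofReal_mul_I_re θ
  rw [h1, Polynomial.Chebyshev.T_real_cos, ← Complex.exp_nat_mul, ← Complex.exp_neg]
  push_cast
  rw [Complex.two_cos]
  congr 2 <;> ring

section Nodes

variable {Nt Nx : ℕ} [NeZero Nt] [NeZero Nx]

lemma coherentTerm_conj (Nγ : ℤ) (H v : SU2) (lam tau : ℂ) :
    coherentTerm (Nt := Nt) (Nx := Nx) Nγ horizontalHolonomy (verticalHolonomy (v⁻¹ * H * v))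
      lam tau = coherentTerm Nγ horizontalHolonomy (verticalHolonomy H) lam tau := by
  have h1 : (horizontalHolonomy : Node Nt Nx → SU2) =
      fun p => v⁻¹ * horizontalHolonomy p * v := by
    ext1 p
    simp [horizontalHolonomy]
  have h2 : (verticalHolonomy (v⁻¹ * H * v) : Node Nt Nx → SU2) =
      fun p => v⁻¹ * verticalHolonomy H p * v := by
    ext1 p
    simp only [verticalHolonomy]
    split_ifs <;> simp
  ext c
  rw [coherentTerm, coherentTerm, h2]
  conv_lhs => rw [h1]
  rw [spinNetwork_conj]

/-! ### The determinant at critical couplings -/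

lemma commute_of_inverse {R : Type*} [Monoid R] {a b c : R} (h : Commute a b) (hac : a * c = 1)
    (hca : c * a = 1) : Commute c b := by
  change c * b = b * c
  calc c * b = c * (b * a) * c := by rw [mul_assoc, mul_assoc, hac, mul_one]
    _ = b * c := by rw [← h.eq, ← mul_assoc, hca, one_mul]

lemma commute_horizontalShift_verticalShift (Nγ : ℤ) (mu : ℂ) :
    Commute (horizontalShift Nt Nx) (verticalShift Nt Nx Nγ mu) := by
  change _ * _ = _ * _
  rw [horizontalShift, verticalShift, linkMatrix_mul, linkMatrix_mul]
  have h : (right : Node Nt Nx ≃ Node Nt Nx).trans (up Nγ) = (up Nγ).trans right := by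
    ext1 p
    simp only [Equiv.trans_apply, right, up, Equiv.coe_fn_mk]
    split_ifs <;> simp [add_right_comm]
  rw [h]
  congr 1
  ext p
  simp only [right, Equiv.coe_fn_mk, one_mul, mul_one]
  rfl

/-- On the critical locus `lam ^ 2 + tau ^ 2 = 1`, the determinant of the coupled system splits into
the determinants of two scalar problems, one for each direction of the lattice. -/
lemma det_one_sub_couplingMatrix (Nγ : ℤ) {mu : ℂ} (hmu : mu * star mu = 1) {lam tau : ℂ}
    (hcrit : lam ^ 2 + tau ^ 2 = 1) :
    (1 - couplingMatrix Nt Nx Nγ mu lam tau).det = 2 ^ (Nt * Nx) *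
      ((1 - (tau / 2) • (horizontalShift Nt Nx + (horizontalShift Nt Nx)ᴴ)).det *
        (1 - (lam / 2) • (verticalShift Nt Nx Nγ mu + (verticalShift Nt Nx Nγ mu)ᴴ)).det) := by
  set R := horizontalShift Nt Nx with hR
  set V := verticalShift Nt Nx Nγ mu with hV
  have hRR : R * Rᴴ = 1 := linkMatrix_mul_conjTranspose _ _ fun p => by simp
  have hVV : V * Vᴴ = 1 := linkMatrix_mul_conjTranspose _ _ fun p => by
    split_ifs
    · exact hmu
    · simp
  have hRR' : Rᴴ * R = 1 := mul_eq_one_comm.1 hRR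
  have hVV' : Vᴴ * V = 1 := mul_eq_one_comm.1 hVV
  have hc : Commute R V := commute_horizontalShift_verticalShift Nγ mu
  have hc1 : Commute Rᴴ V := commute_of_inverse hc hRR hRR'
  have hc2 : Commute Vᴴ R := commute_of_inverse hc.symm hVV hVV'
  have hc3 : Commute Vᴴ Rᴴ := commute_of_inverse hc1.symm hVV hVV'
  -- The lower blocks commute, so that the determinant is the one of a matrix on the lattice.
  have hblocks : 1 - couplingMatrix Nt Nx Nγ mu lam tau = Matrix.fromBlocks
      (1 - tau • R - (lam / 2) • (V + Vᴴ)) (-((lam / 2) • (V - Vᴴ)))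
      (-((lam / 2) • (V - Vᴴ))) (1 - tau • Rᴴ - (lam / 2) • (V + Vᴴ)) := by
    rw [couplingMatrix, ← Matrix.fromBlocks_one, Matrix.fromBlocks_smul, Matrix.fromBlocks_smul,
      Matrix.fromBlocks_add, sub_eq_add_neg, Matrix.fromBlocks_neg, Matrix.fromBlocks_add]
    congr 1
    · rw [neg_add, ← add_assoc]; rfl
    · rw [smul_zero, zero_add, zero_add]
    · rw [smul_zero, zero_add, zero_add]
    · rw [neg_add, ← add_assoc]; rfl
  have hcomm : Commute (-((lam / 2) • (V - Vᴴ))) (1 - tau • Rᴴ - (lam / 2) • (V + Vᴴ)) := by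
    have e1 : Commute (V - Vᴴ) Rᴴ := hc1.symm.sub_left hc3
    have e2 : Commute V Vᴴ := by change _ * _ = _ * _; rw [hVV, hVV']
    have e3 : Commute (V - Vᴴ) (V + Vᴴ) :=
      ((Commute.refl V).add_right e2).sub_left (e2.symm.add_right (Commute.refl _))
    exact (((((Commute.one_right _).sub_right (e1.smul_right tau)).sub_right
      (e3.smul_right (lam / 2))).smul_left (lam / 2)).neg_left)
  rw [hblocks, det_fromBlocks_of_commute _ _ _ _ hcomm]
  -- The terms quadratic in `V` add up to `lam ^ 2`, those quadratic in `R` to `tau ^ 2`; together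
  -- with the unit they make the constant `2` that allows the factorization.
  have hprod : (1 - tau • R - (lam / 2) • (V + Vᴴ)) * (1 - tau • Rᴴ - (lam / 2) • (V + Vᴴ)) -
      -((lam / 2) • (V - Vᴴ)) * -((lam / 2) • (V - Vᴴ)) =
      (2 : ℂ) • ((1 - (tau / 2) • (R + Rᴴ)) * (1 - (lam / 2) • (V + Vᴴ))) := by
    simp only [sub_mul, mul_sub, add_mul, mul_add, one_mul, mul_one, Matrix.smul_mul,
      Matrix.mul_smul, smul_sub, smul_add, neg_mul, mul_neg, hRR, hVV, hVV', ← hc1.eq, hc3.eq]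
    match_scalars <;> first | ring1 | linear_combination hcrit
  rw [hprod, Matrix.det_smul, Matrix.det_mul, card_node]

/-- The determinant whose reciprocal is the boundary state, as a function of the holonomy. -/
lemma det_one_sub_couplingMatrix_eq (Nγ : ℤ) (K nx : ℕ) (hK : K = Int.gcd Nγ (Nx : ℤ))
    (hNx : Nx = K * nx) {mu : ℂ} (hmu : mu * star mu = 1) {lam tau : ℂ}
    (hcrit : lam ^ 2 + tau ^ 2 = 1) (hlam0 : lam ≠ 0) (htau0 : tau ≠ 0) {Xlam Xtau : ℂ}
    (hXlam : Complex.cosh Xlam = lam⁻¹) (hXtau : Complex.cosh Xtau = tau⁻¹) :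
    (1 - couplingMatrix Nt Nx Nγ mu lam tau).det =
      (lam * tau) ^ (Nt * Nx) / 2 ^ (Nt * Nx) * 2 ^ (2 * Nt) * 2 ^ K *
        Complex.sinh ((1 / 2 : ℂ) * (Nx : ℂ) * Xtau) ^ (2 * Nt) *
        (Complex.cosh ((nx : ℂ) * (Nt : ℂ) * Xlam) -
          (((Polynomial.Chebyshev.T ℝ nx).eval (halfTrace (diagonalSU2 mu hmu)) : ℝ) : ℂ)) ^ K := by
  have hmu0 : mu ≠ 0 := left_ne_zero_of_mul (hmu.trans_ne one_ne_zero)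
  have hnx0 : nx ≠ 0 := by
    rintro rfl
    exact NeZero.ne Nx (by simpa using hNx)
  rw [det_one_sub_couplingMatrix Nγ hmu hcrit]
  unfold horizontalShift verticalShift
  rw [det_one_sub_half_add_inv _ _ (linkMatrix_mul_conjTranspose _ _ fun p => by simp)
      (NeZero.ne Nx) one_ne_zero htau0 hXtau
      (fun z => det_sub_linkMatrix_right (Nt := Nt) (Nx := Nx) z),
    det_one_sub_half_add_inv _ _ (linkMatrix_mul_conjTranspose _ _ fun p => by
        split_ifs
        · exact hmu
        · simp)
      (mul_ne_zero (NeZero.ne Nt) hnx0) (pow_ne_zero nx hmu0) hlam0 hXlam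
      (fun z => det_sub_linkMatrix_up_holonomy hK hNx hmu0 z), card_node]
  have h1 : 2 * Complex.cosh ((Nx : ℂ) * Xtau) - 1 - 1⁻¹ =
      2 ^ 2 * Complex.sinh ((1 / 2 : ℂ) * (Nx : ℂ) * Xtau) ^ 2 := by
    have h := Complex.cosh_two_mul ((1 / 2 : ℂ) * (Nx : ℂ) * Xtau)
    rw [show 2 * ((1 / 2 : ℂ) * (Nx : ℂ) * Xtau) = (Nx : ℂ) * Xtau by ring, Complex.cosh_sq] at h
    rw [h]
    ring
  have h2 : 2 * Complex.cosh (((Nt * nx : ℕ) : ℂ) * Xlam) - mu ^ nx - (mu ^ nx)⁻¹ =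
      2 * (Complex.cosh ((nx : ℂ) * (Nt : ℂ) * Xlam) -
        (((Polynomial.Chebyshev.T ℝ nx).eval (halfTrace (diagonalSU2 mu hmu)) : ℝ) : ℂ)) := by
    rw [sub_sub, pow_add_inv_pow_eq_chebyshev hmu, ← mul_sub]
    push_cast
    rw [mul_comm (Nt : ℂ)]
  rw [h1, h2, mul_pow, mul_pow, div_pow, div_pow, mul_pow, ← pow_mul, ← pow_mul]
  have h3 : (2 : ℂ) ^ (Nt * Nx) ≠ 0 := pow_ne_zero _ two_ne_zero
  field_simp

end Nodes

section Nodes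

variable {Nt Nx : ℕ} [NeZero Nt] [NeZero Nx]

/-! ### Analytic continuation in the couplings -/

lemma couplingMatrix_smul (Nγ : ℤ) (mu t lam tau : ℂ) :
    couplingMatrix Nt Nx Nγ mu (t * lam) (t * tau) = t • couplingMatrix Nt Nx Nγ mu lam tau := by
  simp only [couplingMatrix, smul_add, smul_smul, mul_div_assoc]

lemma analyticOnNhd_det_one_sub_couplingMatrix (Nγ : ℤ) (mu : ℂ) (s : Set (ℂ × ℂ)) :
    AnalyticOnNhd ℂ (fun q : ℂ × ℂ => (1 - couplingMatrix Nt Nx Nγ mu q.1 q.2).det) s := by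
  intro q _
  simp only [Matrix.det_apply]
  refine Finset.analyticAt_fun_sum _ fun σ _ => ?_
  refine AnalyticAt.const_smul ?_
  refine Finset.analyticAt_fun_prod _ fun i _ => ?_
  simp only [couplingMatrix, Matrix.sub_apply, Matrix.add_apply, Matrix.smul_apply, smul_eq_mul]
  exact analyticAt_const.sub ((analyticAt_snd.mul analyticAt_const).add
    ((analyticAt_fst.div_const).mul analyticAt_const))

/-- Along a complex line through the origin, the determinant is a polynomial with constant term `1`,
so that it vanishes at finitely many points only. -/
lemma finite_setOf_det_one_sub_smul_eq_zero {κ : Type*} [Fintype κ] [DecidableEq κ]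
    (M : Matrix κ κ ℂ) : {t : ℂ | (1 - t • M).det = 0}.Finite := by
  have h : ∀ t : ℂ, (M.charpolyRev).eval t = (1 - t • M).det := by
    intro t
    rw [Matrix.charpolyRev, ← Polynomial.coe_evalRingHom, RingHom.map_det]
    congr 1
    ext i j
    by_cases hij : i = j <;> simp [hij] <;> ring
  have hne : M.charpolyRev ≠ 0 := by
    intro h0
    have := Matrix.eval_charpolyRev (M := M)
    rw [h0] at this
    simp at this
  refine (Polynomial.finite_setOfPred_isRoot hne).subset fun t ht => ?_
  exact (h t).trans ht

lemma eventually_hasSum_coherentTerm (Nγ : ℤ) {H v : SU2} {mu : ℂ} {hmu : mu * star mu = 1}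
    (hv : v⁻¹ * H * v = diagonalSU2 mu hmu) :
    ∀ᶠ q in 𝓝 (0 : ℂ × ℂ), (1 - couplingMatrix Nt Nx Nγ mu q.1 q.2).det ≠ 0 ∧
      HasSum (coherentTerm (Nt := Nt) (Nx := Nx) Nγ horizontalHolonomy (verticalHolonomy H) q.1 q.2)
        ((1 - couplingMatrix Nt Nx Nγ mu q.1 q.2).det)⁻¹ := by
  have h1 : ∀ᶠ q in 𝓝 (0 : ℂ × ℂ), ‖q.1‖ + ‖q.2‖ < 1 / 2 := by
    have hc : Continuous fun q : ℂ × ℂ => ‖q.1‖ + ‖q.2‖ := by fun_prop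
    exact hc.continuousAt.eventually (gt_mem_nhds (by norm_num))
  filter_upwards [h1] with q hq
  have h2 := hasSum_coherentTerm_diagonal (Nt := Nt) (Nx := Nx) Nγ hmu hq
  rwa [← hv, coherentTerm_conj] at h2

/-- The boundary state is the reciprocal of the determinant wherever the latter does not vanish: the
product of the two is `1` near the origin, hence on every connected open set of couplings. -/
lemma isBoundaryStateValue_iff (Nγ : ℤ) {H v : SU2} {mu : ℂ} {hmu : mu * star mu = 1}
    (hv : v⁻¹ * H * v = diagonalSU2 mu hmu) {lam tau : ℂ}
    (hdet : (1 - couplingMatrix Nt Nx Nγ mu lam tau).det ≠ 0) (w : ℂ) :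
    IsBoundaryStateValue (Nt := Nt) (Nx := Nx) Nγ horizontalHolonomy (verticalHolonomy H)
        lam tau w ↔
      w = ((1 - couplingMatrix Nt Nx Nγ mu lam tau).det)⁻¹ := by
  have hser := eventually_hasSum_coherentTerm (Nt := Nt) (Nx := Nx) Nγ hv
  set P : ℂ × ℂ → ℂ := fun q => (1 - couplingMatrix Nt Nx Nγ mu q.1 q.2).det with hP
  have hPan : ∀ s, AnalyticOnNhd ℂ P s := analyticOnNhd_det_one_sub_couplingMatrix Nγ mu
  constructor
  · rintro ⟨U, F, hUo, hUc, h0, hq, hF, hsum, rfl⟩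
    have h1 : Set.EqOn (F * P) (fun _ => 1) U := by
      refine (hF.mul (hPan U)).eqOn_of_preconnected_of_eventuallyEq analyticOnNhd_const hUc h0 ?_
      filter_upwards [hser, hsum] with q h2 h3
      change F q * P q = 1
      rw [h3.unique h2.2]
      exact inv_mul_cancel₀ h2.1
    exact eq_inv_of_mul_eq_one_left (h1 hq)
  · rintro rfl
    have hopen : IsOpen {q | P q ≠ 0} := by
      have : Continuous P := continuous_iff_continuousAt.2 fun q =>
        (hPan Set.univ q (Set.mem_univ q)).continuousAt
      exact isOpen_ne_fun this continuous_const
    have hline : ∀ t : ℂ, P (t * lam, t * tau) =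
        (1 - t • couplingMatrix Nt Nx Nγ mu lam tau).det := fun t => by
      simp only [hP, couplingMatrix_smul]
    have h0 : (0 : ℂ × ℂ) ∈ {q | P q ≠ 0} := by
      have := hline 0
      simp only [zero_mul, zero_smul, sub_zero, Matrix.det_one] at this
      change P (0, 0) ≠ 0
      rw [this]
      exact one_ne_zero
    -- The continuation lives on the component of the origin in the set of couplings where the
    -- determinant does not vanish; this component contains the complex line through `(lam, tau)`
    -- without finitely many points.
    refine ⟨connectedComponentIn {q | P q ≠ 0} 0, fun q => (P q)⁻¹, hopen.connectedComponentIn,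
      isPreconnected_connectedComponentIn, mem_connectedComponentIn h0, ?_, ?_, ?_, rfl⟩
    · have hpre : IsPreconnected {t : ℂ | (1 - t • couplingMatrix Nt Nx Nγ mu lam tau).det = 0}ᶜ :=
        ((finite_setOf_det_one_sub_smul_eq_zero _).countable.isPathConnected_compl_of_one_lt_rank
          (by rw [Complex.rank_real_complex]; exact Nat.one_lt_ofNat)).isConnected.isPreconnected
      have himg := hpre.image (fun t : ℂ => ((t * lam, t * tau) : ℂ × ℂ))
        (Continuous.continuousOn (by fun_prop))
      refine himg.subset_connectedComponentIn ?_ ?_ ?_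
      · refine ⟨0, ?_, by simp⟩
        simp
      · rintro _ ⟨t, ht, rfl⟩
        change P _ ≠ 0
        rw [hline]
        exact ht
      · refine ⟨1, ?_, by simp⟩
        simpa using hdet
    · exact (hPan _).inv fun q hq => connectedComponentIn_subset _ _ hq
    · exact hser.mono fun q hq => hq.2

/-! ### The boundary state at critical couplings and its Haar average -/

lemma sinh_ne_zero_of_re_pos {a : ℂ} (ha : 0 < a.re) : Complex.sinh a ≠ 0 := by
  intro h
  have h1 : Complex.exp a = Complex.exp (-a) := by
    rw [Complex.sinh, div_eq_zero_iff] at h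
    exact sub_eq_zero.1 (h.resolve_right two_ne_zero)
  have h2 := congrArg (fun w => ‖w‖) h1
  simp only [Complex.norm_exp, Complex.neg_re, Real.exp_eq_exp] at h2
  linarith

lemma cosh_sub_cos_ne_zero {a : ℂ} (ha : 0 < a.re) (θ : ℝ) :
    Complex.cosh a - Complex.cos θ ≠ 0 := by
  have h : Complex.cosh a - Complex.cos θ =
      2 * Complex.sinh ((a + θ * Complex.I) / 2) * Complex.sinh ((a - θ * Complex.I) / 2) := by
    have h1 := Complex.cosh_add ((a + θ * Complex.I) / 2) ((a - θ * Complex.I) / 2)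
    have h2 := Complex.cosh_sub ((a + θ * Complex.I) / 2) ((a - θ * Complex.I) / 2)
    rw [← Complex.cosh_mul_I]
    rw [show (a + θ * Complex.I) / 2 + (a - θ * Complex.I) / 2 = a by ring] at h1
    rw [show (a + θ * Complex.I) / 2 - (a - θ * Complex.I) / 2 = θ * Complex.I by ring] at h2
    rw [h1, h2]
    ring
  rw [h]
  refine mul_ne_zero (mul_ne_zero two_ne_zero (sinh_ne_zero_of_re_pos ?_))
    (sinh_ne_zero_of_re_pos ?_) <;> simp <;> linarith

lemma cosh_sub_ofReal_ne_zero {a : ℂ} (ha : 0 < a.re) {x : ℝ} (hx : x ∈ Set.Icc (-1 : ℝ) 1) :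
    Complex.cosh a - (x : ℂ) ≠ 0 := by
  have h := cosh_sub_cos_ne_zero ha (Real.arccos x)
  rwa [← Complex.ofReal_cos, Real.cos_arccos hx.1 hx.2] at h

/-- An inverse hyperbolic cosine on the imaginary axis is `i` times an angle `θ` with
`lam * cos θ = 1`. -/
lemma IsArcosh.re_pos {X lam : ℂ} (hX : IsArcosh X lam⁻¹)
    (hlam0 : lam ≠ 0) (hlam : ∀ θ : ℝ, lam * Complex.cos (θ : ℂ) ≠ 1) : 0 < X.re := by
  refine lt_of_le_of_ne hX.2 fun h => hlam X.im ?_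
  have hXI : X = X.im * Complex.I := by
    conv_lhs => rw [← Complex.re_add_im X, ← h]
    simp
  rw [← Complex.cosh_mul_I, ← hXI, hX.1, mul_inv_cancel₀ hlam0]

/-- At a zero of `sinh`, a multiple of `iπ`, the number `X` would be `i` times the angle
`2π k / n` of a Fourier mode. -/
lemma IsArcosh.sinh_half_mul_ne_zero {n : ℕ} (hn : n ≠ 0) {X tau : ℂ} (hX : IsArcosh X tau⁻¹)
    (htau0 : tau ≠ 0)
    (htau : ∀ k : ℕ, tau * Complex.cos (2 * (Real.pi : ℂ) * (k : ℂ) / (n : ℂ)) ≠ 1) :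
    Complex.sinh ((1 / 2 : ℂ) * (n : ℂ) * X) ≠ 0 := by
  intro h
  have hn' : (n : ℂ) ≠ 0 := Nat.cast_ne_zero.2 hn
  have h1 : Complex.sin ((1 / 2 : ℂ) * (n : ℂ) * X * Complex.I) = 0 := by
    rw [Complex.sin_mul_I, h, zero_mul]
  obtain ⟨k, hk⟩ := Complex.sin_eq_zero_iff.1 h1
  have h2 : X * Complex.I = 2 * (Real.pi : ℂ) * (k : ℂ) / (n : ℂ) := by
    rw [eq_div_iff hn']
    linear_combination 2 * hk
  have h3 : Complex.cos (2 * (Real.pi : ℂ) * (k : ℂ) / (n : ℂ)) = tau⁻¹ := by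
    rw [← h2, Complex.cos_mul_I, hX.1]
  obtain ⟨m, rfl | rfl⟩ := k.eq_nat_or_neg
  · refine htau m ?_
    rw [Int.cast_natCast] at h3
    rw [h3, mul_inv_cancel₀ htau0]
  · refine htau m ?_
    rw [Int.cast_neg, Int.cast_natCast, mul_neg, neg_div, Complex.cos_neg] at h3
    rw [h3, mul_inv_cancel₀ htau0]

/-- At critical couplings, the continuation of the coherent spin network series exists, is unique
and depends on the holonomy through a Chebyshev polynomial of half its trace. -/
lemma isBoundaryStateValue_critical_iff (Nγ : ℤ) (K nx : ℕ)
    (hK : K = Int.gcd Nγ (Nx : ℤ)) (hNx : Nx = K * nx) {lam tau : ℂ}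
    (hcrit : lam ^ 2 + tau ^ 2 = 1) (hlam0 : lam ≠ 0) (htau0 : tau ≠ 0)
    (hlam : ∀ θ : ℝ, lam * Complex.cos (θ : ℂ) ≠ 1)
    (htau : ∀ k : ℕ, tau * Complex.cos (2 * (Real.pi : ℂ) * (k : ℂ) / (Nx : ℂ)) ≠ 1)
    {Xlam Xtau : ℂ} (hXlam : IsArcosh Xlam lam⁻¹) (hXtau : IsArcosh Xtau tau⁻¹) (H : SU2) (w : ℂ) :
    IsBoundaryStateValue (Nt := Nt) (Nx := Nx) Nγ horizontalHolonomy (verticalHolonomy H)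
        lam tau w ↔
      w = (2 : ℂ) ^ ((Nt : ℤ) * ((Nx : ℤ) - 2) - (K : ℤ)) /
        ((lam * tau) ^ (Nt * Nx) * Complex.sinh ((1 / 2 : ℂ) * (Nx : ℂ) * Xtau) ^ (2 * Nt)) *
        ((Complex.cosh ((nx : ℂ) * (Nt : ℂ) * Xlam) -
          (((Polynomial.Chebyshev.T ℝ nx).eval (halfTrace H) : ℝ) : ℂ)) ^ K)⁻¹ := by
  obtain ⟨v, mu, hmu, hv⟩ := exists_conj_eq_diagonalSU2 H
  have hnx0 : nx ≠ 0 := by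
    rintro rfl
    exact NeZero.ne Nx (by simpa using hNx)
  have hre : 0 < ((nx : ℂ) * (Nt : ℂ) * Xlam).re := by
    have h1 : (nx : ℂ) * (Nt : ℂ) = ((nx * Nt : ℝ) : ℂ) := by push_cast; rfl
    rw [h1, Complex.re_ofReal_mul]
    have h2 : (0 : ℝ) < nx := by exact_mod_cast Nat.pos_of_ne_zero hnx0
    have h3 : (0 : ℝ) < Nt := by exact_mod_cast NeZero.pos Nt
    have h4 := hXlam.re_pos hlam0 hlam
    positivity
  have hdet := det_one_sub_couplingMatrix_eq (Nt := Nt) (Nx := Nx) Nγ K nx hK hNx hmu hcrit hlam0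
    htau0 hXlam.1 hXtau.1
  rw [← hv, halfTrace_conj] at hdet
  have hs := hXtau.sinh_half_mul_ne_zero (NeZero.ne Nx) htau0 htau
  have hc := cosh_sub_ofReal_ne_zero hre (chebyshev_halfTrace_mem nx H)
  set S := Complex.sinh ((1 / 2 : ℂ) * (Nx : ℂ) * Xtau)
  set D := Complex.cosh ((nx : ℂ) * (Nt : ℂ) * Xlam) -
    (((Polynomial.Chebyshev.T ℝ nx).eval (halfTrace H) : ℝ) : ℂ)
  have h2 : (2 : ℂ) ≠ 0 := two_ne_zero
  have hne : (1 - couplingMatrix Nt Nx Nγ mu lam tau).det ≠ 0 := by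
    rw [hdet]
    positivity
  rw [isBoundaryStateValue_iff Nγ hv hne, hdet]
  have hzpow : (2 : ℂ) ^ ((Nt : ℤ) * ((Nx : ℤ) - 2) - (K : ℤ)) =
      2 ^ (Nt * Nx) / (2 ^ (2 * Nt) * 2 ^ K) := by
    rw [show (Nt : ℤ) * ((Nx : ℤ) - 2) - (K : ℤ) = ((Nt * Nx : ℕ) : ℤ) - ((2 * Nt + K : ℕ) : ℤ) by
      push_cast; ring, zpow_sub₀ h2, zpow_natCast, zpow_natCast, pow_add]
  rw [hzpow]
  refine Eq.congr_right ?_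
  field_simp

end Nodes
end PonzanoRegge

theorem mainTheorem2
    (Nt Nx : ℕ) [NeZero Nt] [NeZero Nx] (Nγ : ℤ) (K nx : ℕ)
    (hK : K = Int.gcd Nγ (Nx : ℤ)) (hNx : Nx = K * nx) (hnx : 2 < nx)
    (lam tau : ℂ) (hcoupling : lam ^ 2 + tau ^ 2 = 1)
    (hlam0 : lam ≠ 0) (htau0 : tau ≠ 0)
    (hlam : ∀ θ : ℝ, lam * Complex.cos (θ : ℂ) ≠ 1)
    (htau : ∀ k : ℕ, tau * Complex.cos (2 * (Real.pi : ℂ) * (k : ℂ) / (Nx : ℂ)) ≠ 1)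
    (Xlam Xtau : ℂ)
    (hXlam : PonzanoRegge.IsArcosh Xlam lam⁻¹) (hXtau : PonzanoRegge.IsArcosh Xtau tau⁻¹) :
    (∀ H : PonzanoRegge.SU2, ∃! v : ℂ,
      PonzanoRegge.IsBoundaryStateValue (Nt := Nt) (Nx := Nx) Nγ
        PonzanoRegge.horizontalHolonomy (PonzanoRegge.verticalHolonomy H) lam tau v) ∧
    MeasureTheory.Integrable
      (fun H : PonzanoRegge.SU2 => PonzanoRegge.boundaryState (Nt := Nt) (Nx := Nx) Nγ
        PonzanoRegge.horizontalHolonomy (PonzanoRegge.verticalHolonomy H) lam tau)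
      PonzanoRegge.haarSU2 ∧
    PonzanoRegge.partitionFunction Nt Nx Nγ lam tau =
      (2 : ℂ) ^ ((Nt : ℤ) * ((Nx : ℤ) - 2) - (K : ℤ)) * (nx : ℂ) ^ K /
        ((lam * tau) ^ (Nt * Nx) *
          Complex.sinh ((1 / 2 : ℂ) * (Nx : ℂ) * Xtau) ^ (2 * Nt) *
          Complex.sinh ((Nt : ℂ) * Xlam) ^ K) *
      (PonzanoRegge.legendre (K - 1)).eval
        (Complex.cosh ((nx : ℂ) * (Nt : ℂ) * Xlam) / Complex.sinh ((nx : ℂ) * (Nt : ℂ) * Xlam)) *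
      ∏ k ∈ (Finset.Icc 1 (Nx - 1)).filter (fun k => ¬ nx ∣ k),
        1 / (2 * (Complex.cosh ((Nt : ℂ) * Xlam) -
          Complex.cos (2 * (Real.pi : ℂ) * (Nγ : ℂ) / (Nx : ℂ) * (k : ℂ) +
            Complex.I * (Nt : ℂ) * Xlam))) ∧
    PonzanoRegge.partitionFunction Nt Nx Nγ lam tau =
      (2 : ℂ) ^ ((Nt : ℤ) * ((Nx : ℤ) - 2) - (K : ℤ)) /
        ((lam * tau) ^ (Nt * Nx) *
          Complex.sinh ((1 / 2 : ℂ) * (Nx : ℂ) * Xtau) ^ (2 * Nt) *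
          Complex.sinh ((nx : ℂ) * (Nt : ℂ) * Xlam) ^ K) *
      (PonzanoRegge.legendre (K - 1)).eval
        (Complex.cosh ((nx : ℂ) * (Nt : ℂ) * Xlam) / Complex.sinh ((nx : ℂ) * (Nt : ℂ) * Xlam)) := by
  classical
  have hKpos : K ≠ 0 := by
    rintro rfl
    exact NeZero.ne Nx (by simpa using hNx)
  have hre : 0 < Xlam.re := hXlam.re_pos hlam0 hlam
  have hreY : 0 < ((Nt : ℂ) * Xlam).re := by
    rw [← Complex.ofReal_natCast, Complex.re_ofReal_mul]
    exact mul_pos (by exact_mod_cast NeZero.pos Nt) hre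
  have hrea : 0 < ((nx : ℂ) * (Nt : ℂ) * Xlam).re := by
    rw [mul_assoc, ← Complex.ofReal_natCast nx, Complex.re_ofReal_mul]
    exact mul_pos (by exact_mod_cast (show 0 < nx by omega)) hreY
  have hiff := PonzanoRegge.isBoundaryStateValue_critical_iff (Nt := Nt) (Nx := Nx) Nγ K nx hK hNx
    hcoupling hlam0 htau0 hlam htau hXlam hXtau
  set a : ℂ := (nx : ℂ) * (Nt : ℂ) * Xlam with ha
  set C : ℂ := (2 : ℂ) ^ ((Nt : ℤ) * ((Nx : ℤ) - 2) - (K : ℤ)) /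
    ((lam * tau) ^ (Nt * Nx) * Complex.sinh ((1 / 2 : ℂ) * (Nx : ℂ) * Xtau) ^ (2 * Nt)) with hC
  -- The boundary state is the function `f` of the Chebyshev polynomial of half the trace.
  let f : ℝ → ℂ := fun x => C * ((Complex.cosh a - (x : ℂ)) ^ K)⁻¹
  have hstate : (fun H : PonzanoRegge.SU2 => PonzanoRegge.boundaryState (Nt := Nt) (Nx := Nx) Nγ
      PonzanoRegge.horizontalHolonomy (PonzanoRegge.verticalHolonomy H) lam tau) =
      fun H => f ((Polynomial.Chebyshev.T ℝ nx).eval (PonzanoRegge.halfTrace H)) :=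
    funext fun H => (hiff H _).1 (Classical.epsilon_spec ⟨_, (hiff H _).2 rfl⟩)
  have hf : ContinuousOn f (Set.Icc (-1) 1) := by
    refine continuousOn_const.mul (ContinuousOn.inv₀ (Continuous.continuousOn ?_) fun x hx => ?_)
    · exact (continuous_const.sub Complex.continuous_ofReal).pow K
    · exact pow_ne_zero K (PonzanoRegge.cosh_sub_ofReal_ne_zero hrea hx)
  have hcont : Continuous fun H : PonzanoRegge.SU2 =>
      f ((Polynomial.Chebyshev.T ℝ nx).eval (PonzanoRegge.halfTrace H)) :=
    hf.comp_continuous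
      ((Polynomial.Chebyshev.T ℝ nx).continuous.comp PonzanoRegge.continuous_halfTrace)
      (PonzanoRegge.chebyshev_halfTrace_mem nx)
  have hZ : PonzanoRegge.partitionFunction Nt Nx Nγ lam tau =
      C * ((PonzanoRegge.legendre (K - 1)).eval (Complex.cosh a / Complex.sinh a) /
        Complex.sinh a ^ K) := by
    have hlap := PonzanoRegge.integral_laplace (K - 1) hrea
    rw [Nat.sub_add_cancel (Nat.one_le_iff_ne_zero.2 hKpos)] at hlap
    rw [PonzanoRegge.partitionFunction, hstate,
      PonzanoRegge.integral_comp_chebyshev_halfTrace hnx hf, ← hlap]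
    simp only [f, intervalIntegral.integral_const_mul, Complex.ofReal_cos]
    ring
  have hsa : Complex.sinh a ≠ 0 := PonzanoRegge.sinh_ne_zero_of_re_pos hrea
  have hsY : Complex.sinh ((Nt : ℂ) * Xlam) ≠ 0 := PonzanoRegge.sinh_ne_zero_of_re_pos hreY
  refine ⟨fun H => ⟨_, (hiff H _).2 rfl, fun w hw => (hiff H w).1 hw⟩, ?_, ?_, ?_⟩
  · rw [hstate]
    exact hcont.integrable_of_hasCompactSupport (HasCompactSupport.of_compactSpace _)
  · -- The product over the Fourier modes turns `sinh (Nt * Xlam)` into `sinh a`.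
    have hprod := PonzanoRegge.prod_modes Nx K nx Nγ hK hNx (NeZero.ne Nx) hsY
    simp only [← mul_assoc] at hprod
    rw [← ha, div_pow, mul_pow] at hprod
    rw [Finset.prod_div_distrib, hprod, Finset.prod_const_one, hZ, hC]
    have hnx0 : (nx : ℂ) ^ K ≠ 0 := pow_ne_zero K (Nat.cast_ne_zero.2 (by omega))
    have hsa' : Complex.sinh a ^ K ≠ 0 := pow_ne_zero K hsa
    have hsY' : Complex.sinh ((Nt : ℂ) * Xlam) ^ K ≠ 0 := pow_ne_zero K hsY
    field_simp
  · rw [hZ, hC]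
    simp only [div_eq_mul_inv, mul_inv]
    ring
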